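/- Let $p>2$ be a prime. Let $BP_*\subset\mathbb Q[m_1,m_2,\dots]$ be the $\mathbb Z_{(p)}$-subalgebra generated by the Araki generators $v_k$, defined by $p\,m_n=\sum_{a+b=n}m_a v_b^{p^a}$ with $m_0=1$, $v_0=p$, and let $(BP_*,BP_*BP)$ be the Brown–Peterson Hopf algebroid: $BP_*BP=BP_*[t_1,t_2,\dots]$ with $\eta_R(m_n)=\sum_{a+b=n}m_a t_b^{p^a}$, $t_0=1$, and with coproduct and conjugation determined by these formulas. Degrees are $|v_k|=|t_k|=2(p^k-1)$. Let $EBP_*=E(\mu_k\mid k\ge 0)\otimes BP_*$ with exterior generators of degree $|\mu_k|=2(p^k-1)+1$, and let $$EBP_*EBP=E(\mu_k)\otimes BP_*BP\otimes E(\eta_R(\mu_k))=E(\mu_k)\otimes BP_*BP\otimes E(\tau_k),\qquad \eta_R(\mu_n)=\sum_{k=0}^n\mu_k t_{n-k}^{p^k}+\tau_n ,$$ be the resulting Hopf algebroid over $EBP_*$ (all algebras are graded-commutative, $\mu_k$ and $\tau_k$ odd). In it $EBP_*EBP\otimes_{EBP_*}EBP_*EBP$ is the exterior algebra over $BP_*BP\otimes_{BP_*}BP_*BP$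 on three families of generators $\mu_k$ (left, middle and right units), and the structure maps are the evident ones on these families. The antiderivation $\partial$ with $\partial\mu_k=v_k$, $\partial\eta_R(\mu_k)=\eta_R(v_k)$, $\partial=0$ on $BP_*BP$, commutes with all structure maps. Then $BP_*BP$ is indeed the polynomial ring $BP_*[t_1,t_2,\dots]$, the products displayed above are isomorphisms, the product map $$H(EBP_*EBP;\partial)\otimes_{H(EBP_*;\partial)}H(EBP_*EBP;\partial)\to H(EBP_*EBP\otimes_{EBP_*}EBP_*EBP;\partial)$$ is bijective, so that $\big(H(EBP_*;\partial),H(EBP_*EBP;\partial)\big)$ inherits the structure of a graded Hopf algebroid, and this Hopf algebroid is isomorphic to the dual Steenrod algebra $(\mathbb F_p,A_*)$: there are degree-preserving ring isomorphisms $H(EBP_*;\partial)\cong\mathbb F_p$ and $H(EBP_*EBP;\partial)\cong A_*$ compatible with both units, the counit, the conjugation and the coproduct. Here $A_*=\mathbb F_p[\xi_1,\xi_2,\dots]\otimes E(\tau_0,\tau_1,\dots)$, $|\xi_n|=2(p^n-1)$, $|\tau_n|=2(p^n-1)+1$, has Milnor's coproduct $$\Delta\xi_n=\sum_{i=0}^n\xi_{n-i}^{p^i}\otimes\xi_i,\qquad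 \Delta\tau_n=\tau_n\otimes 1+\sum_{i=0}^n\xi_{n-i}^{p^i}\otimes\tau_i\qquad(\xi_0=1).$$ -/

import Mathlib

open scoped TensorProduct

noncomputable section

namespace EBPHopf

/-! ## Free graded-commutative algebras and their Koszul differentials -/

/-- The exterior algebra over the commutative ring `R` on generators indexed by `X`. -/
abbrev Ext (R X : Type) [CommRing R] : Type := ExteriorAlgebra R (X →₀ R)

/-- The exterior generator with index `x`. -/
def gen (R : Type) {X : Type} [CommRing R] (x : X) : Ext R X :=
  ExteriorAlgebra.ι R (Finsupp.single x 1)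

/-- The ring homomorphism of exterior algebras that is `f` on coefficients and sends the exterior
generator `x` to the linear combination `c x` of exterior generators. -/
def extMap {R S X Y : Type} [CommRing R] [CommRing S] (f : R →+* S) (c : X → (Y →₀ S)) :
    Ext R X →+* Ext S Y :=
  letI : Algebra R (Ext S Y) := Algebra.compHom _ f
  letI : Module R (Y →₀ S) := Module.compHom _ f
  letI g : (Y →₀ S) →ₗ[R] Ext S Y :=
    { toFun := fun m => ExteriorAlgebra.ι S m
      map_add' := fun a b => map_add _ a b
      map_smul' := fun r a => map_smul (ExteriorAlgebra.ι S) (f r) a }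
  (ExteriorAlgebra.lift R
    ⟨g.comp (Finsupp.linearCombination R c), fun _ => ExteriorAlgebra.ι_sq_zero _⟩).toRingHom

theorem extMap_algebraMap {R S X Y : Type} [CommRing R] [CommRing S] (f : R →+* S)
    (c : X → (Y →₀ S)) (r : R) :
    extMap f c (algebraMap R _ r) = algebraMap S _ (f r) := by
  let : Algebra R (Ext S Y) := Algebra.compHom _ f
  let : Module R (Y →₀ S) := Module.compHom _ f
  exact AlgHom.commutes (ExteriorAlgebra.lift R _) r

theorem extMap_ι {R S X Y : Type} [CommRing R] [CommRing S] (f : R →+* S)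
    (c : X → (Y →₀ S)) (m : X →₀ R) :
    extMap f c (ExteriorAlgebra.ι R m) =
      ExteriorAlgebra.ι S (m.sum fun x r => f r • c x) := by
  let : Algebra R (Ext S Y) := Algebra.compHom _ f
  let : Module R (Y →₀ S) := Module.compHom _ f
  exact ExteriorAlgebra.lift_ι_apply R _ _ m

theorem extMap_gen {R S X Y : Type} [CommRing R] [CommRing S] (f : R →+* S)
    (c : X → (Y →₀ S)) (x : X) :
    extMap f c (gen R x) = ExteriorAlgebra.ι S (c x) := by
  rw [gen, extMap_ι, Finsupp.sum_single_index (by simp), map_one, one_smul]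

/-- The Koszul differential: the `R`-linear antiderivation of the exterior algebra that sends the
generator `x` to the scalar `w x`. -/
def koszul {R X : Type} [CommRing R] (w : X → R) : Ext R X →ₗ[R] Ext R X :=
  CliffordAlgebra.contractLeft (Finsupp.linearCombination R w)

section Koszul

variable {R S X Y : Type} [CommRing R] [CommRing S] (w : X → R) (w' : Y → S)

theorem ext_induction {P : Ext R X → Prop} (h0 : ∀ r : R, P (algebraMap R _ r))
    (hadd : ∀ a b, P a → P b → P (a + b))
    (hmul : ∀ (m : X →₀ R) (a : Ext R X), P a → P (ExteriorAlgebra.ι R m * a)) (z : Ext R X) :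
    P z :=
  CliffordAlgebra.left_induction (Q := (0 : QuadraticForm R (X →₀ R))) (P := P) h0 hadd
    (fun a m ha => hmul m a ha) z

theorem koszul_algebraMap (r : R) : koszul w (algebraMap R _ r) = 0 :=
  CliffordAlgebra.contractLeft_algebraMap (0 : QuadraticForm R (X →₀ R)) _ _

theorem koszul_ι_mul (m : X →₀ R) (z : Ext R X) :
    koszul w (ExteriorAlgebra.ι R m * z) =
      Finsupp.linearCombination R w m • z - ExteriorAlgebra.ι R m * koszul w z :=
  CliffordAlgebra.contractLeft_ι_mul (Q := (0 : QuadraticForm R (X →₀ R))) _ _ _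

theorem koszul_gen (x : X) : koszul w (gen R x) = algebraMap R _ (w x) := by
  have h : koszul w (gen R x) =
      algebraMap R _ (Finsupp.linearCombination R w (Finsupp.single x 1)) :=
    CliffordAlgebra.contractLeft_ι (0 : QuadraticForm R (X →₀ R)) _ _
  rw [h, Finsupp.linearCombination_single, one_smul]

theorem koszul_koszul (z : Ext R X) : koszul w (koszul w z) = 0 := by
  induction z using ext_induction with
  | h0 r => rw [koszul_algebraMap, map_zero]
  | hadd a b ha hb => rw [map_add, map_add, ha, hb, add_zero]
  | hmul m a ha =>
    rw [koszul_ι_mul, map_sub, map_smul, koszul_ι_mul, ha, mul_zero, sub_zero, sub_self]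

/-- The automorphism `x ↦ (-1)^|x| x`. -/
def sign : Ext R X →ₐ[R] Ext R X :=
  CliffordAlgebra.involute (Q := (0 : QuadraticForm R (X →₀ R)))

theorem sign_ι (m : X →₀ R) : sign (ExteriorAlgebra.ι R m) = - ExteriorAlgebra.ι R m :=
  CliffordAlgebra.involute_ι m

theorem sign_sign (z : Ext R X) : sign (sign z) = z :=
  CliffordAlgebra.involute_involute z

/-- The graded Leibniz rule. -/
theorem koszul_mul (x y : Ext R X) :
    koszul w (x * y) = koszul w x * y + sign x * koszul w y := by
  induction x using ext_induction with
  | h0 r =>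
    rw [← Algebra.smul_def, map_smul, koszul_algebraMap, AlgHom.commutes, zero_mul, zero_add,
      Algebra.smul_def]
  | hadd a b ha hb => rw [add_mul, map_add, ha, hb, map_add, map_add]; noncomm_ring
  | hmul m a ha =>
    rw [mul_assoc, koszul_ι_mul, koszul_ι_mul, ha, map_mul, sign_ι, sub_mul, smul_mul_assoc]
    noncomm_ring

theorem koszul_sign (x : Ext R X) : koszul w (sign x) = - sign (koszul w x) := by
  induction x using ext_induction with
  | h0 r => rw [AlgHom.commutes, koszul_algebraMap, map_zero, neg_zero]
  | hadd a b ha hb => rw [map_add, map_add, ha, hb, map_add, map_add]; abel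
  | hmul m a ha =>
    rw [koszul_ι_mul, map_mul, sign_ι, neg_mul, map_neg, koszul_ι_mul, ha, map_sub, map_mul,
      map_smul, sign_ι]
    noncomm_ring

theorem extMap_koszul (f : R →+* S) (c : X → (Y →₀ S))
    (h : ∀ x, Finsupp.linearCombination S w' (c x) = f (w x)) (z : Ext R X) :
    koszul w' (extMap f c z) = extMap f c (koszul w z) := by
  have h' : ∀ m : X →₀ R, Finsupp.linearCombination S w' (m.sum fun x r => f r • c x) =
      f (Finsupp.linearCombination R w m) := by
    intro m
    rw [Finsupp.linearCombination_apply R, map_finsuppSum, map_finsuppSum]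
    refine Finsupp.sum_congr fun x _ => ?_
    rw [map_smul, h, smul_eq_mul, smul_eq_mul, map_mul]
  induction z using ext_induction with
  | h0 r => rw [koszul_algebraMap, extMap_algebraMap, koszul_algebraMap, map_zero]
  | hadd a b ha hb => rw [map_add, map_add, ha, hb, map_add, map_add]
  | hmul m a ha =>
    rw [koszul_ι_mul, map_mul, extMap_ι, koszul_ι_mul, ha, map_sub, map_mul, extMap_ι, h',
      Algebra.smul_def, Algebra.smul_def, map_mul, extMap_algebraMap]

/-- The subring of cycles. -/
def cycles : Subring (Ext R X) where
  carrier := {z | koszul w z = 0}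
  zero_mem' := map_zero _
  one_mem' := by simpa using koszul_algebraMap w (1 : R)
  add_mem' := fun {a b} ha hb => by
    rw [Set.mem_ofPred_eq] at ha hb ⊢; rw [map_add, ha, hb, add_zero]
  neg_mem' := fun {a} ha => by
    rw [Set.mem_ofPred_eq] at ha ⊢; rw [map_neg, ha, neg_zero]
  mul_mem' := fun {a b} ha hb => by
    rw [Set.mem_ofPred_eq] at ha hb ⊢; rw [koszul_mul, ha, hb, zero_mul, mul_zero, add_zero]

/-- The boundaries, an ideal in the ring of cycles. -/
def boundaries : Ideal (cycles w) where
  carrier := {z | ∃ y, koszul w y = z}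
  zero_mem' := ⟨0, map_zero _⟩
  add_mem' := by
    rintro a b ⟨x, hx⟩ ⟨y, hy⟩
    exact ⟨x + y, by rw [map_add, hx, hy]; rfl⟩
  smul_mem' := by
    rintro ⟨c, hc⟩ a ⟨x, hx⟩
    have hc' : koszul w c = 0 := hc
    refine ⟨sign c * x, ?_⟩
    rw [koszul_mul, koszul_sign, hc', map_zero, neg_zero, zero_mul, zero_add,
      sign_sign, hx]
    rfl

instance : (boundaries w).IsTwoSided where
  mul_mem_of_left := by
    rintro a ⟨b, hb⟩ ⟨x, hx⟩
    have hb' : koszul w b = 0 := hb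
    refine ⟨x * b, ?_⟩
    rw [koszul_mul, hb', mul_zero, add_zero, hx]
    rfl

/-- The homology ring, cycles modulo boundaries. -/
abbrev Homology : Type := cycles w ⧸ boundaries w

/-- The map that `extMap f c` induces on homology, when it commutes with the differentials. -/
def homologyMap (f : R →+* S) (c : X → (Y →₀ S))
    (h : ∀ x, Finsupp.linearCombination S w' (c x) = f (w x)) : Homology w →+* Homology w' :=
  Ideal.Quotient.lift (boundaries w)
    ((Ideal.Quotient.mk (boundaries w')).comp
      (((extMap f c).comp (cycles w).subtype).codRestrict (cycles w') (fun z => by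
        have hz : koszul w (z : Ext R X) = 0 := z.2
        show koszul w' (extMap f c (z : Ext R X)) = 0
        rw [extMap_koszul w w' f c h, hz, map_zero])))
    (by
      rintro z ⟨y, hy⟩
      refine Ideal.Quotient.eq_zero_iff_mem.mpr ⟨extMap f c y, ?_⟩
      rw [extMap_koszul w w' f c h, hy]
      rfl)

/-- The classes in homology of the cycles in an additive subgroup. -/
def homologyClasses (G : AddSubgroup (Ext R X)) : AddSubgroup (Homology w) :=
  (G.comap (cycles w).subtype.toAddMonoidHom).map
    (Ideal.Quotient.mk (boundaries w)).toAddMonoidHom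

end Koszul

/-- The elements of degree `d` of a ring with a set `G` of pairs
(degree of a generator, generator): the sums of products of generators of total degree `d`. -/
def degreePart {A : Type} [Ring A] (G : Set (ℕ × A)) (d : ℕ) : AddSubgroup A :=
  AddSubgroup.closure {a | ∃ l : List (ℕ × A), (∀ g ∈ l, g ∈ G) ∧
    (l.map Prod.fst).sum = d ∧ (l.map Prod.snd).prod = a}

/-! ## Tensor products over a noncommutative ring, Hopf algebroids -/

/-- The relations `x r(b) ⊗ y = x ⊗ l(b) y`. -/
def tensorRel {B X Y : Type} [Ring B] [Ring X] [Ring Y] (r : B →+* X) (l : B →+* Y) :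
    AddSubgroup (X ⊗[ℤ] Y) :=
  AddSubgroup.closure {z | ∃ x b y, z = (x * r b) ⊗ₜ[ℤ] y - x ⊗ₜ[ℤ] (l b * y)}

/-- `X ⊗_B Y`, where `B` acts on `X` from the right through `r` and on `Y` from the left
through `l`. -/
abbrev TensorOver {B X Y : Type} [Ring B] [Ring X] [Ring Y] (r : B →+* X) (l : B →+* Y) : Type :=
  (X ⊗[ℤ] Y) ⧸ tensorRel r l

/-- The map `X ⊗_B Y → T`, `x ⊗ y ↦ i(x) j(y)`, for ring homomorphisms `i`, `j` that agree
on `B`. -/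
def tensorOverMap {B X Y T : Type} [Ring B] [Ring X] [Ring Y] [Ring T] (r : B →+* X)
    (l : B →+* Y) (i : X →+* T) (j : Y →+* T) (h : i.comp r = j.comp l) :
    TensorOver r l →+ T :=
  QuotientAddGroup.lift (tensorRel r l)
    (TensorProduct.lift ((LinearMap.mul ℤ T).compl₁₂
      i.toAddMonoidHom.toIntLinearMap j.toAddMonoidHom.toIntLinearMap)).toAddMonoidHom
    ((AddSubgroup.closure_le _).mpr (by
      rintro _ ⟨x, b, y, rfl⟩
      have hb : i (r b) = j (l b) := RingHom.congr_fun h b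
      simp [hb, mul_assoc]))

theorem tensorOverMap_tmul {B X Y T : Type} [Ring B] [Ring X] [Ring Y] [Ring T] (r : B →+* X)
    (l : B →+* Y) (i : X →+* T) (j : Y →+* T) (h : i.comp r = j.comp l) (x : X) (y : Y) :
    tensorOverMap r l i j h (QuotientAddGroup.mk (x ⊗ₜ[ℤ] y)) = i x * j y := rfl

/-- The structure maps of a graded Hopf algebroid `(Base, Total)`.  The target of the coproduct,
`Total ⊗_Base Total` with its graded multiplication, is given as a ring `Square` with the two
inclusions `x ↦ x ⊗ 1` and `y ↦ 1 ⊗ y`; see `IsTensorSquare`. -/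
structure HopfData where
  Base : Type
  Total : Type
  Square : Type
  [ringBase : Ring Base]
  [ringTotal : Ring Total]
  [ringSquare : Ring Square]
  /-- The elements of a given degree. -/
  degBase : ℕ → AddSubgroup Base
  degTotal : ℕ → AddSubgroup Total
  degSquare : ℕ → AddSubgroup Square
  leftUnit : Base →+* Total
  rightUnit : Base →+* Total
  counit : Total →+* Base
  conj : Total →+* Total
  inl : Total →+* Square
  inr : Total →+* Square
  comul : Total →+* Square
  compat : inl.comp rightUnit = inr.comp leftUnit

attribute [instance] HopfData.ringBase HopfData.ringTotal HopfData.ringSquare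

/-- `x ⊗ y ↦ (x ⊗ 1)(1 ⊗ y)` is a bijection from `Total ⊗_Base Total` to `Square`, so that
`comul` is a coproduct `Total → Total ⊗_Base Total`. -/
def HopfData.IsTensorSquare (H : HopfData) : Prop :=
  Function.Bijective (tensorOverMap H.rightUnit H.leftUnit H.inl H.inr H.compat)

/-- An isomorphism of graded Hopf algebroids. -/
structure HopfData.Iso (H K : HopfData) where
  base : H.Base ≃+* K.Base
  total : H.Total ≃+* K.Total
  square : H.Square ≃+* K.Square
  base_deg : ∀ d x, base x ∈ K.degBase d ↔ x ∈ H.degBase d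
  total_deg : ∀ d x, total x ∈ K.degTotal d ↔ x ∈ H.degTotal d
  square_deg : ∀ d x, square x ∈ K.degSquare d ↔ x ∈ H.degSquare d
  leftUnit : ∀ b, total (H.leftUnit b) = K.leftUnit (base b)
  rightUnit : ∀ b, total (H.rightUnit b) = K.rightUnit (base b)
  counit : ∀ x, base (H.counit x) = K.counit (total x)
  conj : ∀ x, total (H.conj x) = K.conj (total x)
  inl : ∀ x, square (H.inl x) = K.inl (total x)
  inr : ∀ x, square (H.inr x) = K.inr (total x)
  comul : ∀ x, square (H.comul x) = K.comul (total x)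

/-! ## The Brown-Peterson Hopf algebroid

For a finite index set `I` the rational homotopy of the smash power of `BP` over `I` is the
polynomial ring on one family `m_1, m_2, …` of logarithm coefficients for each `i : I`, and a map
`I → J` acts by renaming the families.  For `I` with one, two, three elements this is the
rationalization of `BP_*`, `BP_*BP`, `BP_*BP ⊗_{BP_*} BP_*BP`. -/

section BP

variable (p : ℕ) {I J L : Type}

/-- The coefficient `m_n` of the logarithm of the family `i`, with `m_0 = 1`. -/
def logCoeff (i : I) : ℕ → MvPolynomial (I × ℕ) ℚ
  | 0 => 1
  | n + 1 => MvPolynomial.X (i, n)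

/-- The Araki elements of the family `i`:
`p m_n = ∑_{a + b = n} m_a v_b^{p^a}`; in particular `v_0 = p`. -/
def araki (i : I) (n : ℕ) : MvPolynomial (I × ℕ) ℚ :=
  (p : MvPolynomial (I × ℕ) ℚ) * logCoeff i n -
    ∑ a : Fin n, logCoeff i (a + 1) * araki i (n - (a + 1)) ^ p ^ (a + 1 : ℕ)
termination_by n
decreasing_by omega

/-- The coefficients of the strict isomorphism between the formal group laws of the families
`i` and `j`: `m_n^{(j)} = ∑_{a + b = n} m_a^{(i)} t_b^{p^a}`; in particular `t_0 = 1`. -/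
def transition (i j : I) (n : ℕ) : MvPolynomial (I × ℕ) ℚ :=
  logCoeff j n -
    ∑ a : Fin n, logCoeff i (a + 1) * transition i j (n - (a + 1)) ^ p ^ (a + 1 : ℕ)
termination_by n
decreasing_by omega

/-- Generators over the integers: the elements of `ℤ_(p)`, all `v_n` and all `t_n`. -/
def bpGens (I : Type) : Set (MvPolynomial (I × ℕ) ℚ) :=
  {x | ∃ q : ℚ, ¬ p ∣ q.den ∧ MvPolynomial.C q = x} ∪
    {x | ∃ i n, araki p i n = x} ∪ {x | ∃ i j n, transition p i j n = x}

/-- The homotopy ring of the smash power of `BP` over `I`, as a subring of its rationalization.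
For one index this is `BP_* = ℤ_(p)[v_1, v_2, …]`, for two indices it is
`BP_*BP = BP_*[t_1, t_2, …]`, generated by the images of the two units and by the `t_n` and their
conjugates. -/
def bp (I : Type) : Subring (MvPolynomial (I × ℕ) ℚ) := Subring.closure (bpGens p I)

/-- `p m_n = ∑_{a + b = n} m_a v_b^{p^a}`. -/
theorem araki_spec (i : I) (n : ℕ) :
    ∑ a ∈ Finset.range (n + 1), logCoeff i a * araki p i (n - a) ^ p ^ a =
      (p : MvPolynomial (I × ℕ) ℚ) * logCoeff i n := by
  rw [Finset.sum_range_succ', araki, Finset.sum_range]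
  simp [logCoeff]

/-- `m_n^{(j)} = ∑_{a + b = n} m_a^{(i)} t_b^{p^a}`. -/
theorem transition_spec (i j : I) (n : ℕ) :
    ∑ a ∈ Finset.range (n + 1), logCoeff i a * transition p i j (n - a) ^ p ^ a =
      logCoeff j n := by
  rw [Finset.sum_range_succ', transition, Finset.sum_range]
  simp [logCoeff]

theorem rename_logCoeff (f : I → J) (i : I) (n : ℕ) :
    MvPolynomial.rename (Prod.map f id) (logCoeff i n) = logCoeff (f i) n := by
  cases n <;> simp [logCoeff]

theorem rename_araki (f : I → J) (i : I) (n : ℕ) :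
    MvPolynomial.rename (Prod.map f id) (araki p i n) = araki p (f i) n := by
  induction n using Nat.strong_induction_on with
  | _ n ih =>
    rw [araki, araki, map_sub, map_mul, map_natCast, rename_logCoeff, map_sum]
    congr 1
    refine Finset.sum_congr rfl fun a _ => ?_
    rw [map_mul, map_pow, rename_logCoeff, ih _ (by have := a.2; omega)]

theorem rename_transition (f : I → J) (i j : I) (n : ℕ) :
    MvPolynomial.rename (Prod.map f id) (transition p i j n) = transition p (f i) (f j) n := by
  induction n using Nat.strong_induction_on with
  | _ n ih =>
    rw [transition, transition, map_sub, rename_logCoeff, map_sum]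
    congr 1
    refine Finset.sum_congr rfl fun a _ => ?_
    rw [map_mul, map_pow, rename_logCoeff, ih _ (by have := a.2; omega)]

theorem rename_mem_bp (f : I → J) (x : bp p I) :
    MvPolynomial.rename (Prod.map f id) (x : MvPolynomial (I × ℕ) ℚ) ∈ bp p J := by
  have h : bp p I ≤
      (bp p J).comap (MvPolynomial.rename (R := ℚ) (Prod.map f (id : ℕ → ℕ))).toRingHom := by
    refine Subring.closure_le.mpr ?_
    rintro x ((⟨q, hq, rfl⟩ | ⟨i, n, rfl⟩) | ⟨i, j, n, rfl⟩)
    · refine Subring.subset_closure (Or.inl (Or.inl ⟨q, hq, ?_⟩))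
      exact (MvPolynomial.rename_C _ _).symm
    · exact Subring.subset_closure (Or.inl (Or.inr ⟨f i, n, (rename_araki p f i n).symm⟩))
    · exact Subring.subset_closure (Or.inr ⟨f i, f j, n, (rename_transition p f i j n).symm⟩)
  exact h x.2

/-- The ring homomorphism that a map of index sets induces. -/
def bpMap (f : I → J) : bp p I →+* bp p J :=
  (((MvPolynomial.rename (R := ℚ) (Prod.map f (id : ℕ → ℕ))).toRingHom).comp
    (bp p I).subtype).codRestrict (bp p J) (rename_mem_bp p f)

/-- The `n`-th Araki generator of the family `i`. -/
def v (i : I) (n : ℕ) : bp p I :=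
  ⟨araki p i n, Subring.subset_closure (Or.inl (Or.inr ⟨i, n, rfl⟩))⟩

/-- The generator `t_n` from the family `i` to the family `j`. -/
def t (i j : I) (n : ℕ) : bp p I :=
  ⟨transition p i j n, Subring.subset_closure (Or.inr ⟨i, j, n, rfl⟩)⟩

theorem bpMap_v (f : I → J) (i : I) (n : ℕ) : bpMap p f (v p i n) = v p (f i) n :=
  Subtype.ext (rename_araki p f i n)

/-! ## `EBP`

`EBP` adjoins to each factor `BP` exterior generators `μ_0, μ_1, …`. -/

/-- For `I` with one, two, three elements: `EBP_*`, `EBP_*EBP = E(μ_k) ⊗ BP_*BP ⊗ E(μ_k)`,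
`EBP_*EBP ⊗_{EBP_*} EBP_*EBP`. -/
abbrev EBP (I : Type) : Type := Ext (bp p I) (I × ℕ)

/-- The differential is determined by `∂ μ_k = v_k` for each family. -/
def vFun (I : Type) : I × ℕ → bp p I := fun x => v p x.1 x.2

/-- The differential on `EBP`. -/
abbrev del (I : Type) : EBP p I →ₗ[bp p I] EBP p I := koszul (vFun p I)

/-- Generators with their degrees: `ℤ_(p)` in degree `0`, `v_k` and `t_k` in degree
`2 (p^k - 1)`, `μ_k` in degree `2 (p^k - 1) + 1`. -/
def ebpGens (I : Type) : Set (ℕ × EBP p I) :=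
  {x | ∃ c : bp p I,
      (∃ q : ℚ, ¬ p ∣ q.den ∧ MvPolynomial.C q = (c : MvPolynomial (I × ℕ) ℚ)) ∧
      x = (0, algebraMap (bp p I) (EBP p I) c)} ∪
    {x | ∃ (i : I) (k : ℕ), x = (2 * (p ^ k - 1), algebraMap (bp p I) (EBP p I) (v p i k))} ∪
    {x | ∃ (i j : I) (k : ℕ),
      x = (2 * (p ^ k - 1), algebraMap (bp p I) (EBP p I) (t p i j k))} ∪
    {x | ∃ (i : I) (k : ℕ), x = (2 * (p ^ k - 1) + 1, gen (bp p I) (i, k))}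

/-- A map of index sets renames the generators `μ_k`. -/
def muMap (f : I → J) : I × ℕ → (J × ℕ →₀ bp p J) := fun x => Finsupp.single (f x.1, x.2) 1

/-- The ring homomorphism that a map of index sets induces on `EBP`. -/
def ebpMap (f : I → J) : EBP p I →+* EBP p J := extMap (bpMap p f) (muMap p f)

theorem muMap_compat (f : I → J) (x : I × ℕ) :
    Finsupp.linearCombination (bp p J) (vFun p J) (muMap p f x) = bpMap p f (vFun p I x) := by
  rw [muMap, Finsupp.linearCombination_single, one_smul]
  exact (bpMap_v p f x.1 x.2).symm

/-- The ring homomorphisms `ebpMap` commute with the differentials. -/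
theorem del_ebpMap (f : I → J) (z : EBP p I) :
    del p J (ebpMap p f z) = ebpMap p f (del p I z) :=
  extMap_koszul _ _ _ _ (muMap_compat p f) z

/-- The homology of `EBP` with respect to the differential. -/
abbrev HEBP (I : Type) : Type := Homology (vFun p I)

/-- The map that a map of index sets induces on the homology of `EBP`. -/
def hebpMap (f : I → J) : HEBP p I →+* HEBP p J :=
  homologyMap (vFun p I) (vFun p J) (bpMap p f) (muMap p f) (muMap_compat p f)

theorem ebpMap_comp (f : I → J) (g : J → L) (z : EBP p I) :
    ebpMap p g (ebpMap p f z) = ebpMap p (g ∘ f) z := by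
  have hb : ∀ r : bp p I, bpMap p g (bpMap p f r) = bpMap p (g ∘ f) r := by
    intro r
    refine Subtype.ext ?_
    show MvPolynomial.rename _ (MvPolynomial.rename _ (r : MvPolynomial (I × ℕ) ℚ)) =
      MvPolynomial.rename _ (r : MvPolynomial (I × ℕ) ℚ)
    rw [MvPolynomial.rename_rename]
    rfl
  have hm : ∀ m : I × ℕ →₀ bp p I,
      ((m.sum fun x r => bpMap p f r • muMap p f x).sum fun x r => bpMap p g r • muMap p g x) =
        m.sum fun x r => bpMap p (g ∘ f) r • muMap p (g ∘ f) x := by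
    intro m
    rw [Finsupp.sum_sum_index (by simp) (by intros; rw [map_add, add_smul])]
    refine Finsupp.sum_congr fun x _ => ?_
    simp [muMap, Finsupp.sum_single_index, hb]
  induction z using ext_induction with
  | h0 r => simp only [ebpMap, extMap_algebraMap, hb]
  | hadd a b ha hb => rw [map_add, map_add, ha, hb, map_add]
  | hmul m a ha =>
    rw [map_mul, map_mul, map_mul, ha]
    congr 1
    simp only [ebpMap, extMap_ι, hm]

theorem hebpMap_comp (f : I → J) (g : J → L) (z : HEBP p I) :
    hebpMap p g (hebpMap p f z) = hebpMap p (g ∘ f) z := by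
  obtain ⟨z, rfl⟩ := Ideal.Quotient.mk_surjective z
  refine congrArg (Ideal.Quotient.mk (boundaries (vFun p L))) (Subtype.ext ?_)
  exact ebpMap_comp p f g z

/-- The Hopf algebroid `(EBP_*, EBP_*EBP)`.  The index `0` of `Fin 2` stands for the left factor
and the index `1` for the right factor. -/
def coopHopf : HopfData where
  Base := EBP p (Fin 1)
  Total := EBP p (Fin 2)
  Square := EBP p (Fin 3)
  degBase := degreePart (ebpGens p (Fin 1))
  degTotal := degreePart (ebpGens p (Fin 2))
  degSquare := degreePart (ebpGens p (Fin 3))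
  leftUnit := ebpMap p ![0]
  rightUnit := ebpMap p ![1]
  counit := ebpMap p ![0, 0]
  conj := ebpMap p ![1, 0]
  inl := ebpMap p ![0, 1]
  inr := ebpMap p ![1, 2]
  comul := ebpMap p ![0, 2]
  compat := by
    ext z
    rw [RingHom.comp_apply, RingHom.comp_apply, ebpMap_comp, ebpMap_comp]
    congr 2
    ext i
    fin_cases i
    rfl

/-- The homology of `(EBP_*, EBP_*EBP)` with respect to the differential, with the structure maps
induced from those of `coopHopf`. -/
def homologyHopf : HopfData where
  Base := HEBP p (Fin 1)
  Total := HEBP p (Fin 2)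
  Square := HEBP p (Fin 3)
  degBase := fun d => homologyClasses _ (degreePart (ebpGens p (Fin 1)) d)
  degTotal := fun d => homologyClasses _ (degreePart (ebpGens p (Fin 2)) d)
  degSquare := fun d => homologyClasses _ (degreePart (ebpGens p (Fin 3)) d)
  leftUnit := hebpMap p ![0]
  rightUnit := hebpMap p ![1]
  counit := hebpMap p ![0, 0]
  conj := hebpMap p ![1, 0]
  inl := hebpMap p ![0, 1]
  inr := hebpMap p ![1, 2]
  comul := hebpMap p ![0, 2]
  compat := by
    refine RingHom.ext fun z => ?_
    rw [RingHom.comp_apply, RingHom.comp_apply, hebpMap_comp, hebpMap_comp]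
    congr 2
    ext i
    fin_cases i
    rfl

/-- The map `BP_*[t_1, t_2, …] → BP_*BP`. -/
def tPoly : MvPolynomial ℕ (bp p (Fin 1)) →+* bp p (Fin 2) :=
  MvPolynomial.eval₂Hom (bpMap p ![0]) (fun k => t p 0 1 (k + 1))

/-- `τ_n = η_R(μ_n) - ∑_{k ≤ n} μ_k t_{n-k}^{p^k}`, as a combination of the generators
`μ_k = (0, k)` and `η_R(μ_k) = (1, k)`. -/
def tau (n : ℕ) : Fin 2 × ℕ →₀ bp p (Fin 2) :=
  Finsupp.single (1, n) 1 -
    ∑ k ∈ Finset.range (n + 1), Finsupp.single (0, k) (t p 0 1 (n - k) ^ p ^ k)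

/-- The map `E(μ_k) ⊗ BP_*BP ⊗ E(τ_k) → EBP_*EBP`; the source has the exterior generators
`μ_k = (0, k)` and `τ_k = (1, k)`. -/
def muTau : Ext (bp p (Fin 2)) (Fin 2 × ℕ) →+* EBP p (Fin 2) :=
  extMap (RingHom.id _) (fun x => if x.1 = 0 then Finsupp.single (0, x.2) 1 else tau p x.2)

end BP

/-! ## The dual Steenrod algebra at an odd prime -/

section Steenrod

variable (p : ℕ)

/-- The polynomial ring over `F_p` on one family `ξ_1, ξ_2, …` for each `i : I`. -/
abbrev XiRing (I : Type) : Type := MvPolynomial (I × ℕ) (ZMod p)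

/-- `ξ_n` of the family `i`, with `ξ_0 = 1`. -/
def xi {I : Type} (i : I) : ℕ → XiRing p I
  | 0 => 1
  | n + 1 => MvPolynomial.X (i, n)

/-- For `I` with one element: the algebra `A_* = F_p[ξ_1, ξ_2, …] ⊗ E(τ_0, τ_1, …)`.  For
`I = Fin 2`: the graded-commutative algebra `A_* ⊗ A_*`, the family `0` being that of the left
factor. -/
abbrev Milnor (I : Type) : Type := Ext (XiRing p I) (I × ℕ)

/-- Generators with their degrees: `|ξ_k| = 2 (p^k - 1)`, `|τ_k| = 2 (p^k - 1) + 1`. -/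
def milnorGens (I : Type) : Set (ℕ × Milnor p I) :=
  {x | ∃ c : ZMod p, x = (0, algebraMap (XiRing p I) (Milnor p I) (MvPolynomial.C c))} ∪
    {x | ∃ (i : I) (k : ℕ), x = (2 * (p ^ k - 1), algebraMap (XiRing p I) (Milnor p I) (xi p i k))} ∪
    {x | ∃ (i : I) (k : ℕ), x = (2 * (p ^ k - 1) + 1, gen (XiRing p I) (i, k))}

/-- The inclusions of the factors of `A_* ⊗ A_*`. -/
def milnorMap {I J : Type} (f : I → J) : Milnor p I →+* Milnor p J :=
  extMap (MvPolynomial.rename (R := ZMod p) (Prod.map f (id : ℕ → ℕ))).toRingHom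
    (fun x => Finsupp.single (f x.1, x.2) 1)

/-- The unit `F_p → A_*`. -/
def milnorUnit : ZMod p →+* Milnor p (Fin 1) :=
  (algebraMap (XiRing p (Fin 1)) (Milnor p (Fin 1))).comp MvPolynomial.C

/-- The counit, zero on all `ξ_n`, `n ≥ 1`, and all `τ_n`. -/
def milnorCounit : Milnor p (Fin 1) →+* ZMod p :=
  (MvPolynomial.constantCoeff).comp
    (ExteriorAlgebra.algebraMapInv (R := XiRing p (Fin 1)) (M := Fin 1 × ℕ →₀ XiRing p (Fin 1))).toRingHom

/-- Milnor's coproduct, `Δ ξ_n = ∑ ξ_{n-i}^{p^i} ⊗ ξ_i` and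
`Δ τ_n = τ_n ⊗ 1 + ∑ ξ_{n-i}^{p^i} ⊗ τ_i`. -/
def milnorComul : Milnor p (Fin 1) →+* Milnor p (Fin 2) :=
  extMap
    (MvPolynomial.eval₂Hom MvPolynomial.C fun x =>
      ∑ i ∈ Finset.range (x.2 + 1 + 1), xi p 0 (x.2 + 1 - i) ^ p ^ i * xi p 1 i)
    (fun x => Finsupp.single (0, x.2) 1 +
      ∑ i ∈ Finset.range (x.2 + 1), Finsupp.single (1, i) (xi p 0 (x.2 - i) ^ p ^ i))

/-- The conjugates of the `ξ_n`: `∑_{i ≤ n} ξ_{n-i}^{p^i} c(ξ_i) = 0` for `n ≥ 1`. -/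
def conjXi (n : ℕ) : XiRing p (Fin 1) :=
  if n = 0 then 1 else - ∑ i : Fin n, xi p 0 (n - i) ^ p ^ (i : ℕ) * conjXi i
termination_by n
decreasing_by exact i.2

/-- The conjugates of the `τ_n`: `τ_n + ∑_{i ≤ n} ξ_{n-i}^{p^i} c(τ_i) = 0`. -/
def conjTau (n : ℕ) : Fin 1 × ℕ →₀ XiRing p (Fin 1) :=
  - Finsupp.single (0, n) 1 - ∑ i : Fin n, (xi p 0 (n - i) ^ p ^ (i : ℕ) : XiRing p (Fin 1)) • conjTau i
termination_by n
decreasing_by exact i.2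

/-- The conjugation of `A_*`. -/
def milnorConj : Milnor p (Fin 1) →+* Milnor p (Fin 1) :=
  extMap (MvPolynomial.eval₂Hom MvPolynomial.C fun x => conjXi p (x.2 + 1))
    (fun x => conjTau p x.2)

/-- The dual Steenrod algebra `A_*` at an odd prime `p`, a Hopf algebra over `F_p`. -/
def dualSteenrod : HopfData where
  Base := ZMod p
  Total := Milnor p (Fin 1)
  Square := Milnor p (Fin 2)
  degBase := degreePart {x | x.1 = 0}
  degTotal := degreePart (milnorGens p (Fin 1))
  degSquare := degreePart (milnorGens p (Fin 2))
  leftUnit := milnorUnit p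
  rightUnit := milnorUnit p
  counit := milnorCounit p
  conj := milnorConj p
  inl := milnorMap p ![0]
  inr := milnorMap p ![1]
  comul := milnorComul p
  compat := by
    refine RingHom.ext fun z => ?_
    simp [milnorUnit, milnorMap, extMap_algebraMap]

end Steenrod

end EBPHopf

end

noncomputable section

namespace EBPHopf

/-! ## Bases of exterior algebras -/

section ExtBasis

variable {R S U X Y Z : Type} [CommRing R] [CommRing S] [CommRing U]

/-! With families `0, …, k`, the complex `EBP p (Fin (k + 1))` is a Koszul complex over `bp p (Fin
(k + 1))`. The Araki generators `v_0 = p, v_1, …` of the last family form a regular sequence, and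
those of every other family lie in the ideal `J` that this sequence generates. Hence each `μ_n` of
another family becomes a cycle after a combination of the last-family `μ_i` is added, and the
homology is `bp / J` tensored with an exterior algebra on the corrected generators (`koszul_exact`,
`exists_del_eq`). Since `bp / J` is polynomial over `F_p` on the transition coefficients from family
`j + 1` to family `j`, the homology is `F_p`, `A_*`, `A_* ⊗ A_*` for `k = 0, 1, 2`.

Behind this lies the fact that `bp` is a polynomial ring over `ℤ_(p)` on the Araki generators at the
root of a tree of families and the transition coefficients along its edges (`bpParam`). Rationally
this is a change of variables; integrally it is the functional equation lemma: all logarithms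
satisfy one and the same functional equation with integral coefficients, which forces the remaining
`v_n` and `t_n` to be integral (`exists_functional_equation`, `feDefect_twConv_mem`,
`mem_of_feDefect_twConv`). Powers of `J` are detected by multiplying the root variables by `p`: an
element lies in the `r`-th power of `J` exactly if `p ^ r` divides its image under `scale`. After
this scaling the logarithms themselves are integral, which yields the invariance of `J`, the
composition law of the `t_n` modulo `J`, and the right unit formula modulo the square of `J`.

The class `ξ_n` is that of `t_n` from the right family to the left one, so the composition law is
Milnor's coproduct in Milnor's order. The class `τ_n` is that of `tauCycle`: the right unit formula
holds modulo the square of `J`, so the correction needed to get a cycle has coefficients in `J` and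
is invisible after reduction. These classes generate, so each compatibility is checked on them
(`hebp_ringHom_ext`). The tensor squares over `EBP_*` and `F_p` come from explicit bases
(`tensorOverMap_bijective`); the one for homology is transported from `A_*` along the isomorphism.
-/

theorem ι_mem_closure_gen (m : X →₀ R) :
    ExteriorAlgebra.ι R m = m.sum fun x r => algebraMap R _ r * gen R x := by
  conv_lhs => rw [← Finsupp.sum_single m]
  rw [map_finsuppSum]
  refine Finsupp.sum_congr fun x _ => ?_
  rw [gen, ← Algebra.smul_def, ← map_smul, Finsupp.smul_single, smul_eq_mul, mul_one]

theorem ext_ringHom {T : Type} [Semiring T] {g h : Ext R X →+* T}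
    (h0 : ∀ r : R, g (algebraMap R _ r) = h (algebraMap R _ r))
    (h1 : ∀ x, g (gen R x) = h (gen R x)) : g = h := by
  ext z
  induction z using ext_induction with
  | h0 r => exact h0 r
  | hadd a b ha hb => rw [map_add, map_add, ha, hb]
  | hmul m a ha =>
    rw [map_mul, map_mul, ha, ι_mem_closure_gen, map_finsuppSum, map_finsuppSum]
    simp only [map_mul, h0, h1]

theorem extMap_extMap (f : R →+* S) (c : X → (Y →₀ S)) (g : S →+* U) (d : Y → (Z →₀ U))
    (z : Ext R X) :
    extMap g d (extMap f c z) =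
      extMap (g.comp f) (fun x => (c x).sum fun y r => g r • d y) z := by
  have : (extMap g d).comp (extMap f c) =
      extMap (g.comp f) (fun x => (c x).sum fun y r => g r • d y) := by
    refine ext_ringHom (fun r => ?_) (fun x => ?_)
    · simp only [RingHom.comp_apply, extMap_algebraMap]
    · simp only [RingHom.comp_apply, extMap_gen, extMap_ι]
  exact RingHom.congr_fun this z

theorem extMap_single_gen (f : R →+* S) (g : X → Y) (x : X) :
    extMap f (fun x => Finsupp.single (g x) 1) (gen R x) = gen S (g x) := by
  rw [extMap_gen]; rfl

theorem extMap_single_id : extMap (RingHom.id R) (fun x : X => Finsupp.single x 1) =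
    RingHom.id _ := by
  refine ext_ringHom (fun r => ?_) (fun x => ?_)
  · rw [extMap_algebraMap]; rfl
  · rw [extMap_gen]; rfl

theorem extMap_smul (f : R →+* S) (c : X → (Y →₀ S)) (r : R) (z : Ext R X) :
    extMap f c (r • z) = f r • extMap f c z := by
  rw [Algebra.smul_def, map_mul, extMap_algebraMap, Algebra.smul_def]

theorem extMap_list_prod (f : R →+* S) (g : X → Y) (l : List X) :
    extMap f (fun x => Finsupp.single (g x) 1) (l.map (gen R)).prod =
      ((l.map g).map (gen S)).prod := by
  rw [map_list_prod, List.map_map, List.map_map]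
  congr 1
  refine List.map_congr_left fun x _ => ?_
  simp only [Function.comp_apply, extMap_single_gen]

/-- Products of generators over duplicate-free lists are, up to sign, the standard basis. -/
theorem exists_sign_list_gen_prod [LinearOrder X] (l : List X) (hl : l.Nodup) :
    ∃ u : ℤˣ, (l.map (gen R)).prod =
      u • (Finsupp.basisSingleOne (R := R) (ι := X)).ExteriorAlgebra l.toFinset := by
  induction l with
  | nil =>
    refine ⟨1, ?_⟩
    rw [one_smul, List.map_nil, List.prod_nil, List.toFinset_nil,
      ExteriorAlgebra.basis_apply_ofCard _ (n := 0) Finset.card_empty]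
    simp
  | cons a l ih =>
    obtain ⟨ha, hl⟩ := List.nodup_cons.mp hl
    obtain ⟨u, hu⟩ := ih hl
    have h1 : gen R a =
        (Finsupp.basisSingleOne (R := R) (ι := X)).ExteriorAlgebra {a} := by
      rw [ExteriorAlgebra.basis_apply_ofCard _ (n := 1) (Finset.card_singleton a)]
      have h2 : Set.powersetCard.ofFinEmbEquiv.symm
          (Set.powersetCard.ofCard (Finset.card_singleton a)) 0 = a := by
        have h3 := (Set.powersetCard.mem_range_ofFinEmbEquiv_symm_iff_mem
          (Set.powersetCard.ofCard (Finset.card_singleton a)) _).mp ⟨0, rfl⟩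
        exact Finset.mem_singleton.mp h3
      simp [ExteriorAlgebra.ιMulti_apply, gen, h2]
    have hd : Disjoint (Set.powersetCard.ofCard (Finset.card_singleton a)).val
        (Set.powersetCard.ofCard (rfl : l.toFinset.card = l.toFinset.card)).val := by
      show Disjoint ({a} : Finset X) l.toFinset
      simpa using ha
    have h4 := ExteriorAlgebra.basis_mul_of_disjoint (R := R)
      (Finsupp.basisSingleOne (R := R) (ι := X)) _ _ hd
    have h5 : (Set.powersetCard.disjUnion hd : Finset X) = (a :: l).toFinset := by
      ext x
      simp
    refine ⟨u * Equiv.Perm.sign (Set.powersetCard.permOfDisjoint hd), ?_⟩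
    rw [List.map_cons, List.prod_cons, hu, h1, mul_smul_comm, mul_smul]
    congr 1
    rw [← h5]
    exact h4

/-- A family of duplicate-free lists of indices, one for each finite set, gives a basis of the
exterior algebra. -/
theorem exists_listBasis (R : Type) [CommRing R] {κ : Type} (e : κ ≃ Finset X) (L : κ → List X)
    (hn : ∀ k, (L k).Nodup) (hL : ∀ k x, x ∈ L k ↔ x ∈ e k) :
    ∃ b : Module.Basis κ R (Ext R X), ∀ k, b k = ((L k).map (gen R)).prod := by
  classical
  -- The standard basis depends on a linear order of the generators. Any order will do, since the
  -- resulting signs are units and are absorbed by `unitsSMul`.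
  let : LinearOrder X := linearOrderOfSTO (WellOrderingRel (α := X))
  have hs : ∀ k, (L k).toFinset = e k := fun k => by ext x; simp [hL]
  choose u hu using fun k => exists_sign_list_gen_prod (R := R) (L k) (hn k)
  refine ⟨(((Finsupp.basisSingleOne (R := R) (ι := X)).ExteriorAlgebra).reindex e.symm).unitsSMul
    fun k => Units.map (Int.castRingHom R).toMonoidHom (u k), fun k => ?_⟩
  rw [Module.Basis.unitsSMul_apply, Module.Basis.reindex_apply, Equiv.symm_symm, hu, hs]
  rcases Int.units_eq_one_or (u k) with h | h <;> simp [h, Units.smul_def]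

/-- The basis of the exterior algebra by the finite sets of generators. -/
def extBasis (R X : Type) [CommRing R] : Module.Basis (Finset X) R (Ext R X) :=
  (exists_listBasis R (Equiv.refl _) Finset.toList Finset.nodup_toList
    fun _ _ => Finset.mem_toList).choose

theorem extBasis_apply (s : Finset X) :
    extBasis R X s = (s.toList.map (gen R)).prod :=
  (exists_listBasis R (Equiv.refl _) Finset.toList Finset.nodup_toList
    fun _ _ => Finset.mem_toList).choose_spec s

/-- The basis consists of products of generators listed independently of the ring, so a base change
carries basis to basis and acts on coordinates alone. -/
theorem extBasis_repr_extMap (f : R →+* S) (z : Ext R X) (s : Finset X) :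
    (extBasis S X).repr (extMap f (fun x => Finsupp.single x 1) z) s =
      f ((extBasis R X).repr z s) := by
  have h : extMap f (fun x => Finsupp.single x 1) z =
      ((extBasis R X).repr z).sum fun s r => f r • extBasis S X s := by
    conv_lhs => rw [← (extBasis R X).linearCombination_repr z, Finsupp.linearCombination_apply,
      map_finsuppSum]
    refine Finsupp.sum_congr fun s _ => ?_
    have : extMap f (fun x => Finsupp.single x 1) (s.toList.map (gen R)).prod =
        ((s.toList.map id).map (gen S)).prod := extMap_list_prod f id s.toList
    rw [List.map_id] at this
    rw [extMap_smul, extBasis_apply, this, extBasis_apply]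
  rw [h, Finsupp.sum, map_sum, Finsupp.finsetSum_apply]
  simp only [map_smul, Module.Basis.repr_self, Finsupp.smul_apply, smul_eq_mul]
  rw [Finset.sum_eq_single s]
  · simp
  · intro b _ hb; simp [hb]
  · intro hs; simp [Finsupp.notMem_support_iff.mp hs]

theorem mem_smul_top_iff_repr {M κ : Type} [AddCommGroup M] [Module R M]
    (b : Module.Basis κ R M) (J : Ideal R) (z : M) :
    z ∈ J • (⊤ : Submodule R M) ↔ ∀ s, b.repr z s ∈ J := by
  constructor
  · intro hz s
    refine Submodule.smul_induction_on hz (fun r hr n _ => ?_) (fun x y hx hy => ?_)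
    · rw [map_smul, Finsupp.smul_apply, smul_eq_mul]
      exact J.mul_mem_right _ hr
    · rw [map_add, Finsupp.add_apply]
      exact J.add_mem hx hy
  · intro h
    rw [← b.linearCombination_repr z, Finsupp.linearCombination_apply]
    exact Submodule.sum_mem _ fun s _ => Submodule.smul_mem_smul (h s) trivial

/-- Turns vanishing after reduction of the coefficients into the ideal membership on which the
Koszul induction runs. -/
theorem extMap_single_eq_zero_iff (f : R →+* S) (z : Ext R X) :
    extMap f (fun x => Finsupp.single x 1) z = 0 ↔
      z ∈ RingHom.ker f • (⊤ : Submodule R (Ext R X)) := by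
  rw [mem_smul_top_iff_repr (extBasis R X), ← (extBasis S X).repr.map_eq_zero_iff,
    Finsupp.ext_iff]
  simp only [extBasis_repr_extMap, Finsupp.coe_zero, Pi.zero_apply, RingHom.mem_ker]

theorem extMap_mem_smul_top (J : Ideal R) (c : X → (Y →₀ R)) {z : Ext R X}
    (hz : z ∈ J • (⊤ : Submodule R (Ext R X))) :
    extMap (RingHom.id R) c z ∈ J • (⊤ : Submodule R (Ext R Y)) := by
  refine Submodule.smul_induction_on hz (fun r hr n _ => ?_) (fun x y hx hy => ?_)
  · rw [extMap_smul]
    exact Submodule.smul_mem_smul hr trivial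
  · rw [map_add]
    exact Submodule.add_mem _ hx hy

/-- A unipotent change of the generators is an automorphism. -/
theorem extMap_shear_bijective (e : X → (X →₀ R))
    (he : ∀ x, (e x).sum (fun y r => r • e y) = 0) :
    Function.Bijective (extMap (RingHom.id R) fun x => Finsupp.single x 1 + e x) := by
  -- On generators this is `(1 - b)(1 + b) = 1 - b²` with `b² = 0`; applied to `e` and to `-e` it
  -- gives a two-sided inverse.
  have key : ∀ a b : X → (X →₀ R), (∀ x, a x = - b x) → (∀ x, (b x).sum (fun y r => r • b y) = 0) →
      ∀ z, extMap (RingHom.id R) (fun x => Finsupp.single x 1 + a x)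
        (extMap (RingHom.id R) (fun x => Finsupp.single x 1 + b x) z) = z := by
    intro a b hab hb z
    rw [extMap_extMap]
    have : (fun x => (Finsupp.single x 1 + b x).sum fun y r =>
        RingHom.id R r • (Finsupp.single y 1 + a y)) = fun x => Finsupp.single x 1 := by
      funext x
      rw [Finsupp.sum_add_index' (by simp) (by intros; simp [add_smul]; abel),
        Finsupp.sum_single_index (by simp)]
      have h1 : (b x).sum (fun y r => RingHom.id R r • (Finsupp.single y 1 + a y)) = b x := by
        simp only [hab, RingHom.id_apply, smul_add, smul_neg, Finsupp.sum_add]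
        rw [Finsupp.sum_neg, hb, neg_zero, add_zero]
        simp
      rw [h1, hab]
      simp
    rw [this, RingHom.id_comp, extMap_single_id, RingHom.id_apply]
  have he' : ∀ x, (-e x).sum (fun y r => r • (-e y)) = 0 := by
    intro x
    rw [Finsupp.sum_neg_index (by simp)]
    simpa using he x
  exact Function.bijective_iff_has_inverse.mpr
    ⟨extMap (RingHom.id R) (fun x => Finsupp.single x 1 + (fun x => - e x) x),
      key _ _ (fun _ => rfl) he, key _ _ (fun x => (neg_neg _).symm) he'⟩

end ExtBasis

/-! ## Free left modules and tensor products -/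

section LeftBasis

/-- The family `e` is a basis of `T` as a left module over `A` through `i`. -/
def IsLeftBasis {A T κ : Type} [Ring A] [Ring T] (i : A →+* T) (e : κ → T) : Prop :=
  Function.Bijective fun x : κ →₀ A => x.sum fun k a => i a * e k

/-- Both sides are copies of `κ →₀ X`. The map `φ` onto the tensor product is surjective because `e`
spans `Y` over `B`, and its composite with the product map is the bijection `he'`, so both are
bijective. -/
theorem tensorOverMap_bijective {B X Y T κ : Type} [Ring B] [Ring X] [Ring Y] [Ring T]
    (r : B →+* X) (l : B →+* Y) (i : X →+* T) (j : Y →+* T) (h : i.comp r = j.comp l)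
    {e : κ → Y} (he : IsLeftBasis l e) (he' : IsLeftBasis i fun k => j (e k)) :
    Function.Bijective (tensorOverMap r l i j h) := by
  let φ : (κ →₀ X) →+ TensorOver r l := Finsupp.liftAddHom fun k =>
    (QuotientAddGroup.mk' (tensorRel r l)).comp
      ((TensorProduct.mk ℤ X Y).flip (e k)).toAddMonoidHom
  have hφ : ∀ k x, φ (Finsupp.single k x) = QuotientAddGroup.mk (x ⊗ₜ[ℤ] e k) := by
    intro k x
    exact Finsupp.liftAddHom_apply_single _ _ _
  have hcomp : ∀ x, tensorOverMap r l i j h (φ x) = x.sum fun k a => i a * j (e k) := by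
    intro x
    induction x using Finsupp.induction_linear with
    | zero => simp
    | add x y hx hy =>
      rw [map_add, map_add, hx, hy, Finsupp.sum_add_index' (by simp) (by simp [add_mul])]
    | single k x =>
      rw [hφ, tensorOverMap_tmul, Finsupp.sum_single_index (by simp)]
  have hsurj : Function.Surjective φ := by
    rw [← AddMonoidHom.range_eq_top, eq_top_iff]
    rintro z -
    obtain ⟨z, rfl⟩ := QuotientAddGroup.mk_surjective z
    induction z using TensorProduct.induction_on with
    | zero => exact zero_mem _
    | add a b ha hb => exact add_mem ha hb
    | tmul x y =>
      obtain ⟨c, rfl⟩ := he.2 y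
      refine ⟨c.mapRange (fun b => x * r b) (by simp), ?_⟩
      induction c using Finsupp.induction_linear with
      | zero => simp
      | add c d hc hd =>
        rw [Finsupp.mapRange_add (by intros; simp [mul_add]), map_add, hc, hd]
        dsimp only
        rw [Finsupp.sum_add_index' (by simp) (by simp [add_mul]), TensorProduct.tmul_add]
        rfl
      | single k b =>
        dsimp only
        rw [Finsupp.mapRange_single, hφ, Finsupp.sum_single_index (by simp)]
        refine (QuotientAddGroup.eq_iff_sub_mem).mpr ?_
        exact AddSubgroup.subset_closure ⟨x, b, e k, rfl⟩
  have hb : Function.Bijective (fun x => tensorOverMap r l i j h (φ x)) := by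
    simp only [hcomp]; exact he'
  refine ⟨fun a b hab => ?_, fun t => ?_⟩
  · obtain ⟨a, rfl⟩ := hsurj a
    obtain ⟨b, rfl⟩ := hsurj b
    rw [hb.1 hab]
  · obtain ⟨x, hx⟩ := hb.2 t
    exact ⟨_, hx⟩

theorem IsLeftBasis.comp_equiv {A A' T κ : Type} [Ring A] [Ring A'] [Ring T] {i : A →+* T}
    {e : κ → T} (h : IsLeftBasis i e) (g : A' ≃+* A) (i' : A' →+* T) (hi : ∀ a, i' a = i (g a)) :
    IsLeftBasis i' e := by
  have : (fun x : κ →₀ A' => x.sum fun k a => i' a * e k) =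
      (fun x : κ →₀ A => x.sum fun k a => i a * e k) ∘
        Finsupp.mapRange.addEquiv (ι := κ) g.toAddEquiv := by
    funext x
    simp only [Function.comp_apply, Finsupp.mapRange.addEquiv_apply]
    rw [Finsupp.sum_mapRange_index (by simp)]
    simp [hi]
  unfold IsLeftBasis
  rw [this]
  exact h.comp (Finsupp.mapRange.addEquiv (ι := κ) g.toAddEquiv).bijective

/-- The coefficients extend along a free extension with basis `b`, and the generators split into the
old ones `g` and the new ones `h`; a basis is formed by the products of basis coefficients with
monomials in the new generators. -/
theorem isLeftBasis_extMap {R S X Z W β : Type} [CommRing R] [CommRing S] (f : R →+* S)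
    {b : β → S} (hb : IsLeftBasis f b) (g : X → W) (h : Z → W)
    (hgh : Function.Bijective (Sum.elim g h)) :
    IsLeftBasis (extMap f fun x => Finsupp.single (g x) 1)
      (fun k : β × Finset Z => algebraMap S (Ext S W) (b k.1) *
        ((k.2.toList.map h).map (gen S)).prod) := by
  have hg : Function.Injective g := fun x y hxy => by
    simpa using @hgh.1 (Sum.inl x) (Sum.inl y) hxy
  have hh : Function.Injective h := fun x y hxy => by
    simpa using @hgh.1 (Sum.inr x) (Sum.inr y) hxy
  have hd : ∀ x z, g x ≠ h z := fun x z hxz => by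
    simpa using @hgh.1 (Sum.inl x) (Sum.inr z) hxz
  -- The lists put old generators before new ones, so every basis element is literally an old
  -- monomial times a new one, without sign.
  obtain ⟨c, hc⟩ := exists_listBasis S
    (Finset.sumEquiv.toEquiv.symm.trans (Equiv.finsetCongr (Equiv.ofBijective _ hgh)))
    (fun k => k.1.toList.map g ++ k.2.toList.map h)
    (by
      rintro ⟨s, s'⟩
      refine List.nodup_append.mpr ⟨(List.nodup_map_iff hg).mpr s.nodup_toList,
        (List.nodup_map_iff hh).mpr s'.nodup_toList, ?_⟩
      intro a ha b hb hab
      obtain ⟨x, -, rfl⟩ := List.mem_map.mp ha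
      obtain ⟨z, -, rfl⟩ := List.mem_map.mp hb
      exact hd x z hab)
    (by
      rintro ⟨s, s'⟩ x
      obtain ⟨y, rfl⟩ := (Equiv.ofBijective _ hgh).surjective x
      have h1 : ∀ x, (Equiv.ofBijective _ hgh).symm (g x) = Sum.inl x := fun x => by
        rw [Equiv.symm_apply_eq]; rfl
      have h2 : ∀ z, (Equiv.ofBijective _ hgh).symm (h z) = Sum.inr z := fun z => by
        rw [Equiv.symm_apply_eq]; rfl
      cases y <;> simp [hg.eq_iff, hh.eq_iff, hd, fun x z => (hd x z).symm, h1, h2])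
  -- The sum map is factored into bijections: expand the coefficients in monomials over `R`, reorder
  -- the indices, collect the `β`-coordinates into elements of `S`, and apply the basis `c`.
  let e1 : (β × Finset Z →₀ Ext R X) ≃+ (β × Finset Z →₀ (Finset X →₀ R)) :=
    Finsupp.mapRange.addEquiv (extBasis R X).repr.toAddEquiv
  let e2 : (β × Finset Z →₀ (Finset X →₀ R)) ≃+ ((β × Finset Z) × Finset X →₀ R) :=
    Finsupp.curryAddEquiv.symm
  let e3 : ((β × Finset Z) × Finset X →₀ R) ≃+ ((Finset X × Finset Z) × β →₀ R) :=
    Finsupp.domCongr ⟨fun x => ((x.2, x.1.2), x.1.1), fun x => ((x.2, x.1.2), x.1.1),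
      fun _ => rfl, fun _ => rfl⟩
  let e4 : ((Finset X × Finset Z) × β →₀ R) ≃+ ((Finset X × Finset Z) →₀ (β →₀ R)) :=
    Finsupp.curryAddEquiv
  let b' : (β →₀ R) ≃+ S := AddEquiv.ofBijective
    (Finsupp.liftAddHom fun k => (AddMonoidHom.mulRight (b k)).comp f.toAddMonoidHom) hb
  have hb' : ∀ k r, b' (Finsupp.single k r) = f r * b k := fun k r =>
    Finsupp.liftAddHom_apply_single _ _ _
  let e5 : ((Finset X × Finset Z) →₀ (β →₀ R)) ≃+ ((Finset X × Finset Z) →₀ S) :=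
    Finsupp.mapRange.addEquiv b'
  let E := ((((e1.trans e2).trans e3).trans e4).trans e5).trans c.repr.symm.toAddEquiv
  have hE : (fun x : β × Finset Z →₀ Ext R X => x.sum fun k a =>
      extMap f (fun x => Finsupp.single (g x) 1) a * (algebraMap S (Ext S W) (b k.1) *
        ((k.2.toList.map h).map (gen S)).prod)) = E := by
    have key : (Finsupp.liftAddHom fun k : β × Finset Z =>
        (AddMonoidHom.mulRight (algebraMap S (Ext S W) (b k.1) *
          ((k.2.toList.map h).map (gen S)).prod)).comp
          (extMap f fun x => Finsupp.single (g x) 1).toAddMonoidHom) = E.toAddMonoidHom := by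
      have : (Finsupp.liftAddHom fun k : β × Finset Z =>
        (AddMonoidHom.mulRight (algebraMap S (Ext S W) (b k.1) *
          ((k.2.toList.map h).map (gen S)).prod)).comp
          (extMap f fun x => Finsupp.single (g x) 1).toAddMonoidHom).comp
            (e1.trans e2).symm.toAddMonoidHom = E.toAddMonoidHom.comp
            (e1.trans e2).symm.toAddMonoidHom := by
        refine Finsupp.addHom_ext ?_
        rintro ⟨⟨β0, s'⟩, s⟩ r
        have h1 : (e1.trans e2).symm (Finsupp.single ((β0, s'), s) r) =
            Finsupp.single (β0, s') (r • extBasis R X s) := by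
          rw [AddEquiv.symm_apply_eq]
          simp [e1, e2]
        have h2 : E (Finsupp.single (β0, s') (r • extBasis R X s)) =
            (f r * b β0) • c (s, s') := by
          have h3 : E (Finsupp.single (β0, s') (r • extBasis R X s)) =
              c.repr.symm (Finsupp.single (s, s') (b' (Finsupp.single β0 r))) := by
            simp [E, e1, e2, e3, e4, e5, -Module.Basis.coe_repr_symm]
          rw [h3, hb', Module.Basis.repr_symm_single]
        simp only [AddMonoidHom.comp_apply, AddEquiv.coe_toAddMonoidHom]
        rw [h1, h2, hc]
        rw [Finsupp.liftAddHom_apply_single]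
        simp only [AddMonoidHom.comp_apply, AddMonoidHom.coe_mulRight,
          RingHom.toAddMonoidHom_eq_coe, AddMonoidHom.coe_coe]
        rw [extMap_smul, extBasis_apply, extMap_list_prod, List.map_append, List.prod_append,
          mul_smul, ← Algebra.smul_def, smul_mul_assoc, mul_smul_comm]
      refine AddMonoidHom.ext fun x => ?_
      have h3 := DFunLike.congr_fun this ((e1.trans e2) x)
      simpa using h3
    funext x
    exact DFunLike.congr_fun key x
  unfold IsLeftBasis
  rw [hE]
  exact E.bijective

end LeftBasis

/-! ## Exactness of Koszul complexes -/

section KoszulExact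

variable {R X : Type} [CommRing R]

theorem koszul_koszul_comm (w w' : X → R) (z : Ext R X) :
    koszul w (koszul w' z) = - koszul w' (koszul w z) :=
  CliffordAlgebra.contractLeft_comm (Q := (0 : QuadraticForm R (X →₀ R))) _ _ z

theorem koszul_add (w w' : X → R) (z : Ext R X) :
    koszul (w + w') z = koszul w z + koszul w' z := by
  have : Finsupp.linearCombination R (w + w') =
      Finsupp.linearCombination R w + Finsupp.linearCombination R w' := by
    ext x; simp
  simp only [koszul, this, map_add, LinearMap.add_apply]

theorem koszul_smul (r : R) (w : X → R) (z : Ext R X) :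
    koszul (r • w) z = r • koszul w z := by
  have : Finsupp.linearCombination R (r • w) = r • Finsupp.linearCombination R w := by
    ext x; simp
  simp only [koszul, this, map_smul, LinearMap.smul_apply]

theorem koszul_zero (z : Ext R X) : koszul (0 : X → R) z = 0 := by
  have := koszul_smul (0 : R) (0 : X → R) z
  rwa [zero_smul, zero_smul] at this

theorem koszul_gen_mul (w : X → R) (x : X) (z : Ext R X) :
    koszul w (gen R x * z) = w x • z - gen R x * koszul w z := by
  rw [gen, koszul_ι_mul, Finsupp.linearCombination_single, one_smul]

theorem koszul_mem_smul_top (J : Ideal R) (w : X → R) (hw : ∀ x, w x ∈ J) (z : Ext R X) :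
    koszul w z ∈ J • (⊤ : Submodule R (Ext R X)) := by
  induction z using ext_induction with
  | h0 r => rw [koszul_algebraMap]; exact zero_mem _
  | hadd a b ha hb => rw [map_add]; exact add_mem ha hb
  | hmul m a ha =>
    rw [koszul_ι_mul]
    refine sub_mem (Submodule.smul_mem_smul ?_ trivial) ?_
    · rw [Finsupp.linearCombination_apply]
      exact J.sum_mem fun x _ => J.mul_mem_left _ (hw x)
    · refine Submodule.smul_induction_on ha (fun r hr n _ => ?_) (fun x y hx hy => ?_)
      · rw [mul_smul_comm]; exact Submodule.smul_mem_smul hr trivial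
      · rw [mul_add]; exact add_mem hx hy

/-- The endomorphism of the exterior algebra that kills the generators in `s`. -/
def kill (R : Type) [CommRing R] (s : Set X) : Ext R X →+* Ext R X :=
  open Classical in
  extMap (RingHom.id R) fun x => if x ∈ s then 0 else Finsupp.single x 1

theorem kill_gen (s : Set X) (x : X) [Decidable (x ∈ s)] :
    kill R s (gen R x) = if x ∈ s then 0 else gen R x := by
  rw [kill, extMap_gen]
  split_ifs <;> simp [gen]

theorem kill_algebraMap (s : Set X) (r : R) :
    kill R s (algebraMap R _ r) = algebraMap R _ r := extMap_algebraMap _ _ _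

theorem kill_smul (s : Set X) (r : R) (z : Ext R X) : kill R s (r • z) = r • kill R s z :=
  extMap_smul _ _ _ _

theorem kill_kill (s s' : Set X) (z : Ext R X) : kill R s (kill R s' z) = kill R (s ∪ s') z := by
  classical
  have : (kill R s).comp (kill R s') = kill R (s ∪ s') := by
    refine ext_ringHom (fun r => ?_) (fun x => ?_)
    · simp only [RingHom.comp_apply, kill_algebraMap]
    · rw [RingHom.comp_apply, kill_gen, kill_gen]
      by_cases h' : x ∈ s' <;> by_cases h : x ∈ s <;> simp [h, h', kill_gen]
  exact RingHom.congr_fun this z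

theorem kill_empty (z : Ext R X) : kill R (∅ : Set X) z = z := by
  have : kill R (∅ : Set X) = RingHom.id _ := by
    refine ext_ringHom (fun r => kill_algebraMap _ _) (fun x => ?_)
    classical
    simp [kill_gen]
  exact RingHom.congr_fun this z

/-- Killing generators commutes with the Koszul differential if the weights of the surviving
generators agree and those of the killed ones vanish. -/
theorem koszul_kill (w w' : X → R) (s : Set X) (h : ∀ x ∉ s, w' x = w x) (h' : ∀ x ∈ s, w x = 0)
    (z : Ext R X) : koszul w' (kill R s z) = kill R s (koszul w z) := by
  classical
  refine extMap_koszul w w' _ _ (fun x => ?_) z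
  by_cases hx : x ∈ s <;> simp [hx, h, h']

theorem kill_mem_smul_top (s : Set X) (J : Ideal R) {z : Ext R X}
    (hz : z ∈ J • (⊤ : Submodule R (Ext R X))) : kill R s z ∈ J • (⊤ : Submodule R (Ext R X)) :=
  extMap_mem_smul_top _ _ hz

/-- If `z = a + x b` with `a` and `b` free of the generator `x`, then contraction against `x` gives
`b`, and what remains is `a`. -/
theorem kill_singleton (x : X) [DecidableEq X] (z : Ext R X) :
    kill R {x} z = z - gen R x * koszul (Pi.single x 1) z := by
  have hsq : ∀ m : X →₀ R, ∀ a : Ext R X, gen R x * (ExteriorAlgebra.ι R m * a) =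
      - (ExteriorAlgebra.ι R m * (gen R x * a)) := by
    intro m a
    rw [← mul_assoc, ← mul_assoc, ← neg_mul]
    congr 1
    exact eq_neg_of_add_eq_zero_left (ExteriorAlgebra.ι_add_mul_swap _ _)
  have hx2 : ∀ a : Ext R X, gen R x * (gen R x * a) = 0 := by
    intro a
    rw [← mul_assoc, gen, ExteriorAlgebra.ι_sq_zero, zero_mul]
  induction z using ext_induction with
  | h0 r => rw [koszul_algebraMap, kill_algebraMap, mul_zero, sub_zero]
  | hadd a b ha hb => rw [map_add, map_add, ha, hb, mul_add]; abel
  | hmul m a ha =>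
    have hm : kill R {x} (ExteriorAlgebra.ι R m) = ExteriorAlgebra.ι R m -
        (Finsupp.linearCombination R (Pi.single x (1 : R)) m) • gen R x := by
      induction m using Finsupp.induction_linear with
      | zero => simp
      | add m n hm hn => rw [map_add, map_add, hm, hn, map_add, add_smul]; abel
      | single y r =>
        have h1 : ExteriorAlgebra.ι R (Finsupp.single y r) = r • gen R y := by
          rw [gen, ← map_smul, Finsupp.smul_single, smul_eq_mul, mul_one]
        rw [h1, kill_smul, kill_gen, Finsupp.linearCombination_single]
        by_cases hy : y = x
        · subst hy; simp
        · simp [hy]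
    rw [map_mul, hm, ha, koszul_ι_mul, sub_mul, mul_sub, mul_sub, mul_sub, smul_mul_assoc,
      smul_mul_assoc, hx2, mul_smul_comm, hsq]
    simp only [smul_zero]
    abel

/-- Partial Koszul complexes of a regular sequence are exact. -/
theorem koszul_exact_of_lt (v : ℕ → R)
    (hv : ∀ n x, v n * x ∈ Ideal.span (v '' Set.Iio n) → x ∈ Ideal.span (v '' Set.Iio n))
    (k : ℕ → X) (hk : Function.Injective k) (n : ℕ) (w : X → R) (hw : ∀ i < n, w (k i) = v i)
    (hw' : ∀ x ∉ k '' Set.Iio n, w x = 0) (z : Ext R X) (hz : koszul w z = 0)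
    (hz' : kill R (k '' Set.Iio n) z ∈
      Ideal.span (v '' Set.Iio n) • (⊤ : Submodule R (Ext R X))) :
    ∃ y, koszul w y = z := by
  classical
  induction n generalizing w z with
  | zero =>
    refine ⟨0, ?_⟩
    have h0 : (Set.Iio 0 : Set ℕ) = ∅ := Set.Iio_bot
    rw [h0, Set.image_empty, Set.image_empty, kill_empty, Ideal.span_empty,
      Submodule.bot_smul, Submodule.mem_bot] at hz'
    rw [map_zero, hz']
  | succ n ih =>
    have hI : (Set.Iio (n + 1) : Set ℕ) = Set.Iio n ∪ {n} := by
      ext i; simp only [Set.mem_Iio, Set.mem_union, Set.mem_singleton_iff]; omega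
    have hs : k '' Set.Iio (n + 1) = {k n} ∪ k '' Set.Iio n := by
      rw [hI, Set.image_union, Set.image_singleton, Set.union_comm]
    have hs' : k '' Set.Iio n ∪ k '' Set.Iio (n + 1) = k '' Set.Iio (n + 1) := by
      rw [hs, Set.union_left_comm, Set.union_self]
    have hs2 : k '' Set.Iio (n + 1) ∪ k '' Set.Iio n = k '' Set.Iio (n + 1) := by
      rw [Set.union_comm, hs']
    have hkn : k n ∉ k '' Set.Iio n := by
      rintro ⟨i, hi, h⟩
      exact absurd (hk h) (ne_of_lt hi)
    set J := Ideal.span (v '' Set.Iio n) with hJ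
    have hJ' : Ideal.span (v '' Set.Iio (n + 1)) = J ⊔ Ideal.span {v n} := by
      rw [hI, Set.image_union, Set.image_singleton, Ideal.span_union]
    set d : Ext R X →ₗ[R] Ext R X := koszul (Pi.single (k n) 1) with hd
    have hdd : ∀ y, d (d y) = 0 := koszul_koszul _
    -- The differential splits as that of the shorter sequence plus `v n` times the contraction `d`
    -- against the last generator.
    let w0 : X → R := w - v n • Pi.single (k n) 1
    have hw0n : w (k n) = v n := hw n (Nat.lt_succ_self n)
    have hww : w = w0 + v n • Pi.single (k n) 1 := by simp [w0]
    have h1 : ∀ y, koszul w y = koszul w0 y + v n • d y := by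
      intro y
      conv_lhs => rw [hww]
      rw [koszul_add, koszul_smul]
    have hw0k : ∀ i < n, w0 (k i) = v i := by
      intro i hi
      have : k i ≠ k n := fun h => absurd (hk h) (ne_of_lt hi)
      simp [w0, this, hw i (by omega)]
    have hw0z : ∀ x ∉ k '' Set.Iio n, w0 x = 0 := by
      intro x hx
      by_cases hxn : x = k n
      · subst hxn; simp [w0, hw0n]
      · have : w x = 0 := hw' x (by rw [hs]; simpa [hxn] using hx)
        simp [w0, hxn, this]
    have hw0J : ∀ x, w0 x ∈ J := by
      intro x
      by_cases hx : x ∈ k '' Set.Iio n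
      · obtain ⟨i, hi, rfl⟩ := hx
        rw [hw0k i hi]
        exact Ideal.subset_span ⟨i, hi, rfl⟩
      · rw [hw0z x hx]; exact zero_mem _
    have hK : ∀ y, kill R {k n} y = y - gen R (k n) * d y := kill_singleton (k n)
    have hdK : ∀ y, d (kill R {k n} y) = 0 := by
      intro y
      rw [hK, map_sub, hd, koszul_gen_mul, ← hd, hdd, Pi.single_eq_same, one_smul, mul_zero,
        sub_zero, sub_self]
    have hKd : ∀ y, d y = 0 → kill R {k n} y = y := by
      intro y hy
      rw [hK, hy, mul_zero, sub_zero]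
    have hkk : ∀ y, kill R (k '' Set.Iio n) (kill R {k n} y) = kill R (k '' Set.Iio (n + 1)) y := by
      intro y
      rw [kill_kill, Set.union_comm, ← hs]
    have hkk' : ∀ y, kill R {k n} (kill R (k '' Set.Iio n) y) = kill R (k '' Set.Iio (n + 1)) y := by
      intro y
      rw [kill_kill, ← hs]
    have hwμ : ∀ y, koszul w (gen R (k n) * y) = v n • y - gen R (k n) * koszul w y := by
      intro y
      rw [koszul_gen_mul, hw0n]
    have hb1 : koszul w (d z) = 0 := by
      rw [hd, koszul_koszul_comm, hz, map_zero, neg_zero]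
    have hb2 : koszul w0 (d z) = 0 := by
      have := h1 (d z)
      rw [hb1, hdd, smul_zero, add_zero] at this
      exact this.symm
    -- The cycle equation gives `v n • d z = - koszul w0 z`, whose coordinates lie in `J`.
    -- Regularity cancels `v n` coordinatewise.
    have hb3 : kill R (k '' Set.Iio n) (d z) ∈ J • (⊤ : Submodule R (Ext R X)) := by
      have h2 : v n • kill R (k '' Set.Iio n) (d z) ∈ J • (⊤ : Submodule R (Ext R X)) := by
        have h3 : v n • kill R (k '' Set.Iio n) (d z) =
            - kill R (k '' Set.Iio n) (koszul w0 z) := by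
          have := h1 z
          rw [hz] at this
          rw [← kill_smul, ← map_neg, ← eq_neg_of_add_eq_zero_right this.symm]
        rw [h3]
        exact neg_mem (kill_mem_smul_top _ _ (koszul_mem_smul_top J w0 hw0J z))
      rw [mem_smul_top_iff_repr (extBasis R X)] at h2 ⊢
      intro s
      have := h2 s
      rw [map_smul, Finsupp.smul_apply, smul_eq_mul] at this
      exact hv n _ this
    obtain ⟨c, hc⟩ := ih w0 hw0k hw0z (d z) hb2 hb3
    -- Adding this boundary removes the generator `k n` from `z`, because its coefficient `d z` is
    -- `koszul w0 c`.
    set z1 := z + koszul w (gen R (k n) * c) with hz1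
    have hz1K : z1 = kill R {k n} (z + v n • c) := by
      rw [hz1, hwμ, h1, hc, hK, map_add, map_smul, mul_add]
      abel
    have hz1w : koszul w z1 = 0 := by rw [hz1, map_add, hz, koszul_koszul, add_zero]
    have hz1d : d z1 = 0 := by rw [hz1K, hdK]
    have hz1m : kill R (k '' Set.Iio n) z1 ∈
        Ideal.span (v '' Set.Iio (n + 1)) • (⊤ : Submodule R (Ext R X)) := by
      rw [hz1K, hkk, map_add, kill_smul]
      exact add_mem hz' (Submodule.smul_mem_smul
        (Ideal.subset_span ⟨n, Nat.lt_succ_self n, rfl⟩) trivial)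
    rw [hJ', Submodule.sup_smul, Submodule.mem_sup] at hz1m
    obtain ⟨q, hq, e, he, hqe⟩ := hz1m
    rw [Submodule.ideal_span_singleton_smul] at he
    obtain ⟨e, -, rfl⟩ := he
    -- Only generators of weight zero survive in `e'`, so it is a cycle and `v n • e'` is the
    -- boundary of `gen R (k n) * e'`. Subtracting it leaves a cycle to which the induction
    -- hypothesis applies.
    set e' := kill R (k '' Set.Iio (n + 1)) e with he'
    have hqe' : kill R (k '' Set.Iio n) z1 = kill R (k '' Set.Iio (n + 1)) q + v n • e' := by
      have h2 : kill R (k '' Set.Iio (n + 1)) (kill R (k '' Set.Iio n) z1) =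
          kill R (k '' Set.Iio n) z1 := by
        rw [kill_kill, hs2, ← hkk, hKd z1 hz1d]
      rw [← h2, ← hqe, map_add]
      congr 1
      exact kill_smul _ _ _
    have hde' : d e' = 0 := by rw [he', ← hkk', hdK]
    have hwe' : koszul w e' = 0 := by
      rw [he', koszul_kill 0 w _ (fun x hx => hw' x hx) (fun _ _ => rfl), koszul_zero, map_zero]
    set z2 := z1 - v n • e' with hz2
    have hz2d : d z2 = 0 := by rw [hz2, map_sub, map_smul, hz1d, hde', smul_zero, sub_zero]
    have hz2w : koszul w0 z2 = 0 := by
      have := h1 z2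
      rw [hz2d, smul_zero, add_zero] at this
      rw [← this, hz2, map_sub, map_smul, hz1w, hwe', smul_zero, sub_zero]
    have hz2m : kill R (k '' Set.Iio n) z2 ∈ J • (⊤ : Submodule R (Ext R X)) := by
      have h2 : kill R (k '' Set.Iio n) e' = e' := by rw [he', kill_kill, hs']
      rw [hz2, map_sub, kill_smul, h2, hqe', add_sub_cancel_right]
      exact kill_mem_smul_top _ _ hq
    obtain ⟨y, hy⟩ := ih w0 hw0k hw0z z2 hz2w hz2m
    -- The three terms bound `z2`, `v n • e'` and `z - z1` respectively.
    refine ⟨kill R {k n} y + gen R (k n) * e' - gen R (k n) * c, ?_⟩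
    have h3 : koszul w (kill R {k n} y) = z2 := by
      rw [h1, hdK, smul_zero, add_zero, koszul_kill w0 w0 _ (fun _ _ => rfl)
        (by rintro x rfl; exact hw0z _ hkn), hy, hKd z2 hz2d]
    rw [map_sub, map_add, h3, hwμ e', hwe', mul_zero, sub_zero, hz2, sub_add_cancel, hz1,
      add_sub_cancel_right]

/-- An element involves finitely many generators. Together with `exists_mem_span_Iio_smul` this
reduces an infinite regular sequence to a finite one. -/
theorem exists_kill_image_Ici_eq {k : ℕ → X} (hk : Function.Injective k) (z : Ext R X) :
    ∃ N, ∀ n ≥ N, kill R (k '' Set.Ici n) z = z := by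
  classical
  have hg : ∀ x, ∃ N, ∀ n ≥ N, kill R (k '' Set.Ici n) (gen R x) = gen R x := by
    intro x
    by_cases hx : ∃ i, k i = x
    · obtain ⟨i, rfl⟩ := hx
      refine ⟨i + 1, fun n hn => ?_⟩
      rw [kill_gen, if_neg]
      rintro ⟨j, hj, h⟩
      rw [hk h] at hj
      exact absurd (Set.mem_Ici.mp hj) (by omega)
    · refine ⟨0, fun n _ => ?_⟩
      rw [kill_gen, if_neg]
      rintro ⟨j, -, h⟩
      exact hx ⟨j, h⟩
  induction z using ext_induction with
  | h0 r => exact ⟨0, fun n _ => kill_algebraMap _ _⟩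
  | hadd a b ha hb =>
    obtain ⟨N, hN⟩ := ha
    obtain ⟨M, hM⟩ := hb
    exact ⟨max N M, fun n hn => by
      rw [map_add, hN n (le_of_max_le_left hn), hM n (le_of_max_le_right hn)]⟩
  | hmul m a ha =>
    have hm : ∃ N, ∀ n ≥ N,
        kill R (k '' Set.Ici n) (ExteriorAlgebra.ι R m) = ExteriorAlgebra.ι R m := by
      induction m using Finsupp.induction_linear with
      | zero => exact ⟨0, fun n _ => by simp⟩
      | add a b ha hb =>
        obtain ⟨N, hN⟩ := ha
        obtain ⟨M, hM⟩ := hb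
        exact ⟨max N M, fun n hn => by
          rw [map_add, map_add, hN n (le_of_max_le_left hn), hM n (le_of_max_le_right hn)]⟩
      | single x r =>
        obtain ⟨N, hN⟩ := hg x
        have h1 : ExteriorAlgebra.ι R (Finsupp.single x r) = r • gen R x := by
          rw [gen, ← map_smul, Finsupp.smul_single, smul_eq_mul, mul_one]
        exact ⟨N, fun n hn => by rw [h1, kill_smul, hN n hn]⟩
    obtain ⟨N, hN⟩ := ha
    obtain ⟨M, hM⟩ := hm
    exact ⟨max N M, fun n hn => by
      rw [map_mul, hN n (le_of_max_le_left hn), hM n (le_of_max_le_right hn)]⟩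

theorem exists_mem_span_Iio_smul {M : Type} [AddCommGroup M] [Module R M] (v : ℕ → R) {z : M}
    (hz : z ∈ Ideal.span (Set.range v) • (⊤ : Submodule R M)) :
    ∃ N, ∀ n ≥ N, z ∈ Ideal.span (v '' Set.Iio n) • (⊤ : Submodule R M) := by
  have hr : ∀ r ∈ Ideal.span (Set.range v), ∃ N, ∀ n ≥ N, r ∈ Ideal.span (v '' Set.Iio n) := by
    intro r hr
    induction hr using Submodule.span_induction with
    | mem x hx =>
      obtain ⟨i, rfl⟩ := hx
      exact ⟨i + 1, fun n hn => Ideal.subset_span ⟨i, by simp; omega, rfl⟩⟩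
    | zero => exact ⟨0, fun n _ => zero_mem _⟩
    | add x y _ _ hx hy =>
      obtain ⟨N, hN⟩ := hx
      obtain ⟨M, hM⟩ := hy
      exact ⟨max N M, fun n hn => add_mem (hN n (le_of_max_le_left hn))
        (hM n (le_of_max_le_right hn))⟩
    | smul a x _ hx =>
      obtain ⟨N, hN⟩ := hx
      exact ⟨N, fun n hn => Ideal.mul_mem_left _ _ (hN n hn)⟩
  refine Submodule.smul_induction_on hz (fun r h n _ => ?_) (fun x y hx hy => ?_)
  · obtain ⟨N, hN⟩ := hr r h
    exact ⟨N, fun n hn => Submodule.smul_mem_smul (hN n hn) trivial⟩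
  · obtain ⟨N, hN⟩ := hx
    obtain ⟨M, hM⟩ := hy
    exact ⟨max N M, fun n hn => add_mem (hN n (le_of_max_le_left hn))
      (hM n (le_of_max_le_right hn))⟩

/-- The Koszul complex of a regular sequence is exact, in the presence of further generators of
weight zero. -/
theorem koszul_exact (v : ℕ → R)
    (hv : ∀ n x, v n * x ∈ Ideal.span (v '' Set.Iio n) → x ∈ Ideal.span (v '' Set.Iio n))
    {k : ℕ → X} (hk : Function.Injective k) (w : X → R) (hw : ∀ i, w (k i) = v i)
    (hw' : ∀ x ∉ Set.range k, w x = 0) {z : Ext R X} (hz : koszul w z = 0)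
    (hz' : kill R (Set.range k) z ∈ Ideal.span (Set.range v) • (⊤ : Submodule R (Ext R X))) :
    ∃ y, koszul w y = z := by
  classical
  obtain ⟨N, hN⟩ := exists_kill_image_Ici_eq hk z
  obtain ⟨M, hM⟩ := exists_mem_span_Iio_smul v hz'
  set n := max N M with hn
  have hσ := hN n (le_max_left _ _)
  have hm := hM n (le_max_right _ _)
  -- Truncated weights: `z` does not involve the generators with index at least `n`, so it stays a
  -- cycle, and a bounding element can be projected back by killing them.
  let wn : X → R := fun x => if x ∈ k '' Set.Ici n then 0 else w x
  have h1 : ∀ y, koszul w (kill R (k '' Set.Ici n) y) = kill R (k '' Set.Ici n) (koszul wn y) :=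
    koszul_kill wn w _ (fun x hx => by simp only [wn, if_neg hx])
      (fun x hx => by simp only [wn, if_pos hx])
  have h2 : ∀ y, koszul wn (kill R (k '' Set.Ici n) y) = kill R (k '' Set.Ici n) (koszul wn y) :=
    koszul_kill wn wn _ (fun x hx => rfl) (fun x hx => by simp only [wn, if_pos hx])
  have h3 : koszul wn z = 0 := by
    have h4 := h2 z
    rw [← h1, hσ, hz] at h4
    exact h4
  have hr : k '' Set.Iio n ∪ k '' Set.Ici n = Set.range k := by
    rw [← Set.image_union, Set.Iio_union_Ici, Set.image_univ]
  obtain ⟨y, hy⟩ := koszul_exact_of_lt v hv k hk n wn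
    (fun i hi => by
      have : k i ∉ k '' Set.Ici n := by
        rintro ⟨j, hj, h⟩
        rw [hk h] at hj
        exact absurd (Set.mem_Ici.mp hj) (by omega)
      simp only [wn, if_neg this, hw])
    (fun x hx => by
      by_cases hx' : x ∈ k '' Set.Ici n
      · simp only [wn, if_pos hx']
      · have : x ∉ Set.range k := by
          rw [← hr]
          exact fun h => h.elim hx hx'
        simp only [wn, if_neg hx', hw' x this])
    z h3 (by
      have h4 : kill R (k '' Set.Iio n) z = kill R (Set.range k) z := by
        conv_lhs => rw [← hσ]
        rw [kill_kill, hr]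
      rwa [h4])
  exact ⟨kill R (k '' Set.Ici n) y, by rw [h1, hy, hσ]⟩

/-- A cycle that becomes zero after the elements of the regular sequence and the corresponding
generators are killed is a boundary. -/
theorem koszul_exact_of_extMap {S : Type} [CommRing S] (v : ℕ → R)
    (hv : ∀ n x, v n * x ∈ Ideal.span (v '' Set.Iio n) → x ∈ Ideal.span (v '' Set.Iio n))
    {k : ℕ → X} (hk : Function.Injective k) (w : X → R) (hw : ∀ i, w (k i) = v i)
    (hw' : ∀ x ∉ Set.range k, w x = 0) (f : R →+* S)
    (hf : RingHom.ker f = Ideal.span (Set.range v)) {z : Ext R X} (hz : koszul w z = 0)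
    (hz' : extMap f (fun x => Finsupp.single x 1) (kill R (Set.range k) z) = 0) :
    ∃ y, koszul w y = z := by
  rw [extMap_single_eq_zero_iff, hf] at hz'
  exact koszul_exact v hv hk w hw hw' hz hz'

end KoszulExact

/-! ## Integrality of twisted convolutions -/

section Integrality

variable {K : Type} [CommRing K] (p : ℕ)

/-- `(M * c)_n = ∑_{a + b = n} M_a c_b^{p^a}`. -/
def twConv (M c : ℕ → K) (n : ℕ) : K := ∑ a ∈ Finset.range (n + 1), M a * c (n - a) ^ p ^ a

theorem twConv_eq_add (M c : ℕ → K) (h0 : M 0 = 1) (n : ℕ) :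
    twConv p M c n = (∑ a ∈ Finset.range n, M (a + 1) * c (n - (a + 1)) ^ p ^ (a + 1)) + c n := by
  rw [twConv, Finset.sum_range_succ', h0]
  simp

theorem twConv_zero (M c : ℕ → K) (h0 : M 0 = 1) : twConv p M c 0 = c 0 := by
  rw [twConv_eq_add p M c h0]; simp

/-- The term of index `0` is `c n` itself and all other terms involve earlier values of `c`, so the
convolution can be solved recursively. -/
theorem twConv_left_cancel {M c d : ℕ → K} (h0 : M 0 = 1)
    (h : ∀ n, twConv p M c n = twConv p M d n) (n : ℕ) : c n = d n := by
  induction n using Nat.strong_induction_on with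
  | _ n ih =>
    have h1 := h n
    rw [twConv_eq_add p M c h0, twConv_eq_add p M d h0] at h1
    have h2 : ∑ a ∈ Finset.range n, M (a + 1) * c (n - (a + 1)) ^ p ^ (a + 1) =
        ∑ a ∈ Finset.range n, M (a + 1) * d (n - (a + 1)) ^ p ^ (a + 1) := by
      refine Finset.sum_congr rfl fun a ha => ?_
      rw [ih _ (by have := Finset.mem_range.mp ha; omega)]
    rw [h2] at h1
    exact add_left_cancel h1

theorem map_twConv {L : Type} [CommRing L] (f : K →+* L) (M c : ℕ → K) (n : ℕ) :
    f (twConv p M c n) = twConv p (fun n => f (M n)) (fun n => f (c n)) n := by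
  simp [twConv, map_sum]

theorem twConv_delta [Fact p.Prime] (M : ℕ → K) (n : ℕ) :
    twConv p M (fun n => if n = 0 then 1 else 0) n = M n := by
  rw [twConv, Finset.sum_range_succ, Finset.sum_eq_zero]
  · simp
  · intro a ha
    have h1 : n - a ≠ 0 := by have := Finset.mem_range.mp ha; omega
    have h2 : p ^ a ≠ 0 := (Nat.pow_pos (Fact.out : p.Prime).pos).ne'
    rw [if_neg h1, zero_pow h2, mul_zero]

/-- In characteristic `p` the twisted convolution is associative. -/
theorem twConv_assoc [Fact p.Prime] [CharP K p] (M c d : ℕ → K) (n : ℕ) :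
    twConv p (twConv p M c) d n = twConv p M (twConv p c d) n := by
  have : ExpChar K p := ExpChar.prime Fact.out
  -- The only place where the characteristic matters: the `p ^ a`-th power distributes over the
  -- inner sum.
  simp only [twConv, Finset.sum_mul, sum_pow_char_pow, Finset.mul_sum]
  rw [Finset.sum_sigma', Finset.sum_sigma']
  refine Finset.sum_bij' (fun x _ => ⟨x.2, x.1 - x.2⟩) (fun x _ => ⟨x.1 + x.2, x.1⟩) ?_ ?_ ?_ ?_ ?_
  · rintro ⟨a, b⟩ h
    simp only [Finset.mem_sigma, Finset.mem_range] at h ⊢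
    omega
  · rintro ⟨a, b⟩ h
    simp only [Finset.mem_sigma, Finset.mem_range] at h ⊢
    omega
  · rintro ⟨a, b⟩ h
    simp only [Finset.mem_sigma, Finset.mem_range] at h
    have h1 : b + (a - b) = a := by omega
    simp [h1]
  · rintro ⟨a, b⟩ h
    simp
  · rintro ⟨a, b⟩ h
    simp only [Finset.mem_sigma, Finset.mem_range] at h
    have h1 : n - b - (a - b) = n - a := by omega
    have h2 : p ^ a = p ^ (a - b) * p ^ b := by rw [← pow_add]; congr 1; omega
    rw [h1, mul_pow, ← pow_mul, h2, mul_assoc]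

variable (U : Subring K) (σ : K →+* K)

/-- The defect of the functional equation with coefficients `u`. -/
def feDefect (u w : ℕ → K) (n : ℕ) : K := ∑ b ∈ Finset.range (n + 1), u b * (σ ^ b) (w (n - b))

/-- `p U`. -/
def pMul : AddSubgroup K := U.toAddSubgroup.map (AddMonoidHom.mulLeft (p : K))

variable {p U σ}

theorem mem_pMul {x : K} : x ∈ pMul p U ↔ ∃ y ∈ U, (p : K) * y = x := Iff.rfl

theorem mul_mem_pMul {x y : K} (hx : x ∈ U) (hy : y ∈ pMul p U) : x * y ∈ pMul p U := by
  obtain ⟨z, hz, rfl⟩ := hy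
  exact ⟨x * z, U.mul_mem hx hz, by simp only [AddMonoidHom.coe_mulLeft]; ring⟩

theorem pow_apply_mem (hσ : ∀ x ∈ U, σ x ∈ U) {x : K} (hx : x ∈ U) (b : ℕ) : (σ ^ b) x ∈ U := by
  induction b with
  | zero => exact hx
  | succ b ih => rw [pow_succ', RingHom.mul_def, RingHom.comp_apply]; exact hσ _ ih

/-- Solving the functional equation for `p * w n` adds one factor `p` to the denominator at each
index. -/
theorem pow_mul_mem_of_feDefect (hp : IsLeftRegular (p : K)) {u w : ℕ → K}
    (hσ : ∀ x ∈ U, σ x ∈ U) (hu : ∀ b, u b ∈ U) (hu0 : u 0 = p) {N : ℕ}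
    (hw : ∀ n < N, feDefect σ u w n ∈ pMul p U) : ∀ n < N, (p : K) ^ n * w n ∈ U := by
  intro n hn
  induction n using Nat.strong_induction_on with
  | _ n ih =>
    obtain ⟨y, hy, h⟩ := mem_pMul.mp (hw n hn)
    rw [feDefect, Finset.sum_range_succ', hu0] at h
    cases n with
    | zero =>
      simp only [Finset.range_zero, Finset.sum_empty, zero_add, pow_zero, RingHom.one_def,
        RingHom.id_apply] at h
      rw [pow_zero, one_mul, ← hp h]
      exact hy
    | succ n =>
      have h1 : (p : K) ^ (n + 1) * w (n + 1) = (p : K) ^ n * (p * y) -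
          ∑ b ∈ Finset.range (n + 1), u (b + 1) * ((p : K) ^ b *
            (σ ^ (b + 1)) ((p : K) ^ (n - b) * w (n - b))) := by
        have h2 : ∑ b ∈ Finset.range (n + 1), u (b + 1) * ((p : K) ^ b *
            (σ ^ (b + 1)) ((p : K) ^ (n - b) * w (n - b))) =
            (p : K) ^ n * ∑ b ∈ Finset.range (n + 1), u (b + 1) *
              (σ ^ (b + 1)) (w (n + 1 - (b + 1))) := by
          rw [Finset.mul_sum]
          refine Finset.sum_congr rfl fun b hb => ?_
          have h3 : n = b + (n - b) := by have := Finset.mem_range.mp hb; omega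
          have h4 : n + 1 - (b + 1) = n - b := by omega
          rw [map_mul, map_pow, map_natCast, h4]
          conv_rhs => rw [show (p : K) ^ n = (p : K) ^ b * (p : K) ^ (n - b) by
            rw [← pow_add, ← h3]]
          ring
        rw [h2, h]
        simp only [pow_zero, RingHom.one_def, RingHom.id_apply, Nat.sub_zero]
        ring
      rw [h1]
      have hpU : ∀ k, (p : K) ^ k ∈ U := fun k => U.pow_mem (natCast_mem U p) k
      refine U.sub_mem (U.mul_mem (hpU n) (U.mul_mem (natCast_mem U p) hy))
        (U.sum_mem fun b hb => U.mul_mem (hu _) (U.mul_mem (hpU b) (pow_apply_mem hσ ?_ _)))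
      have := Finset.mem_range.mp hb
      exact ih _ (by omega) (by omega)

/-- Iterating the Frobenius lift gives `σ^b c ≡ c^{p^b}` modulo `p`, and each `p`-th power of a
congruence gains one more factor `p`. -/
theorem exists_frobenius_pow [Fact p.Prime] (hσ : ∀ x ∈ U, ∃ y ∈ U, σ x = x ^ p + p * y)
    {c : K} (hc : c ∈ U) (b k : ℕ) :
    ∃ y ∈ U, ((σ ^ b) c) ^ p ^ k = c ^ p ^ (b + k) + (p : K) ^ (k + 1) * y := by
  have hσ' : ∀ x ∈ U, σ x ∈ U := by
    intro x hx
    obtain ⟨y, hy, h⟩ := hσ x hx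
    rw [h]
    exact U.add_mem (U.pow_mem hx _) (U.mul_mem (natCast_mem U p) hy)
  have h1 : ∀ b, (p : U) ∣ ⟨(σ ^ b) c, pow_apply_mem hσ' hc b⟩ - ⟨c, hc⟩ ^ p ^ b := by
    intro b
    induction b with
    | zero =>
      simp only [pow_zero, pow_one]
      have : (⟨(1 : K →+* K) c, pow_apply_mem hσ' hc 0⟩ : U) = ⟨c, hc⟩ := rfl
      rw [this, sub_self]
      exact dvd_zero _
    | succ b ih =>
      obtain ⟨y, hy, h⟩ := hσ _ (pow_apply_mem hσ' hc b)
      have h2 : (⟨(σ ^ (b + 1)) c, pow_apply_mem hσ' hc (b + 1)⟩ : U) =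
          ⟨(σ ^ b) c, pow_apply_mem hσ' hc b⟩ ^ p + (p : U) * ⟨y, hy⟩ := by
        refine Subtype.ext (Eq.trans ?_ h)
        show (σ ^ (b + 1)) c = σ ((σ ^ b) c)
        rw [pow_succ', RingHom.mul_def, RingHom.comp_apply]
      rw [h2, pow_succ, pow_mul, add_sub_right_comm]
      exact dvd_add (ih.trans (sub_dvd_pow_sub_pow _ _ p)) (dvd_mul_right _ _)
  obtain ⟨y, hy⟩ := dvd_sub_pow_of_dvd_sub (h1 b) k
  refine ⟨y, y.2, ?_⟩
  have := congrArg (Subtype.val) hy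
  simp only [AddSubgroupClass.coe_sub, SubmonoidClass.coe_pow, Subring.coe_mul,
    Subring.coe_natCast] at this
  rw [← this, ← pow_mul, ← pow_add]
  ring

/-- The heart of the functional equation lemma. Replacing `(σ^b c)^{p^{n-b}}` by `c^{p^n}` costs a
multiple of `p^{n-b+1}`, which clears the denominator `p^{n-b}` of `w (n - b)` and leaves a factor
`p`. -/
theorem feDefect_mul_pow_mem [Fact p.Prime] (hp : IsLeftRegular (p : K))
    (hσ : ∀ x ∈ U, ∃ y ∈ U, σ x = x ^ p + p * y) {u w : ℕ → K} (hu : ∀ b, u b ∈ U)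
    (hu0 : u 0 = p) {N : ℕ} (hw : ∀ n < N, feDefect σ u w n ∈ pMul p U) {c : K} (hc : c ∈ U) :
    ∀ n < N, feDefect σ u (fun n => w n * c ^ p ^ n) n ∈ pMul p U := by
  have hσ' : ∀ x ∈ U, σ x ∈ U := by
    intro x hx
    obtain ⟨y, hy, h⟩ := hσ x hx
    rw [h]
    exact U.add_mem (U.pow_mem hx _) (U.mul_mem (natCast_mem U p) hy)
  intro n hn
  choose y hy h using fun b : ℕ => exists_frobenius_pow hσ hc b (n - b)
  have h1 : feDefect σ u (fun n => w n * c ^ p ^ n) n = c ^ p ^ n * feDefect σ u w n +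
      ∑ b ∈ Finset.range (n + 1),
        u b * (σ ^ b) ((p : K) ^ (n - b) * w (n - b)) * y b * (p * 1) := by
    rw [feDefect, feDefect, Finset.mul_sum, ← Finset.sum_add_distrib]
    refine Finset.sum_congr rfl fun b hb => ?_
    have h3 : b + (n - b) = n := by have := Finset.mem_range.mp hb; omega
    rw [map_mul, map_pow, h, h3, map_mul, map_pow, map_natCast]
    ring
  rw [h1]
  refine add_mem (mul_mem_pMul (U.pow_mem hc _) (hw n hn)) (sum_mem fun b hb => ?_)
  refine mul_mem_pMul (U.mul_mem (U.mul_mem (hu b) (pow_apply_mem hσ' ?_ b)) (hy b))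
    ⟨1, U.one_mem, rfl⟩
  exact pow_mul_mem_of_feDefect hp hσ' hu hu0 hw _ (by omega)

/-- Regrouping by the index of `c` reduces a convolution to the sequences `M m * x ^ p ^ m` with a
fixed `x`. -/
theorem feDefect_twConv (u M c : ℕ → K) (n : ℕ) :
    feDefect σ u (twConv p M c) n =
      ∑ i ∈ Finset.range (n + 1), feDefect σ u (fun m => M m * c i ^ p ^ m) (n - i) := by
  simp only [feDefect, twConv, map_sum, Finset.mul_sum]
  rw [Finset.sum_sigma', Finset.sum_sigma']
  refine Finset.sum_bij' (fun x _ => ⟨n - x.1 - x.2, x.1⟩) (fun x _ => ⟨x.2, n - x.1 - x.2⟩)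
    ?_ ?_ ?_ ?_ ?_
  · rintro ⟨a, b⟩ h
    simp only [Finset.mem_sigma, Finset.mem_range] at h ⊢
    omega
  · rintro ⟨a, b⟩ h
    simp only [Finset.mem_sigma, Finset.mem_range] at h ⊢
    omega
  · rintro ⟨a, b⟩ h
    simp only [Finset.mem_sigma, Finset.mem_range] at h
    have : n - (n - a - b) - a = b := by omega
    simp [this]
  · rintro ⟨a, b⟩ h
    simp only [Finset.mem_sigma, Finset.mem_range] at h
    have : n - b - (n - a - b) = a := by omega
    simp [this]
  · rintro ⟨a, b⟩ h
    simp only [Finset.mem_sigma, Finset.mem_range] at h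
    have h1 : n - (n - a - b) - a = b := by omega
    rw [h1]

/-- Functional equation lemma: an integral change of coordinate preserves the functional equation.
-/
theorem feDefect_twConv_mem [Fact p.Prime] (hp : IsLeftRegular (p : K))
    (hσ : ∀ x ∈ U, ∃ y ∈ U, σ x = x ^ p + p * y) {u M c : ℕ → K} (hu : ∀ b, u b ∈ U)
    (hu0 : u 0 = p) (hM : ∀ n, feDefect σ u M n ∈ pMul p U) (hc : ∀ n, c n ∈ U) (n : ℕ) :
    feDefect σ u (twConv p M c) n ∈ pMul p U := by
  rw [feDefect_twConv]
  exact sum_mem fun i _ => feDefect_mul_pow_mem hp hσ hu hu0 (N := n - i + 1)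
    (fun k _ => hM k) (hc i) _ (by omega)

/-- Converse: two logarithms with the same functional equation differ by an integral coordinate
change. In the defect at `n`, the summand of `c n` is `p * c n`, and the others lie in `p U` by
induction. -/
theorem mem_of_feDefect_twConv [Fact p.Prime] (hp : IsLeftRegular (p : K))
    (hσ : ∀ x ∈ U, ∃ y ∈ U, σ x = x ^ p + p * y) {u M c : ℕ → K} (hu : ∀ b, u b ∈ U)
    (hu0 : u 0 = p) (hM : ∀ n, feDefect σ u M n ∈ pMul p U) (hM0 : M 0 = 1)
    (hw : ∀ n, feDefect σ u (twConv p M c) n ∈ pMul p U) (n : ℕ) : c n ∈ U := by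
  induction n using Nat.strong_induction_on with
  | _ n ih =>
    have h := hw n
    rw [feDefect_twConv, Finset.sum_range_succ, Nat.sub_self] at h
    have h1 : ∑ i ∈ Finset.range n, feDefect σ u (fun m => M m * c i ^ p ^ m) (n - i) ∈
        pMul p U := sum_mem fun i hi => feDefect_mul_pow_mem hp hσ hu hu0 (N := n - i + 1)
          (fun k _ => hM k) (ih i (Finset.mem_range.mp hi)) _ (by omega)
    obtain ⟨y, hy, h2⟩ := mem_pMul.mp ((AddSubgroup.add_mem_cancel_left _ h1).mp h)
    have h3 : feDefect σ u (fun m => M m * c n ^ p ^ m) 0 = p * c n := by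
      simp [feDefect, hu0, hM0]
    rw [h3] at h2
    rw [← hp h2]
    exact hy

/-- Araki's formula reads `(p - p^{p^n}) m_n = ∑_{a<n} m_a v_{n-a}^{p^a}`. The factor on the left is
`p` times an element inverted by `hloc`, so each index costs one `p`. -/
theorem pow_mul_log_mem {m v : ℕ → K} (hm0 : m 0 = 1)
    (hv : ∀ n, v n ∈ U) (hv0 : v 0 = p) (hmv : ∀ n, twConv p m v n = p * m n) (hp1 : 1 < p)
    (hloc : ∀ n, 0 < n → ∃ y ∈ U, (1 - (p : K) ^ (p ^ n - 1)) * y = 1) (n : ℕ) :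
    (p : K) ^ n * m n ∈ U := by
  induction n using Nat.strong_induction_on with
  | _ n ih =>
    cases n with
    | zero => simp [hm0]
    | succ n =>
      have h := hmv (n + 1)
      rw [twConv, Finset.sum_range_succ, Nat.sub_self, hv0] at h
      obtain ⟨y, hy, hy1⟩ := hloc (n + 1) (Nat.succ_pos n)
      have hpos : 0 < p ^ (n + 1) := Nat.pow_pos (by omega)
      have h1 : (p : K) ^ (n + 1) * m (n + 1) = y * ∑ a ∈ Finset.range (n + 1),
          (p : K) ^ (n - a) * ((p : K) ^ a * m a) * v (n + 1 - a) ^ p ^ a := by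
        have h2 : ∑ a ∈ Finset.range (n + 1),
            (p : K) ^ (n - a) * ((p : K) ^ a * m a) * v (n + 1 - a) ^ p ^ a =
            (p : K) ^ n * ∑ a ∈ Finset.range (n + 1), m a * v (n + 1 - a) ^ p ^ a := by
          rw [Finset.mul_sum]
          refine Finset.sum_congr rfl fun a ha => ?_
          have h3 : n - a + a = n := by have := Finset.mem_range.mp ha; omega
          rw [← mul_assoc, ← pow_add, h3]
          ring
        have h4 : (p : K) ^ p ^ (n + 1) = p * (p : K) ^ (p ^ (n + 1) - 1) := by
          rw [← pow_succ', Nat.sub_add_cancel hpos]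
        rw [h2, eq_sub_of_add_eq h, h4]
        linear_combination (-(p : K) ^ (n + 1) * m (n + 1)) * hy1
      rw [h1]
      refine U.mul_mem hy (U.sum_mem fun a ha => U.mul_mem (U.mul_mem
        (U.pow_mem (natCast_mem U p) _) (ih a (Finset.mem_range.mp ha))) (U.pow_mem (hv _) _))

/-- The coefficients of the functional equation of a logarithm. -/
def feCoeff (p : ℕ) (σ : K →+* K) (m : ℕ → K) : ℕ → K
  | 0 => p
  | n + 1 => - ∑ b : Fin (n + 1), feCoeff p σ m b * (σ ^ (b : ℕ)) (m (n + 1 - b))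

/-- A logarithm of Araki type satisfies a functional equation with integral coefficients. -/
theorem exists_functional_equation [Fact p.Prime] (hp : IsLeftRegular (p : K))
    (hσ : ∀ x ∈ U, ∃ y ∈ U, σ x = x ^ p + p * y) {m v : ℕ → K} (hm0 : m 0 = 1)
    (hv : ∀ n, v n ∈ U) (hv0 : v 0 = p) (hmv : ∀ n, twConv p m v n = p * m n)
    (hloc : ∀ n, 0 < n → ∃ y ∈ U, (1 - (p : K) ^ (p ^ n - 1)) * y = 1) :
    ∃ u : ℕ → K, (∀ b, u b ∈ U) ∧ u 0 = p ∧ ∀ n, feDefect σ u m n ∈ pMul p U := by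
  have hp1 : 1 < p := (Fact.out : p.Prime).one_lt
  have hσ' : ∀ x ∈ U, σ x ∈ U := by
    intro x hx
    obtain ⟨y, hy, h⟩ := hσ x hx
    rw [h]
    exact U.add_mem (U.pow_mem hx _) (U.mul_mem (natCast_mem U p) hy)
  set u := feCoeff p σ m with hu
  have hu0 : u 0 = p := by rw [hu, feCoeff]
  have hun : ∀ n, 0 < n → ∑ b ∈ Finset.range n, u b * (σ ^ b) (m (n - b)) = - u n := by
    intro n hn
    obtain ⟨n, rfl⟩ := Nat.exists_eq_add_of_le' hn
    rw [hu, feCoeff, neg_neg, Finset.sum_range]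
  have hD : ∀ n, feDefect σ u m n ∈ pMul p U := by
    intro n
    rcases Nat.eq_zero_or_pos n with rfl | hn
    · exact ⟨1, U.one_mem, by simp [feDefect, hu0, hm0]⟩
    · rw [feDefect, Finset.sum_range_succ, hun n hn, Nat.sub_self, hm0, map_one, mul_one,
        neg_add_cancel]
      exact zero_mem _
  refine ⟨u, fun n => ?_, hu0, hD⟩
  induction n using Nat.strong_induction_on with
  | _ n ih =>
    rcases Nat.eq_zero_or_pos n with rfl | hn
    · rw [hu0]; exact natCast_mem U p
    -- Integrality of `u n` is not yet known, so the estimates are applied to the coefficients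
    -- truncated below `n`.
    let u' : ℕ → K := fun b => if b < n then u b else 0
    have hu' : ∀ b, u' b ∈ U := by
      intro b
      by_cases hb : b < n
      · simp only [u', if_pos hb]; exact ih b hb
      · simp only [u', if_neg hb]; exact U.zero_mem
    have hu0' : u' 0 = p := by simp only [u', if_pos hn, hu0]
    have hD' : ∀ k < n, feDefect σ u' m k ∈ pMul p U := by
      intro k hk
      have : feDefect σ u' m k = feDefect σ u m k := by
        refine Finset.sum_congr rfl fun b hb => ?_
        have : b < n := by have := Finset.mem_range.mp hb; omega
        simp only [u', if_pos this]
      rw [this]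
      exact hD k
    have hun' : ∀ w : ℕ → K, feDefect σ u' w n =
        ∑ b ∈ Finset.range n, u b * (σ ^ b) (w (n - b)) := by
      intro w
      rw [feDefect, Finset.sum_range_succ]
      simp only [u', lt_irrefl, if_false, zero_mul, add_zero]
      refine Finset.sum_congr rfl fun b hb => ?_
      simp only [if_pos (Finset.mem_range.mp hb)]
    -- The defect of `p * m = twConv p m v` is computed in two ways. By the definition of `u` it is
    -- `-p u_n`; the convolution shows that it lies in `p U`.
    have h1 : feDefect σ u' (twConv p m v) n = - ((p : K) * u n) := by
      rw [hun', ← mul_neg, ← hun n hn, Finset.mul_sum]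
      refine Finset.sum_congr rfl fun b _ => ?_
      rw [hmv, map_mul, map_natCast]
      ring
    have h2 : feDefect σ u' (twConv p m v) n ∈ pMul p U := by
      rw [feDefect_twConv, Finset.sum_range_succ']
      refine add_mem (sum_mem fun i hi => feDefect_mul_pow_mem hp hσ hu' hu0' hD' (hv _) _
        (by have := Finset.mem_range.mp hi; omega)) ?_
      -- The summand of `v_0 = p` is not covered by the truncated estimate. It is handled directly:
      -- `p^{p^k} m_k` lies in `p U` because `p^k ≥ k + 1` and `p^k m_k` is integral.
      rw [Nat.sub_zero, hun', hv0]
      refine sum_mem fun b hb => mul_mem_pMul (ih b (Finset.mem_range.mp hb)) ?_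
      have hk : 0 < n - b := by have := Finset.mem_range.mp hb; omega
      set k := n - b
      have hkp : k + 1 ≤ p ^ k := Nat.lt_pow_self hp1
      have h3 : m k * (p : K) ^ p ^ k =
          (p : K) ^ (p ^ k - (k + 1)) * ((p : K) ^ k * m k) * p := by
        conv_lhs => rw [show p ^ k = (p ^ k - (k + 1)) + k + 1 by omega]
        ring
      rw [h3, map_mul, map_natCast]
      refine mul_mem_pMul (pow_apply_mem hσ' (U.mul_mem (U.pow_mem (natCast_mem U p) _)
        (pow_mul_log_mem hm0 hv hv0 hmv hp1 hloc k)) b) ⟨1, U.one_mem, by simp⟩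
    rw [h1, neg_mem_iff] at h2
    obtain ⟨y, hy, h4⟩ := h2
    rw [← hp h4]
    exact hy

end Integrality

/-! ## The ring of `p`-local integers -/

section PInt

variable (p : ℕ)

theorem not_dvd_den_of_mul_eq {q : ℚ} {a : ℤ} {b : ℕ} (hb : ¬ p ∣ b) (h : q * b = a) :
    ¬ p ∣ q.den := by
  have hb0 : (b : ℚ) ≠ 0 := by
    rintro h0
    exact hb (by rw [Nat.cast_eq_zero.mp h0]; exact dvd_zero p)
  have hq : q = ((a : ℚ) / ((b : ℤ) : ℚ)) := by
    rw [eq_div_iff (by exact_mod_cast hb0)]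
    exact_mod_cast h
  intro hd
  have := Rat.den_dvd a b
  rw [Rat.divInt_eq_div, ← hq] at this
  exact hb (hd.trans (by exact_mod_cast this))

variable [Fact p.Prime]

/-- The subring `ℤ_(p)` of `ℚ`. -/
def pInt : Subring ℚ where
  carrier := {q | ¬ p ∣ q.den}
  zero_mem' := by simpa using (Fact.out : p.Prime).one_lt.ne'
  one_mem' := by simpa using (Fact.out : p.Prime).one_lt.ne'
  add_mem' := by
    intro q r hq hr
    refine not_dvd_den_of_mul_eq p (a := q.num * r.den + r.num * q.den) (b := q.den * r.den)
      ((Fact.out : p.Prime).not_dvd_mul hq hr) ?_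
    push_cast
    have h1 := q.mul_den_eq_num
    have h2 := r.mul_den_eq_num
    linear_combination (r.den : ℚ) * h1 + (q.den : ℚ) * h2
  mul_mem' := by
    intro q r hq hr
    refine not_dvd_den_of_mul_eq p (a := q.num * r.num) (b := q.den * r.den)
      ((Fact.out : p.Prime).not_dvd_mul hq hr) ?_
    push_cast
    rw [← q.mul_den_eq_num, ← r.mul_den_eq_num]
    ring
  neg_mem' := by
    intro q hq
    exact hq

theorem den_cast_ne_zero {q : ℚ} (hq : q ∈ pInt p) : (q.den : ZMod p) ≠ 0 := by
  rw [Ne, ZMod.natCast_eq_zero_iff]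
  exact hq

/-- Reduction modulo `p`. -/
def pRed : pInt p →+* ZMod p where
  toFun q := ((q : ℚ) : ZMod p)
  map_one' := by simp
  map_zero' := by simp
  map_add' q r := Rat.cast_add_of_ne_zero (den_cast_ne_zero p q.2) (den_cast_ne_zero p r.2)
  map_mul' q r := Rat.cast_mul_of_ne_zero (den_cast_ne_zero p q.2) (den_cast_ne_zero p r.2)

theorem pRed_eq_zero_iff (q : pInt p) : pRed p q = 0 ↔ (p : pInt p) ∣ q := by
  constructor
  · intro h
    have h1 : ((q : ℚ) : ZMod p) = 0 := h
    rw [Rat.cast_def, div_eq_zero_iff, or_iff_left (den_cast_ne_zero p q.2),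
      ZMod.intCast_zmod_eq_zero_iff_dvd] at h1
    obtain ⟨a, ha⟩ := h1
    have hp0 : (p : ℚ) ≠ 0 := Nat.cast_ne_zero.mpr (Fact.out : p.Prime).ne_zero
    refine ⟨⟨(q : ℚ) / p, ?_⟩, ?_⟩
    · refine not_dvd_den_of_mul_eq p (a := a) (b := (q : ℚ).den) q.2 ?_
      rw [div_mul_eq_mul_div, (q : ℚ).mul_den_eq_num, ha]
      push_cast
      field_simp
    · refine Subtype.ext ?_
      push_cast
      field_simp
  · rintro ⟨r, rfl⟩
    rw [map_mul, map_natCast, CharP.cast_eq_zero, zero_mul]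

theorem pRed_surjective : Function.Surjective (pRed p) := fun z =>
  ⟨(z.val : pInt p), by rw [map_natCast, ZMod.natCast_zmod_val]⟩

theorem map_pRed_eq_zero_iff {X : Type} (x : MvPolynomial X (pInt p)) :
    MvPolynomial.map (pRed p) x = 0 ↔ (p : MvPolynomial X (pInt p)) ∣ x := by
  have hC : (p : MvPolynomial X (pInt p)) = MvPolynomial.C (p : pInt p) := by simp
  rw [hC, MvPolynomial.C_dvd_iff_dvd_coeff, MvPolynomial.ext_iff]
  simp only [MvPolynomial.coeff_map, MvPolynomial.coeff_zero, pRed_eq_zero_iff]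

theorem pInt_isRegular {X : Type} : IsLeftRegular (p : MvPolynomial X (pInt p)) :=
  (IsRegular.of_ne_zero (Nat.cast_ne_zero.mpr (Fact.out : p.Prime).ne_zero)).left

/-- The inclusion of the polynomials with coefficients in `ℤ_(p)`. -/
def pIncl (X : Type) : MvPolynomial X (pInt p) →+* MvPolynomial X ℚ :=
  MvPolynomial.map (pInt p).subtype

theorem pIncl_injective (X : Type) : Function.Injective (pIncl p X) :=
  MvPolynomial.map_injective _ Subtype.val_injective

/-- Raising all variables to the `p`-th power and fixing the coefficients lifts Frobenius: over
`F_p` this substitution is the `p`-th power map. -/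
theorem exists_frobenius_lift {X : Type} :
    ∀ x ∈ (pIncl p X).range, ∃ y ∈ (pIncl p X).range,
      (MvPolynomial.expand p : MvPolynomial X ℚ →ₐ[ℚ] _).toRingHom x = x ^ p + p * y := by
  rintro _ ⟨x, rfl⟩
  have h : (p : MvPolynomial X (pInt p)) ∣ MvPolynomial.expand p x - x ^ p := by
    rw [← map_pRed_eq_zero_iff, map_sub, map_pow, MvPolynomial.map_expand,
      MvPolynomial.expand_zmod, sub_self]
  obtain ⟨y, hy⟩ := h
  refine ⟨_, ⟨y, rfl⟩, ?_⟩
  have h1 : pIncl p X (MvPolynomial.expand p x) = MvPolynomial.expand p (pIncl p X x) :=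
    MvPolynomial.map_expand _ _ _
  have h2 := congrArg (pIncl p X) hy
  rw [map_sub, h1, map_mul, map_pow, map_natCast] at h2
  rw [← h2]
  simp

theorem one_sub_pow_inv_mem_pInt {k : ℕ} (hk : 0 < k) : (1 - (p : ℚ) ^ k)⁻¹ ∈ pInt p := by
  have hp1 : 1 < p := (Fact.out : p.Prime).one_lt
  have h1 : 1 < p ^ k := Nat.one_lt_pow hk.ne' hp1
  have h2 : (1 - (p : ℚ) ^ k) ≠ 0 := by
    rw [sub_ne_zero]; exact_mod_cast h1.ne
  refine not_dvd_den_of_mul_eq p (a := -1) (b := p ^ k - 1) ?_ ?_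
  · intro h
    have h3 : p ∣ 1 := by
      rw [← Nat.sub_sub_self h1.le]
      exact Nat.dvd_sub (dvd_pow_self p hk.ne') h
    exact hp1.ne' (Nat.dvd_one.mp h3)
  · rw [Nat.cast_sub h1.le]
    push_cast
    field_simp
    ring

end PInt

/-! ## Polynomial generators of `bp` -/

/-- A rooted tree on the index set. -/
structure RootedTree (I : Type) where
  root : I
  parent : I → I
  rank : I → ℕ
  rank_lt : ∀ j, j ≠ root → rank (parent j) < rank j

section Param

/-- The `n`-th variable of the family `j`, with value `1` for `n = 0`. -/
def famVar (R : Type) [CommRing R] {I : Type} (j : I) : ℕ → MvPolynomial (I × ℕ) R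
  | 0 => 1
  | n + 1 => MvPolynomial.X (j, n)

/-- The `n`-th variable of the family `j`, with value `p` for `n = 0`. -/
def vVar (p : ℕ) (R : Type) [CommRing R] {I : Type} (j : I) : ℕ → MvPolynomial (I × ℕ) R
  | 0 => p
  | n + 1 => MvPolynomial.X (j, n)

variable (p : ℕ) {I : Type} (O : RootedTree I)

/-- The logarithm with Araki generators `vVar`. -/
def rootLog (j : I) (n : ℕ) : MvPolynomial (I × ℕ) ℚ :=
  if n = 0 then 1 else MvPolynomial.C ((p : ℚ) - (p : ℚ) ^ p ^ n)⁻¹ *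
    ∑ a : Fin n, rootLog j a * vVar p ℚ j (n - a) ^ p ^ (a : ℕ)
termination_by n
decreasing_by exact a.2

open Classical in
/-- The logarithm of the family `j` in terms of the Araki generators at the root and the
transition coefficients along the tree. -/
def treeLog (j : I) : ℕ → MvPolynomial (I × ℕ) ℚ :=
  if _h : j = O.root then rootLog p j else twConv p (treeLog (O.parent j)) (famVar ℚ j)
termination_by O.rank j
decreasing_by exact O.rank_lt j _h

theorem rootLog_zero (j : I) : rootLog p j 0 = 1 := by rw [rootLog]; simp

theorem treeLog_root : treeLog p O O.root = rootLog p O.root := by rw [treeLog, dif_pos rfl]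

theorem treeLog_of_ne {j : I} (hj : j ≠ O.root) :
    treeLog p O j = twConv p (treeLog p O (O.parent j)) (famVar ℚ j) := by
  rw [treeLog, dif_neg hj]

theorem tree_induction {P : I → Prop} (h0 : P O.root)
    (h1 : ∀ j, j ≠ O.root → P (O.parent j) → P j) (j : I) : P j := by
  induction hn : O.rank j using Nat.strong_induction_on generalizing j with
  | _ n ih =>
    by_cases hj : j = O.root
    · rw [hj]; exact h0
    · exact h1 j hj (ih _ (hn ▸ O.rank_lt j hj) _ rfl)

theorem treeLog_zero (j : I) : treeLog p O j 0 = 1 := by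
  induction j using tree_induction O with
  | h0 => rw [treeLog_root, rootLog_zero]
  | h1 j hj ih =>
    rw [treeLog_of_ne p O hj, twConv_zero p _ _ ih]
    rfl

/-- Logarithm coefficients expressed in the polynomial generators. -/
def logToTree : MvPolynomial (I × ℕ) ℚ →+* MvPolynomial (I × ℕ) ℚ :=
  MvPolynomial.eval₂Hom MvPolynomial.C fun x => treeLog p O x.1 (x.2 + 1)

open Classical in
/-- The polynomial generators expressed in the logarithm coefficients. -/
def treeToLog : MvPolynomial (I × ℕ) ℚ →+* MvPolynomial (I × ℕ) ℚ :=
  MvPolynomial.eval₂Hom MvPolynomial.C fun x =>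
    if x.1 = O.root then araki p x.1 (x.2 + 1) else transition p (O.parent x.1) x.1 (x.2 + 1)

theorem logToTree_logCoeff (j : I) (n : ℕ) : logToTree p O (logCoeff j n) = treeLog p O j n := by
  cases n with
  | zero => rw [treeLog_zero, logCoeff, map_one]
  | succ n => rw [logCoeff, logToTree, MvPolynomial.eval₂Hom_X']

theorem twConv_araki (j : I) (n : ℕ) :
    twConv p (logCoeff j) (araki p j) n = p * logCoeff j n := araki_spec p j n

theorem twConv_transition (i j : I) (n : ℕ) :
    twConv p (logCoeff i) (transition p i j) n = logCoeff j n := transition_spec p i j n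

theorem araki_zero (j : I) : araki p j 0 = p := by
  rw [araki]; simp [logCoeff]

theorem transition_zero (i j : I) : transition p i j 0 = 1 := by
  rw [transition]; simp [logCoeff]

theorem treeToLog_vVar (n : ℕ) : treeToLog p O (vVar p ℚ O.root n) = araki p O.root n := by
  cases n with
  | zero => rw [vVar, map_natCast, araki_zero]
  | succ n => rw [vVar, treeToLog, MvPolynomial.eval₂Hom_X', if_pos rfl]

theorem treeToLog_famVar {j : I} (hj : j ≠ O.root) (n : ℕ) :
    treeToLog p O (famVar ℚ j n) = transition p (O.parent j) j n := by
  cases n with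
  | zero => rw [famVar, map_one, transition_zero]
  | succ n => rw [famVar, treeToLog, MvPolynomial.eval₂Hom_X', if_neg hj]

theorem twConv_logToTree_araki (j : I) (n : ℕ) :
    twConv p (treeLog p O j) (fun n => logToTree p O (araki p j n)) n =
      p * treeLog p O j n := by
  have := congrArg (logToTree p O) (twConv_araki p j n)
  rw [map_twConv, map_mul, map_natCast, logToTree_logCoeff] at this
  simpa only [logToTree_logCoeff] using this

theorem twConv_logToTree_transition (i j : I) (n : ℕ) :
    twConv p (treeLog p O i) (fun n => logToTree p O (transition p i j n)) n =
      treeLog p O j n := by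
  have := congrArg (logToTree p O) (twConv_transition p i j n)
  rw [map_twConv, logToTree_logCoeff] at this
  simpa only [logToTree_logCoeff] using this

/-- Both sides convolve the parent's logarithm into that of `j`, and convolution on the left can be
cancelled. -/
theorem logToTree_transition_parent {j : I} (hj : j ≠ O.root) (n : ℕ) :
    logToTree p O (transition p (O.parent j) j n) = famVar ℚ j n := by
  refine twConv_left_cancel p (treeLog_zero p O (O.parent j))
    (c := fun n => logToTree p O (transition p (O.parent j) j n)) (fun n => ?_) n
  rw [twConv_logToTree_transition, treeLog_of_ne p O hj]

variable [Fact p.Prime]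

theorem p_sub_pow_ne_zero {n : ℕ} (hn : n ≠ 0) : (p : ℚ) - (p : ℚ) ^ p ^ n ≠ 0 := by
  have hp1 : 1 < p := (Fact.out : p.Prime).one_lt
  rw [sub_ne_zero]
  have h1 : p ^ 1 < p ^ p ^ n := Nat.pow_lt_pow_right hp1 (Nat.one_lt_pow hn hp1)
  rw [pow_one] at h1
  exact_mod_cast h1.ne

theorem twConv_rootLog (j : I) (n : ℕ) :
    twConv p (rootLog p j) (vVar p ℚ j) n = p * rootLog p j n := by
  cases n with
  | zero => rw [twConv_zero p _ _ (rootLog_zero p j), rootLog_zero, mul_one]; rfl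
  | succ n =>
    have h1 := p_sub_pow_ne_zero p (Nat.succ_ne_zero n)
    have h2 : ∑ a ∈ Finset.range (n + 1),
        rootLog p j a * vVar p ℚ j (n + 1 - a) ^ p ^ a =
        MvPolynomial.C ((p : ℚ) - (p : ℚ) ^ p ^ (n + 1)) * rootLog p j (n + 1) := by
      conv_rhs => rw [rootLog, if_neg (Nat.succ_ne_zero n), ← mul_assoc, ← MvPolynomial.C_mul,
        mul_inv_cancel₀ h1, MvPolynomial.C_1, one_mul]
      rw [Finset.sum_range]
    rw [twConv, Finset.sum_range_succ, h2, Nat.sub_self]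
    have h3 : vVar p ℚ j 0 = (p : MvPolynomial (I × ℕ) ℚ) := rfl
    rw [h3]
    simp only [MvPolynomial.C_sub, MvPolynomial.C_pow, map_natCast]
    ring

/-- A logarithm is determined by its Araki generators. -/
theorem eq_of_twConv_eq_mul {X : Type} {m m' v : ℕ → MvPolynomial X ℚ} (h0 : m 0 = 1)
    (h0' : m' 0 = 1) (hv0 : v 0 = p) (h : ∀ n, twConv p m v n = p * m n)
    (h' : ∀ n, twConv p m' v n = p * m' n) (n : ℕ) : m n = m' n := by
  induction n using Nat.strong_induction_on with
  | _ n ih =>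
    rcases Nat.eq_zero_or_pos n with rfl | hn
    · rw [h0, h0']
    have h1 := h n
    have h2 := h' n
    rw [twConv, Finset.sum_range_succ, Nat.sub_self, hv0] at h1 h2
    have h3 : ∑ a ∈ Finset.range n, m a * v (n - a) ^ p ^ a =
        ∑ a ∈ Finset.range n, m' a * v (n - a) ^ p ^ a :=
      Finset.sum_congr rfl fun a ha => by rw [ih a (Finset.mem_range.mp ha)]
    have h4 : (MvPolynomial.C ((p : ℚ) - (p : ℚ) ^ p ^ n) : MvPolynomial X ℚ) * m n =
        MvPolynomial.C ((p : ℚ) - (p : ℚ) ^ p ^ n) * m' n := by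
      simp only [MvPolynomial.C_sub, MvPolynomial.C_pow, map_natCast]
      linear_combination h3 - h1 + h2
    refine mul_left_cancel₀ ?_ h4
    rw [Ne, MvPolynomial.C_eq_zero]
    exact p_sub_pow_ne_zero p hn.ne'

/-- At the root both logarithms have the same Araki generators, which determine them; along an edge
both arise by convolution with the same transition coefficients. -/
theorem treeToLog_treeLog (j : I) (n : ℕ) : treeToLog p O (treeLog p O j n) = logCoeff j n := by
  induction j using tree_induction O generalizing n with
  | h0 =>
    rw [treeLog_root]
    refine eq_of_twConv_eq_mul p (v := araki p O.root)
      (m := fun n => treeToLog p O (rootLog p O.root n)) ?_ rfl (araki_zero p _) ?_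
      (twConv_araki p _) n
    · rw [rootLog_zero, map_one]
    · intro n
      have := congrArg (treeToLog p O) (twConv_rootLog p O.root n)
      rw [map_twConv, map_mul, map_natCast] at this
      simpa only [treeToLog_vVar] using this
  | h1 j hj ih =>
    rw [treeLog_of_ne p O hj, map_twConv]
    simp only [ih, treeToLog_famVar p O hj]
    exact twConv_transition p _ _ n

theorem treeToLog_logToTree (x : MvPolynomial (I × ℕ) ℚ) :
    treeToLog p O (logToTree p O x) = x := by
  have : (treeToLog p O).comp (logToTree p O) = RingHom.id _ := by
    refine MvPolynomial.ringHom_ext (fun r => ?_) (fun x => ?_)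
    · simp [treeToLog, logToTree]
    · rw [RingHom.comp_apply, logToTree, MvPolynomial.eval₂Hom_X', treeToLog_treeLog]
      rfl
  exact RingHom.congr_fun this x

theorem logToTree_araki_root (n : ℕ) : logToTree p O (araki p O.root n) = vVar p ℚ O.root n := by
  refine twConv_left_cancel p (treeLog_zero p O O.root)
    (c := fun n => logToTree p O (araki p O.root n)) (fun n => ?_) n
  rw [twConv_logToTree_araki, treeLog_root, twConv_rootLog]

theorem logToTree_treeToLog (x : MvPolynomial (I × ℕ) ℚ) :
    logToTree p O (treeToLog p O x) = x := by
  have : (logToTree p O).comp (treeToLog p O) = RingHom.id _ := by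
    refine MvPolynomial.ringHom_ext (fun r => ?_) (fun x => ?_)
    · simp [treeToLog, logToTree]
    · obtain ⟨j, n⟩ := x
      rw [RingHom.comp_apply, treeToLog, MvPolynomial.eval₂Hom_X']
      split_ifs with h
      · have h' : j = O.root := h
        subst h'
        exact logToTree_araki_root p O (n + 1)
      · exact logToTree_transition_parent p O h (n + 1)
  exact RingHom.congr_fun this x

/-! ### Integrality -/

theorem pIncl_vVar (j : I) (n : ℕ) : pIncl p (I × ℕ) (vVar p _ j n) = vVar p ℚ j n := by
  cases n <;> simp [vVar, pIncl]

theorem pIncl_famVar (j : I) (n : ℕ) : pIncl p (I × ℕ) (famVar _ j n) = famVar ℚ j n := by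
  cases n <;> simp [famVar, pIncl]

theorem pIncl_C (q : pInt p) : pIncl p (I × ℕ) (MvPolynomial.C q) = MvPolynomial.C (q : ℚ) := by
  simp [pIncl]

theorem natCast_p_isLeftRegular {X : Type} : IsLeftRegular (p : MvPolynomial X ℚ) :=
  (IsRegular.of_ne_zero (Nat.cast_ne_zero.mpr (Fact.out : p.Prime).ne_zero)).left

/-- One `u` serves all families. It comes from the Araki relation at the root and is passed along
the edges, whose transition coefficients are variables and hence integral. -/
theorem exists_treeLog_functional_equation :
    ∃ u : ℕ → MvPolynomial (I × ℕ) ℚ, (∀ b, u b ∈ (pIncl p (I × ℕ)).range) ∧ u 0 = p ∧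
      ∀ j n, feDefect (MvPolynomial.expand p : MvPolynomial (I × ℕ) ℚ →ₐ[ℚ] _).toRingHom u
        (treeLog p O j) n ∈ pMul p (pIncl p (I × ℕ)).range := by
  have hreg := natCast_p_isLeftRegular p (X := I × ℕ)
  obtain ⟨u, hu, hu0, hD⟩ := exists_functional_equation (U := (pIncl p (I × ℕ)).range)
    (p := p) hreg (exists_frobenius_lift p) (m := rootLog p O.root) (v := vVar p ℚ O.root)
    (rootLog_zero p _) (fun n => ⟨_, pIncl_vVar p _ n⟩) rfl (twConv_rootLog p _)
    (fun n hn => by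
      have hp1 : 1 < p := (Fact.out : p.Prime).one_lt
      have hk : 0 < p ^ n - 1 := by
        have := Nat.one_lt_pow hn.ne' hp1
        omega
      have h2 : (1 - (p : ℚ) ^ (p ^ n - 1)) ≠ 0 := by
        rw [sub_ne_zero]
        have := Nat.one_lt_pow hk.ne' hp1
        exact_mod_cast this.ne
      refine ⟨_, ⟨MvPolynomial.C ⟨_, one_sub_pow_inv_mem_pInt p hk⟩, rfl⟩, ?_⟩
      rw [pIncl_C]
      have h3 : (1 - (p : MvPolynomial (I × ℕ) ℚ) ^ (p ^ n - 1)) =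
          MvPolynomial.C (1 - (p : ℚ) ^ (p ^ n - 1)) := by simp
      rw [h3, ← MvPolynomial.C_mul, mul_inv_cancel₀ h2, MvPolynomial.C_1])
  refine ⟨u, hu, hu0, fun j => ?_⟩
  induction j using tree_induction O with
  | h0 => rw [treeLog_root]; exact hD
  | h1 j hj ih =>
    rw [treeLog_of_ne p O hj]
    exact feDefect_twConv_mem hreg (exists_frobenius_lift p) hu hu0 ih
      (fun n => ⟨_, pIncl_famVar p j n⟩)

/-- Convolving the logarithm of `j` with these elements gives `p` times that logarithm, whose defect
is `p` times an integral one; the converse of the functional equation lemma applies. -/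
theorem logToTree_araki_mem (j : I) (n : ℕ) :
    logToTree p O (araki p j n) ∈ (pIncl p (I × ℕ)).range := by
  obtain ⟨u, hu, hu0, hD⟩ := exists_treeLog_functional_equation p O
  refine mem_of_feDefect_twConv (natCast_p_isLeftRegular p) (exists_frobenius_lift p) hu hu0 (hD j)
    (treeLog_zero p O j) (c := fun n => logToTree p O (araki p j n)) (fun n => ?_) n
  have h1 : twConv p (treeLog p O j) (fun n => logToTree p O (araki p j n)) =
      twConv p (treeLog p O j) (fun n => logToTree p O (araki p j n)) := rfl
  have h2 : feDefect (MvPolynomial.expand p : MvPolynomial (I × ℕ) ℚ →ₐ[ℚ] _).toRingHom u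
      (twConv p (treeLog p O j) (fun n => logToTree p O (araki p j n))) n =
      p * feDefect (MvPolynomial.expand p : MvPolynomial (I × ℕ) ℚ →ₐ[ℚ] _).toRingHom u
        (treeLog p O j) n := by
    rw [funext (twConv_logToTree_araki p O j), feDefect, feDefect, Finset.mul_sum]
    refine Finset.sum_congr rfl fun b _ => ?_
    rw [map_mul, map_natCast]
    ring
  rw [h2]
  exact mul_mem_pMul (natCast_mem _ p) (hD j n)

/-- The logarithms of `i` and `j` satisfy the same functional equation, so the transition between
them is integral even off the tree. -/
theorem logToTree_transition_mem (i j : I) (n : ℕ) :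
    logToTree p O (transition p i j n) ∈ (pIncl p (I × ℕ)).range := by
  obtain ⟨u, hu, hu0, hD⟩ := exists_treeLog_functional_equation p O
  refine mem_of_feDefect_twConv (natCast_p_isLeftRegular p) (exists_frobenius_lift p) hu hu0 (hD i)
    (treeLog_zero p O i) (c := fun n => logToTree p O (transition p i j n)) (fun n => ?_) n
  rw [funext (twConv_logToTree_transition p O i j)]
  exact hD j n

theorem logToTree_mem {x : MvPolynomial (I × ℕ) ℚ} (hx : x ∈ bp p I) :
    logToTree p O x ∈ (pIncl p (I × ℕ)).range := by
  have h : bp p I ≤ (pIncl p (I × ℕ)).range.comap (logToTree p O) := by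
    refine Subring.closure_le.mpr ?_
    rintro x ((⟨q, hq, rfl⟩ | ⟨i, n, rfl⟩) | ⟨i, j, n, rfl⟩)
    · refine ⟨MvPolynomial.C ⟨q, hq⟩, ?_⟩
      rw [pIncl_C]
      simp [logToTree]
    · exact logToTree_araki_mem p O i n
    · exact logToTree_transition_mem p O i j n
  exact h hx

theorem treeToLog_pIncl_mem (x : MvPolynomial (I × ℕ) (pInt p)) :
    treeToLog p O (pIncl p _ x) ∈ bp p I := by
  induction x using MvPolynomial.induction_on with
  | C q =>
    rw [pIncl_C]
    refine Subring.subset_closure (Or.inl (Or.inl ⟨q, q.2, ?_⟩))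
    simp [treeToLog]
  | add x y hx hy => rw [map_add, map_add]; exact add_mem hx hy
  | mul_X x i hx =>
    rw [map_mul, map_mul]
    refine mul_mem hx ?_
    obtain ⟨j, n⟩ := i
    have h1 : pIncl p (I × ℕ) (MvPolynomial.X (j, n)) = MvPolynomial.X (j, n) := by simp [pIncl]
    rw [h1]
    by_cases hj : j = O.root
    · subst hj
      have := treeToLog_vVar p O (n + 1)
      rw [vVar] at this
      rw [this]
      exact Subring.subset_closure (Or.inl (Or.inr ⟨_, _, rfl⟩))
    · have := treeToLog_famVar p O hj (n + 1)
      rw [famVar] at this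
      rw [this]
      exact Subring.subset_closure (Or.inr ⟨_, _, _, rfl⟩)

/-- `bp p I` is a polynomial ring over `ℤ_(p)` on the Araki generators at the root and the
transition coefficients along the edges of the tree. -/
def bpParam : MvPolynomial (I × ℕ) (pInt p) ≃+* bp p I :=
  RingEquiv.ofBijective (((treeToLog p O).comp (pIncl p _)).codRestrict (bp p I)
    (treeToLog_pIncl_mem p O)) (by
    -- Injectivity comes from the rational inverse `logToTree`; surjectivity is the integrality of
    -- all the generators of `bp p I`.
    constructor
    · intro x y h
      have h1 : treeToLog p O (pIncl p _ x) = treeToLog p O (pIncl p _ y) :=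
        congrArg Subtype.val h
      have h2 := congrArg (logToTree p O) h1
      rw [logToTree_treeToLog, logToTree_treeToLog] at h2
      exact pIncl_injective p _ h2
    · rintro ⟨x, hx⟩
      obtain ⟨y, hy⟩ := logToTree_mem p O hx
      refine ⟨y, Subtype.ext ?_⟩
      show treeToLog p O (pIncl p _ y) = x
      rw [hy, treeToLog_logToTree])

theorem coe_bpParam (x : MvPolynomial (I × ℕ) (pInt p)) :
    (bpParam p O x : MvPolynomial (I × ℕ) ℚ) = treeToLog p O (pIncl p _ x) := rfl

theorem pIncl_bpParam_symm (x : bp p I) :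
    pIncl p _ ((bpParam p O).symm x) = logToTree p O x := by
  obtain ⟨y, rfl⟩ := (bpParam p O).surjective x
  rw [RingEquiv.symm_apply_apply, coe_bpParam, logToTree_treeToLog]

theorem bpParam_vVar (n : ℕ) : bpParam p O (vVar p _ O.root n) = v p O.root n :=
  Subtype.ext (by rw [coe_bpParam, pIncl_vVar, treeToLog_vVar]; rfl)

theorem bpParam_famVar {j : I} (hj : j ≠ O.root) (n : ℕ) :
    bpParam p O (famVar _ j n) = t p (O.parent j) j n :=
  Subtype.ext (by rw [coe_bpParam, pIncl_famVar, treeToLog_famVar p O hj]; rfl)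

end Param

/-! ## Reduction modulo the ideal of the Araki generators -/

section Reduction

variable (p : ℕ) {I : Type} (O : RootedTree I)

open Classical in
/-- Multiplication of the variables at the root by `p`. -/
def scale (R : Type) [CommRing R] : MvPolynomial (I × ℕ) R →+* MvPolynomial (I × ℕ) R :=
  MvPolynomial.eval₂Hom MvPolynomial.C fun x =>
    if x.1 = O.root then (p : MvPolynomial (I × ℕ) R) * MvPolynomial.X x else MvPolynomial.X x

theorem scale_vVar_succ (R : Type) [CommRing R] (n : ℕ) :
    scale p O R (vVar p R O.root (n + 1)) = p * vVar p R O.root (n + 1) := by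
  rw [vVar, scale, MvPolynomial.eval₂Hom_X', if_pos rfl]

theorem scale_famVar (R : Type) [CommRing R] {j : I} (hj : j ≠ O.root) (n : ℕ) :
    scale p O R (famVar R j n) = famVar R j n := by
  cases n with
  | zero => rw [famVar, map_one]
  | succ n => rw [famVar, scale, MvPolynomial.eval₂Hom_X', if_neg hj]

theorem scale_monomial (R : Type) [CommRing R] (e : I × ℕ →₀ ℕ) :
    ∃ s : R, ∀ c, scale p O R (MvPolynomial.monomial e c) = MvPolynomial.monomial e (s * c) := by
  classical
  refine ⟨e.prod fun x k => (if x.1 = O.root then (p : R) else 1) ^ k, fun c => ?_⟩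
  rw [scale, MvPolynomial.coe_eval₂Hom, MvPolynomial.eval₂_monomial, MvPolynomial.monomial_eq,
    MvPolynomial.C_mul, mul_comm (MvPolynomial.C _) (MvPolynomial.C c), mul_assoc]
  congr 1
  have h : ∀ x : I × ℕ, (if x.1 = O.root then (p : MvPolynomial (I × ℕ) R) * MvPolynomial.X x
      else MvPolynomial.X x) = MvPolynomial.C (if x.1 = O.root then (p : R) else 1) *
        MvPolynomial.X x := by
    intro x
    split_ifs <;> simp
  simp only [h, mul_pow, Finsupp.prod_mul]
  congr 1
  rw [Finsupp.prod, Finsupp.prod, map_prod]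
  simp only [map_pow]

/-- The coefficients of a scaled polynomial. -/
theorem coeff_scale (R : Type) [CommRing R] (e : I × ℕ →₀ ℕ) :
    ∃ s : R, (∀ c, scale p O R (MvPolynomial.monomial e c) = MvPolynomial.monomial e (s * c)) ∧
      ∀ x, MvPolynomial.coeff e (scale p O R x) = s * MvPolynomial.coeff e x := by
  classical
  choose s hs using scale_monomial p O R
  refine ⟨s e, hs e, fun x => ?_⟩
  induction x using MvPolynomial.induction_on' with
  | monomial u a =>
    rw [hs, MvPolynomial.coeff_monomial, MvPolynomial.coeff_monomial]
    split_ifs with h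
    · rw [h]
    · rw [mul_zero]
  | add x y hx hy =>
    rw [map_add, MvPolynomial.coeff_add, MvPolynomial.coeff_add, hx, hy, mul_add]

variable [Fact p.Prime]

theorem pIncl_scale (x : MvPolynomial (I × ℕ) (pInt p)) :
    pIncl p _ (scale p O _ x) = scale p O ℚ (pIncl p _ x) := by
  classical
  have : (pIncl p _).comp (scale p O (pInt p)) = (scale p O ℚ).comp (pIncl p (I × ℕ)) := by
    refine MvPolynomial.ringHom_ext (fun r => ?_) (fun x => ?_)
    · simp [scale, pIncl]
    · simp only [RingHom.comp_apply, pIncl, MvPolynomial.map_X, scale, MvPolynomial.eval₂Hom_X']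
      split_ifs <;> simp
  exact RingHom.congr_fun this x

/-- Scaling makes the logarithms integral. At the root each summand of the recursion contains a
positive-index variable `v`, hence a factor `p`, which cancels the `p` in the denominator `p (1 -
p^{p^n - 1})`. Divisibility of a scaled element by powers of `p` then tests membership in powers of
the ideal generated by `p` and the root variables. -/
theorem scale_treeLog_mem (j : I) (n : ℕ) :
    scale p O ℚ (treeLog p O j n) ∈ (pIncl p (I × ℕ)).range := by
  induction j using tree_induction O generalizing n with
  | h0 =>
    rw [treeLog_root]
    induction n using Nat.strong_induction_on with
    | _ n ih =>
      rw [rootLog]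
      split_ifs with hn
      · rw [map_one]; exact one_mem _
      have hp1 : 1 < p := (Fact.out : p.Prime).one_lt
      have hk : 0 < p ^ n - 1 := by
        have := Nat.one_lt_pow hn hp1
        omega
      have h1 : ∀ a : Fin n, ∃ y ∈ (pIncl p (I × ℕ)).range,
          scale p O ℚ (rootLog p O.root a * vVar p ℚ O.root (n - a) ^ p ^ (a : ℕ)) = p * y := by
        intro a
        obtain ⟨k, hk⟩ : ∃ k, n - a = k + 1 := ⟨n - a - 1, by have := a.2; omega⟩
        have hpos : 0 < p ^ (a : ℕ) := Nat.pow_pos (by omega)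
        refine ⟨scale p O ℚ (rootLog p O.root a) * ((p : MvPolynomial (I × ℕ) ℚ) ^ (p ^ (a : ℕ) - 1) *
          vVar p ℚ O.root (k + 1) ^ p ^ (a : ℕ)), ?_, ?_⟩
        · have hv : vVar p ℚ O.root (k + 1) ∈ (pIncl p (I × ℕ)).range := ⟨_, pIncl_vVar p _ _⟩
          exact mul_mem (ih a a.2) (mul_mem (pow_mem (natCast_mem _ p) _) (pow_mem hv _))
        · rw [map_mul, map_pow, hk, scale_vVar_succ, mul_pow]
          conv_lhs => rw [show (p : MvPolynomial (I × ℕ) ℚ) ^ p ^ (a : ℕ) =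
            (p : MvPolynomial (I × ℕ) ℚ) * (p : MvPolynomial (I × ℕ) ℚ) ^ (p ^ (a : ℕ) - 1) by
              rw [← pow_succ', Nat.sub_add_cancel hpos]]
          ring
      choose y hy h using h1
      have h2 : scale p O ℚ (MvPolynomial.C ((p : ℚ) - (p : ℚ) ^ p ^ n)⁻¹) *
          (p : MvPolynomial (I × ℕ) ℚ) = MvPolynomial.C (1 - (p : ℚ) ^ (p ^ n - 1))⁻¹ := by
        have h3 : (p : ℚ) - (p : ℚ) ^ p ^ n = p * (1 - (p : ℚ) ^ (p ^ n - 1)) := by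
          have hpos : 0 < p ^ n := Nat.pow_pos (by omega)
          rw [mul_sub, ← pow_succ', Nat.sub_add_cancel hpos, mul_one]
        have h4 : (p : MvPolynomial (I × ℕ) ℚ) = MvPolynomial.C (p : ℚ) := by simp
        have hp0 : (p : ℚ) ≠ 0 := Nat.cast_ne_zero.mpr (by omega)
        rw [scale, MvPolynomial.coe_eval₂Hom, MvPolynomial.eval₂_C, h4, ← MvPolynomial.C_mul, h3,
          mul_inv, mul_comm, ← mul_assoc, mul_inv_cancel₀ hp0, one_mul]
      rw [map_mul, map_sum]
      simp only [h]
      rw [← Finset.mul_sum, ← mul_assoc, h2]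
      refine mul_mem ⟨MvPolynomial.C ⟨_, one_sub_pow_inv_mem_pInt p hk⟩, pIncl_C p _⟩
        (sum_mem fun a _ => hy a)
  | h1 j hj ih =>
    rw [treeLog_of_ne p O hj, map_twConv]
    refine sum_mem fun a _ => mul_mem (ih a) (pow_mem ?_ _)
    dsimp only
    rw [scale_famVar p O ℚ hj]
    exact ⟨_, pIncl_famVar p _ _⟩

/-- The Araki generators in terms of the polynomial generators. -/
def aP (j : I) (n : ℕ) : MvPolynomial (I × ℕ) (pInt p) := (bpParam p O).symm (v p j n)

/-- The transition coefficients in terms of the polynomial generators. -/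
def tP (i j : I) (n : ℕ) : MvPolynomial (I × ℕ) (pInt p) := (bpParam p O).symm (t p i j n)

theorem pIncl_aP (j : I) (n : ℕ) : pIncl p _ (aP p O j n) = logToTree p O (araki p j n) :=
  pIncl_bpParam_symm p O _

theorem pIncl_tP (i j : I) (n : ℕ) :
    pIncl p _ (tP p O i j n) = logToTree p O (transition p i j n) :=
  pIncl_bpParam_symm p O _

theorem tP_parent {j : I} (hj : j ≠ O.root) (n : ℕ) : tP p O (O.parent j) j n = famVar _ j n := by
  rw [tP, ← bpParam_famVar p O hj, RingEquiv.symm_apply_apply]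

/-- The defining relations of the `v_n` and `t_n` hold with integral logarithm coefficients, so they
can be reduced modulo `p` and `p ^ 2`. -/
theorem exists_scaled_log : ∃ N : I → ℕ → MvPolynomial (I × ℕ) (pInt p), (∀ j, N j 0 = 1) ∧
    (∀ j n, twConv p (N j) (fun n => scale p O _ (aP p O j n)) n = p * N j n) ∧
    ∀ i j n, twConv p (N i) (fun n => scale p O _ (tP p O i j n)) n = N j n := by
  choose N hN using fun j n => scale_treeLog_mem p O j n
  refine ⟨N, fun j => pIncl_injective p _ ?_, fun j n => pIncl_injective p _ ?_,
    fun i j n => pIncl_injective p _ ?_⟩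
  · rw [hN, treeLog_zero, map_one, map_one]
  · rw [map_twConv, map_mul, map_natCast]
    simp only [hN, pIncl_scale, pIncl_aP]
    rw [← map_twConv, twConv_logToTree_araki, map_mul, map_natCast]
  · rw [map_twConv]
    simp only [hN, pIncl_scale, pIncl_tP]
    rw [← map_twConv, twConv_logToTree_transition]

/-- Invariance of the ideal: every family's `v_n` lies in the one generated at the root. The scaled
Araki relation expresses it by multiples of `p` and powers of earlier `v`. -/
theorem p_dvd_scale_aP (j : I) (n : ℕ) :
    (p : MvPolynomial (I × ℕ) (pInt p)) ∣ scale p O _ (aP p O j n) := by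
  obtain ⟨N, hN0, hNa, -⟩ := exists_scaled_log p O
  induction n using Nat.strong_induction_on with
  | _ n ih =>
    have h := hNa j n
    rw [twConv_eq_add p _ _ (hN0 j)] at h
    have h1 : scale p O _ (aP p O j n) = _ := eq_sub_of_add_eq' h
    rw [h1]
    refine dvd_sub (dvd_mul_right _ _) (Finset.dvd_sum fun a ha => Dvd.dvd.mul_left ?_ _)
    have hpos : p ^ (a + 1) ≠ 0 := (Nat.pow_pos (Fact.out : p.Prime).pos).ne'
    exact dvd_pow (ih _ (by have := Finset.mem_range.mp ha; omega)) hpos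

/-- Modulo the square of the ideal of the Araki generators,
`v_n^{(j)} = ∑ v_k^{(i)} t_{n-k}^{p^k}`. -/
theorem sq_dvd_scale_aP_sub (i j : I) (n : ℕ) :
    (p : MvPolynomial (I × ℕ) (pInt p)) ^ 2 ∣
      scale p O _ (aP p O j n - twConv p (aP p O i) (tP p O i j) n) := by
  obtain ⟨N, hN0, hNa, hNt⟩ := exists_scaled_log p O
  -- In the scaled Araki relation all terms but `v_n` carry at least a `p`-th power of an element
  -- divisible by `p`, so `v_n ≡ p N_n` modulo `p ^ 2`. The claim is then `p` times the relation
  -- between the two logarithms.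
  have h1 : ∀ j n, (p : MvPolynomial (I × ℕ) (pInt p)) ^ 2 ∣
      p * N j n - scale p O _ (aP p O j n) := by
    intro j n
    rw [← hNa, twConv_eq_add p _ _ (hN0 j), add_sub_cancel_right]
    refine Finset.dvd_sum fun a _ => Dvd.dvd.mul_left ?_ _
    refine (pow_dvd_pow_of_dvd (p_dvd_scale_aP p O j _) 2).trans (pow_dvd_pow _ ?_)
    exact (Fact.out : p.Prime).two_le.trans (Nat.le_self_pow (Nat.succ_ne_zero a) p)
  have h2 : scale p O _ (aP p O j n - twConv p (aP p O i) (tP p O i j) n) =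
      (∑ a ∈ Finset.range (n + 1), (p * N i a - scale p O _ (aP p O i a)) *
        scale p O _ (tP p O i j (n - a)) ^ p ^ a) -
      (p * N j n - scale p O _ (aP p O j n)) := by
    simp only [sub_mul, Finset.sum_sub_distrib]
    rw [map_sub, map_twConv, ← hNt i j n, twConv, twConv, Finset.mul_sum]
    simp only [mul_assoc]
    ring
  rw [h2]
  exact dvd_sub (Finset.dvd_sum fun a _ => Dvd.dvd.mul_right (h1 i a) _) (h1 j n)

/-- Reduction modulo `p` and the variables in `S`. -/
def redKill {X : Type} (S : Set X) : MvPolynomial X (pInt p) →+* MvPolynomial X (ZMod p) :=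
  open Classical in
  MvPolynomial.eval₂Hom (MvPolynomial.C.comp (pRed p)) fun x =>
    if x ∈ S then 0 else MvPolynomial.X x

theorem ker_redKill {X : Type} (S : Set X) :
    RingHom.ker (redKill p S) =
      Ideal.span ({(p : MvPolynomial X (pInt p))} ∪ MvPolynomial.X '' S) := by
  classical
  let κ : MvPolynomial X (pInt p) →+* MvPolynomial X (pInt p) :=
    MvPolynomial.eval₂Hom MvPolynomial.C fun x => if x ∈ S then 0 else MvPolynomial.X x
  set J := Ideal.span ({(p : MvPolynomial X (pInt p))} ∪ MvPolynomial.X '' S) with hJ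
  have h1 : (Ideal.Quotient.mk J).comp κ = Ideal.Quotient.mk J := by
    refine MvPolynomial.ringHom_ext (fun r => ?_) (fun x => ?_)
    · simp [κ]
    · rw [RingHom.comp_apply]
      simp only [κ, MvPolynomial.eval₂Hom_X']
      split_ifs with hx
      · rw [map_zero, eq_comm, Ideal.Quotient.eq_zero_iff_mem]
        exact Ideal.subset_span (Or.inr ⟨x, hx, rfl⟩)
      · rfl
  have h2 : redKill p S = (MvPolynomial.map (pRed p)).comp κ := by
    refine MvPolynomial.ringHom_ext (fun r => ?_) (fun x => ?_)
    · simp [κ, redKill]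
    · simp only [κ, redKill, RingHom.comp_apply, MvPolynomial.eval₂Hom_X']
      split_ifs <;> simp
  refine le_antisymm (fun x hx => ?_) (Ideal.span_le.mpr ?_)
  · rw [RingHom.mem_ker, h2, RingHom.comp_apply, map_pRed_eq_zero_iff] at hx
    rw [← Ideal.Quotient.eq_zero_iff_mem, ← h1, RingHom.comp_apply,
      Ideal.Quotient.eq_zero_iff_mem]
    exact J.mem_of_dvd hx (Ideal.subset_span (Or.inl rfl))
  · rintro x (rfl | ⟨x, hx, rfl⟩)
    · show redKill p S p = 0
      simp
    · show redKill p S (MvPolynomial.X x) = 0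
      rw [redKill, MvPolynomial.eval₂Hom_X', if_pos hx]

end Reduction

/-! ### Regularity of the Araki generators and the quotient of `bp` by their ideal -/

section Regular

variable (p : ℕ) {I : Type} (O : RootedTree I) [Fact p.Prime]

/-- The variables at the root with index in `s`. -/
def rootVars (s : Set ℕ) : Set (I × ℕ) := (fun n => (O.root, n)) '' s

theorem vVar_image_eq (s : Set ℕ) :
    ({(p : MvPolynomial (I × ℕ) (pInt p))} ∪ MvPolynomial.X '' rootVars O s) =
      vVar p (pInt p) O.root '' ({0} ∪ Nat.succ '' s) := by
  rw [Set.image_union, Set.image_singleton, Set.image_image, rootVars, Set.image_image]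
  rfl

theorem ker_redKill_rootVars (s : Set ℕ) :
    RingHom.ker (redKill p (rootVars O s)) =
      Ideal.span (vVar p (pInt p) O.root '' ({0} ∪ Nat.succ '' s)) := by
  rw [ker_redKill, vVar_image_eq]

theorem Iio_succ_eq_image (n : ℕ) : (Set.Iio (n + 1) : Set ℕ) = {0} ∪ Nat.succ '' Set.Iio n := by
  ext i
  cases i <;> simp

theorem univ_eq_image : (Set.univ : Set ℕ) = {0} ∪ Nat.succ '' Set.univ := by
  ext i
  cases i <;> simp

/-- For positive `n` the quotient by the earlier elements embeds in a polynomial ring over `F_p`, a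
domain in which the next variable is nonzero; for `n = 0` this is cancellation of `p`. -/
theorem vVar_regular (n : ℕ) (x : MvPolynomial (I × ℕ) (pInt p))
    (h : vVar p (pInt p) O.root n * x ∈ Ideal.span (vVar p (pInt p) O.root '' Set.Iio n)) :
    x ∈ Ideal.span (vVar p (pInt p) O.root '' Set.Iio n) := by
  cases n with
  | zero =>
    have h0 : (Set.Iio 0 : Set ℕ) = ∅ := Set.Iio_bot
    rw [h0, Set.image_empty, Ideal.span_empty, Submodule.mem_bot] at h ⊢
    rw [vVar] at h
    exact pInt_isRegular p (by simpa using h)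
  | succ n =>
    rw [Iio_succ_eq_image, ← ker_redKill_rootVars, RingHom.mem_ker] at h ⊢
    rw [map_mul] at h
    refine (mul_eq_zero.mp h).resolve_left ?_
    have : (O.root, n) ∉ rootVars O (Set.Iio n) := by
      rintro ⟨i, hi, h⟩
      exact absurd (congrArg Prod.snd h) (ne_of_lt hi)
    rw [vVar, redKill, MvPolynomial.eval₂Hom_X', if_neg this]
    exact MvPolynomial.X_ne_zero _

theorem mem_span_v_iff (s : Set ℕ) (x : bp p I) :
    x ∈ Ideal.span (v p O.root '' s) ↔
      (bpParam p O).symm x ∈ Ideal.span (vVar p (pInt p) O.root '' s) := by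
  have h1 : v p O.root '' s = bpParam p O '' (vVar p (pInt p) O.root '' s) := by
    rw [Set.image_image]
    exact Set.image_congr fun n _ => (bpParam_vVar p O n).symm
  rw [h1, ← Ideal.map_span, Ideal.mem_map_of_equiv]
  constructor
  · rintro ⟨y, hy, rfl⟩
    rwa [RingEquiv.symm_apply_apply]
  · intro h
    exact ⟨_, h, RingEquiv.apply_symm_apply _ _⟩

/-- The Araki generators of one family form a regular sequence. -/
theorem v_regular (n : ℕ) (x : bp p I)
    (h : v p O.root n * x ∈ Ideal.span (v p O.root '' Set.Iio n)) :
    x ∈ Ideal.span (v p O.root '' Set.Iio n) := by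
  rw [mem_span_v_iff] at h ⊢
  rw [map_mul, ← bpParam_vVar, RingEquiv.symm_apply_apply] at h
  exact vVar_regular p O n _ h

/-- Reduction of `bp` modulo the Araki generators. -/
def redV : bp p I →+* XiRing p I :=
  (redKill p (rootVars O Set.univ)).comp (bpParam p O).symm.toRingHom

theorem redV_apply (x : bp p I) :
    redV p O x = redKill p (rootVars O Set.univ) ((bpParam p O).symm x) := rfl

theorem ker_redV : RingHom.ker (redV p O) = Ideal.span (Set.range (v p O.root)) := by
  ext x
  rw [RingHom.mem_ker, redV_apply, ← RingHom.mem_ker, ker_redKill_rootVars, ← univ_eq_image,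
    ← mem_span_v_iff, Set.image_univ]

/-- The scaled variables die on both sides, so relations proved after scaling can be read off in the
quotient. -/
theorem redKill_eq_comp_scale (x : MvPolynomial (I × ℕ) (pInt p)) :
    redKill p (rootVars O Set.univ) x =
      redKill p (rootVars O Set.univ) (scale p O _ x) := by
  classical
  have : redKill p (rootVars O Set.univ) =
      (redKill p (rootVars O Set.univ)).comp (scale p O _) := by
    refine MvPolynomial.ringHom_ext (fun r => ?_) (fun x => ?_)
    · simp [redKill, scale]
    · rw [RingHom.comp_apply, scale, MvPolynomial.eval₂Hom_X']
      split_ifs with hx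
      · have hx' : x ∈ rootVars O Set.univ := ⟨x.2, trivial, Prod.ext hx.symm rfl⟩
        rw [map_mul, redKill, MvPolynomial.eval₂Hom_X', if_pos hx', mul_zero]
      · rfl
  exact RingHom.congr_fun this x

theorem redKill_eq_zero_of_dvd {x : MvPolynomial (I × ℕ) (pInt p)} (S : Set (I × ℕ))
    (h : (p : MvPolynomial (I × ℕ) (pInt p)) ∣ x) : redKill p S x = 0 := by
  obtain ⟨y, rfl⟩ := h
  simp

theorem redV_v (j : I) (n : ℕ) : redV p O (v p j n) = 0 := by
  rw [redV_apply, redKill_eq_comp_scale]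
  exact redKill_eq_zero_of_dvd p _ (p_dvd_scale_aP p O j n)

theorem t_self (i : I) (n : ℕ) : t p i i n = if n = 0 then 1 else 0 := by
  have h : ∀ n, transition p i i n = if n = 0 then 1 else 0 := by
    refine twConv_left_cancel p (M := logCoeff i) rfl fun n => ?_
    rw [twConv_transition, twConv_delta]
  refine Subtype.ext ((h n).trans ?_)
  split_ifs <;> rfl

/-- Modulo the Araki generators the transition coefficients compose like
`t_n^{(il)} = ∑ t_a^{(ij)} (t_{n-a}^{(jl)})^{p^a}`. -/
theorem redV_t (i j l : I) (n : ℕ) :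
    redV p O (t p i l n) =
      twConv p (fun n => redV p O (t p i j n)) (fun n => redV p O (t p j l n)) n := by
  obtain ⟨N, hN0, -, hNt⟩ := exists_scaled_log p O
  have h1 : ∀ i j n, redV p O (t p i j n) =
      redKill p (rootVars O Set.univ) (scale p O _ (tP p O i j n)) := fun i j n => by
    rw [redV_apply, redKill_eq_comp_scale]; rfl
  -- The reduced scaled logarithms satisfy `M_i * t^{(ij)} = M_j`. Associativity in characteristic
  -- `p` and left cancellation of `M_i` give the composition law.
  let M : I → ℕ → XiRing p I := fun i n => redKill p (rootVars O Set.univ) (N i n)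
  have h2 : ∀ i j, twConv p (M i) (fun n => redV p O (t p i j n)) = M j := by
    intro i j
    funext n
    simp only [h1, M, ← hNt i j n]
    rw [map_twConv]
  refine twConv_left_cancel p (M := M i) (by simp only [M, hN0, map_one])
    (c := fun n => redV p O (t p i l n)) (fun n => ?_) n
  rw [h2]
  have h3 := twConv_assoc p (M i) (fun n => redV p O (t p i j n)) (fun n => redV p O (t p j l n)) n
  rw [h2, h2] at h3
  exact h3

theorem redV_t_parent {j : I} (hj : j ≠ O.root) (n : ℕ) :
    redV p O (t p (O.parent j) j n) = xi p j n := by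
  classical
  rw [redV_apply]
  have := tP_parent p O hj n
  rw [tP] at this
  rw [this]
  cases n with
  | zero => rw [famVar, map_one, xi]
  | succ n =>
    rw [famVar, redKill, MvPolynomial.eval₂Hom_X', if_neg, xi]
    rintro ⟨i, -, h⟩
    exact hj (congrArg Prod.fst h).symm

theorem bpParam_C (q : pInt p) :
    (bpParam p O (MvPolynomial.C q) : MvPolynomial (I × ℕ) ℚ) = MvPolynomial.C (q : ℚ) := by
  rw [coe_bpParam, pIncl_C]
  simp [treeToLog]

theorem redV_C {c : bp p I} {q : ℚ} (hq : ¬ p ∣ q.den)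
    (h : MvPolynomial.C q = (c : MvPolynomial (I × ℕ) ℚ)) :
    redV p O c = MvPolynomial.C (pRed p ⟨q, hq⟩) := by
  have : c = bpParam p O (MvPolynomial.C ⟨q, hq⟩) := Subtype.ext (by rw [bpParam_C, ← h])
  rw [redV_apply, this, RingEquiv.symm_apply_apply]
  simp [redKill]

end Regular

/-! ### Homogeneity -/

section Homogeneous

open MvPolynomial

variable (p : ℕ) {I : Type} (O : RootedTree I)

/-- The degree of `v_n` and `t_n`. -/
def vDeg (n : ℕ) : ℕ := 2 * (p ^ n - 1)

/-- The degrees of the variables. -/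
def varDeg (x : I × ℕ) : ℕ := vDeg p (x.2 + 1)

/-- This identity is what makes twisted convolutions homogeneous. -/
theorem vDeg_add (hp : 0 < p) {a n : ℕ} (h : a ≤ n) :
    vDeg p a + p ^ a * vDeg p (n - a) = vDeg p n := by
  obtain ⟨b, rfl⟩ := Nat.exists_eq_add_of_le h
  rw [Nat.add_sub_cancel_left, vDeg, vDeg, vDeg]
  obtain ⟨x, hx⟩ := Nat.exists_eq_add_of_le' (Nat.pow_pos (n := a) hp)
  obtain ⟨y, hy⟩ := Nat.exists_eq_add_of_le' (Nat.pow_pos (n := b) hp)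
  have h1 : p ^ (a + b) = (x * y + x + y) + 1 := by rw [pow_add, hx, hy]; ring
  rw [hx, hy, h1]
  simp only [Nat.add_sub_cancel]
  ring

variable {p} in
theorem isWeightedHomogeneous_twConv {R X : Type} [CommRing R] {w : X → ℕ} (hp : 0 < p)
    {M c : ℕ → MvPolynomial X R} {n : ℕ} (hM : ∀ a ≤ n, IsWeightedHomogeneous w (M a) (vDeg p a))
    (hc : ∀ a ≤ n, IsWeightedHomogeneous w (c a) (vDeg p a)) :
    IsWeightedHomogeneous w (twConv p M c n) (vDeg p n) := by
  refine IsWeightedHomogeneous.sum _ _ _ fun a ha => ?_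
  have han : a ≤ n := Nat.lt_succ_iff.mp (Finset.mem_range.mp ha)
  rw [← vDeg_add p hp han]
  exact (hM a han).mul ((hc (n - a) (Nat.sub_le _ _)).pow _)

variable {p} in
theorem isWeightedHomogeneous_of_twConv {R X : Type} [CommRing R] {w : X → ℕ} (hp : 0 < p)
    {M c W : ℕ → MvPolynomial X R} (hM0 : M 0 = 1)
    (hM : ∀ a, IsWeightedHomogeneous w (M a) (vDeg p a)) (h : ∀ n, twConv p M c n = W n)
    (hW : ∀ n, IsWeightedHomogeneous w (W n) (vDeg p n)) (n : ℕ) :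
    IsWeightedHomogeneous w (c n) (vDeg p n) := by
  induction n using Nat.strong_induction_on with
  | _ n ih =>
    have h1 := h n
    rw [twConv_eq_add p _ _ hM0] at h1
    rw [eq_sub_of_add_eq' h1, ← mem_weightedHomogeneousSubmodule]
    refine sub_mem (hW n) (sum_mem fun a ha => ?_)
    have han : a + 1 ≤ n := Finset.mem_range.mp ha
    rw [mem_weightedHomogeneousSubmodule, ← vDeg_add p hp han]
    exact (hM (a + 1)).mul ((ih (n - (a + 1)) (by omega)).pow _)

theorem isWeightedHomogeneous_vVar (R : Type) [CommRing R] (j : I) (n : ℕ) :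
    IsWeightedHomogeneous (varDeg p) (vVar p R j n) (vDeg p n) := by
  cases n with
  | zero =>
    have h : (p : MvPolynomial (I × ℕ) R) = C (p : R) := by simp
    rw [vVar, h]
    simpa [vDeg] using isWeightedHomogeneous_C (varDeg p) (p : R)
  | succ n => exact isWeightedHomogeneous_X R (varDeg p) (j, n)

theorem isWeightedHomogeneous_famVar (R : Type) [CommRing R] (j : I) (n : ℕ) :
    IsWeightedHomogeneous (varDeg p) (famVar R j n) (vDeg p n) := by
  cases n with
  | zero => simpa [vDeg, famVar] using isWeightedHomogeneous_one R (varDeg p (I := I))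
  | succ n => exact isWeightedHomogeneous_X R (varDeg p) (j, n)

theorem scale_monomial_of_eq_zero (R : Type) [CommRing R] {e : I × ℕ →₀ ℕ}
    (he : ∀ n, e (O.root, n) = 0) (c : R) : scale p O R (monomial e c) = monomial e c := by
  rw [scale, coe_eval₂Hom, eval₂_monomial, monomial_eq]
  congr 1
  refine Finsupp.prod_congr fun x hx => ?_
  rw [if_neg]
  intro h
  refine Finsupp.mem_support_iff.mp hx ?_
  show e (x.1, x.2) = 0
  rw [h, he]

variable [Fact p.Prime]

theorem isWeightedHomogeneous_treeLog (j : I) (n : ℕ) :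
    IsWeightedHomogeneous (varDeg p) (treeLog p O j n) (vDeg p n) := by
  have hp : 0 < p := (Fact.out : p.Prime).pos
  induction j using tree_induction O generalizing n with
  | h0 =>
    rw [treeLog_root]
    induction n using Nat.strong_induction_on with
    | _ n ih =>
      rw [rootLog]
      split_ifs with hn
      · simpa [hn, vDeg] using isWeightedHomogeneous_one ℚ (varDeg p (I := I))
      · rw [← zero_add (vDeg p n)]
        refine (isWeightedHomogeneous_C _ _).mul (IsWeightedHomogeneous.sum _ _ _ fun a _ => ?_)
        rw [← vDeg_add p hp a.2.le]
        exact (ih a a.2).mul ((isWeightedHomogeneous_vVar p ℚ _ _).pow _)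
  | h1 j hj ih =>
    rw [treeLog_of_ne p O hj]
    exact isWeightedHomogeneous_twConv hp (fun a _ => ih a)
      (fun a _ => isWeightedHomogeneous_famVar p ℚ j a)

theorem isWeightedHomogeneous_of_pIncl {X : Type} {w : X → ℕ} {x : MvPolynomial X (pInt p)} {n : ℕ}
    (h : IsWeightedHomogeneous w (pIncl p X x) n) : IsWeightedHomogeneous w x n := by
  intro d hd
  refine h (d := d) ?_
  rw [pIncl, coeff_map]
  exact fun h0 => hd (Subtype.ext h0)

theorem isWeightedHomogeneous_aP (j : I) (n : ℕ) :
    IsWeightedHomogeneous (varDeg p) (aP p O j n) (vDeg p n) := by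
  refine isWeightedHomogeneous_of_pIncl p ?_
  rw [pIncl_aP]
  refine isWeightedHomogeneous_of_twConv (Fact.out : p.Prime).pos (treeLog_zero p O j)
    (isWeightedHomogeneous_treeLog p O j) (twConv_logToTree_araki p O j) (fun n => ?_) n
  have h : (p : MvPolynomial (I × ℕ) ℚ) = C (p : ℚ) := by simp
  rw [h, ← zero_add (vDeg p n)]
  exact (isWeightedHomogeneous_C _ _).mul (isWeightedHomogeneous_treeLog p O j n)

theorem isWeightedHomogeneous_tP (i j : I) (n : ℕ) :
    IsWeightedHomogeneous (varDeg p) (tP p O i j n) (vDeg p n) := by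
  refine isWeightedHomogeneous_of_pIncl p ?_
  rw [pIncl_tP]
  exact isWeightedHomogeneous_of_twConv (Fact.out : p.Prime).pos (treeLog_zero p O i)
    (isWeightedHomogeneous_treeLog p O i) (twConv_logToTree_transition p O i j)
    (isWeightedHomogeneous_treeLog p O j) n

/-- A monomial in the square of the ideal either contains a root variable, which is split off, or
has a coefficient divisible by `p ^ 2`, in which case one `p = v_0` is split off. The remaining
factor still lies in the ideal. -/
theorem exists_monomial_combination {e : I × ℕ →₀ ℕ} {c : pInt p}
    (h2 : (p : MvPolynomial (I × ℕ) (pInt p)) ^ 2 ∣ scale p O _ (monomial e c)) :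
    ∃ (k : ℕ) (a : MvPolynomial (I × ℕ) (pInt p)), monomial e c = a * vVar p _ O.root k ∧
      redKill p (rootVars O Set.univ) a = 0 ∧
      ∀ e', coeff e' a ≠ 0 →
        Finsupp.weight (varDeg p) e' + vDeg p k = Finsupp.weight (varDeg p) e := by
  classical
  by_cases he : ∃ n, e (O.root, n) ≠ 0
  · obtain ⟨n, hn⟩ := he
    obtain ⟨e', rfl⟩ : ∃ e', e = e' + Finsupp.single (O.root, n) 1 :=
      ⟨e - Finsupp.single (O.root, n) 1,
        (tsub_add_cancel_of_le (Finsupp.single_le_iff.mpr (Nat.one_le_iff_ne_zero.mpr hn))).symm⟩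
    have h1 : monomial (e' + Finsupp.single (O.root, n) 1) c =
        monomial e' c * vVar p (pInt p) O.root (n + 1) := by
      rw [vVar, X, monomial_mul, mul_one]
    refine ⟨n + 1, monomial e' c, h1, ?_, ?_⟩
    · rw [redKill_eq_comp_scale]
      refine redKill_eq_zero_of_dvd p _ ?_
      rw [h1, map_mul, scale_vVar_succ] at h2
      obtain ⟨y, hy⟩ := h2
      have h3 : scale p O _ (monomial e' c) * vVar p (pInt p) O.root (n + 1) = p * y := by
        refine pInt_isRegular p ?_
        show (p : MvPolynomial (I × ℕ) (pInt p)) * _ = p * _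
        linear_combination hy
      -- Modulo `p` the split-off variable is a nonzero element of a domain, so the second factor
      -- `p` divides the scaled cofactor.
      have h4 := congrArg (map (pRed p)) h3
      rw [map_mul, map_mul, map_natCast, CharP.cast_eq_zero, zero_mul, mul_eq_zero, vVar,
        map_X] at h4
      exact (map_pRed_eq_zero_iff p _).mp (h4.resolve_right (X_ne_zero _))
    · intro e1 h
      rw [coeff_monomial] at h
      have : e' = e1 := by
        by_contra h0
        exact h (if_neg h0)
      rw [← this, map_add, Finsupp.weight_single]
      simp [varDeg]
  · push Not at he
    rw [scale_monomial_of_eq_zero p O _ he] at h2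
    have h3 : (p : MvPolynomial (I × ℕ) (pInt p)) ^ 2 = C ((p : pInt p) ^ 2) := by simp
    rw [h3, C_dvd_iff_dvd_coeff] at h2
    obtain ⟨c', hc'⟩ := h2 e
    rw [coeff_monomial, if_pos rfl] at hc'
    refine ⟨0, monomial e (p * c'), ?_, ?_, ?_⟩
    · have h4 : (p : MvPolynomial (I × ℕ) (pInt p)) = C (p : pInt p) := by simp
      rw [vVar, h4, mul_comm, C_mul_monomial, hc']
      congr 1
      ring
    · refine redKill_eq_zero_of_dvd p _ ⟨monomial e c', ?_⟩
      have h4 : (p : MvPolynomial (I × ℕ) (pInt p)) = C (p : pInt p) := by simp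
      rw [h4, C_mul_monomial]
    · intro e1 h
      rw [coeff_monomial] at h
      have : e = e1 := by
        by_contra h0
        exact h (if_neg h0)
      rw [← this]
      simp [vDeg]

/-- A homogeneous element of the square of the ideal of the Araki generators is a combination of
them with homogeneous coefficients in the ideal. -/
theorem exists_homogeneous_combination {x : MvPolynomial (I × ℕ) (pInt p)} {D : ℕ}
    (hx : IsWeightedHomogeneous (varDeg p) x D)
    (h2 : (p : MvPolynomial (I × ℕ) (pInt p)) ^ 2 ∣ scale p O _ x) :
    ∃ d : ℕ →₀ MvPolynomial (I × ℕ) (pInt p),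
      x = d.sum (fun k a => a * vVar p _ O.root k) ∧
      (∀ k, redKill p (rootVars O Set.univ) (d k) = 0) ∧
      ∀ k e, coeff e (d k) ≠ 0 → Finsupp.weight (varDeg p) e + vDeg p k = D := by
  classical
  have key : ∀ e ∈ x.support, ∃ (k : ℕ) (a : MvPolynomial (I × ℕ) (pInt p)),
      monomial e (coeff e x) = a * vVar p _ O.root k ∧
      redKill p (rootVars O Set.univ) a = 0 ∧
      ∀ e', coeff e' a ≠ 0 → Finsupp.weight (varDeg p) e' + vDeg p k = D := by
    intro e he
    -- Scaling multiplies each monomial by a constant, so divisibility by `p ^ 2` passes to each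
    -- monomial of `x` separately.
    obtain ⟨s, hs, hs'⟩ := coeff_scale p O (pInt p) e
    have h3 : (p : MvPolynomial (I × ℕ) (pInt p)) ^ 2 = C ((p : pInt p) ^ 2) := by simp
    rw [← hx (mem_support_iff.mp he)]
    refine exists_monomial_combination p O ?_
    rw [h3, C_dvd_iff_dvd_coeff] at h2 ⊢
    have h4 := h2 e
    rw [hs'] at h4
    intro e1
    rw [hs, coeff_monomial]
    split_ifs
    · exact h4
    · exact dvd_zero _
  choose! k a h1 h3 h4 using key
  refine ⟨∑ e ∈ x.support, Finsupp.single (k e) (a e), ?_, ?_, ?_⟩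
  · rw [← Finsupp.sum_finsetSum_index (by simp) (by intros; rw [add_mul])]
    conv_lhs => rw [← support_sum_monomial_coeff x]
    refine Finset.sum_congr rfl fun e he => ?_
    rw [h1 e he, Finsupp.sum_single_index (zero_mul _)]
  · intro j
    rw [Finsupp.finsetSum_apply, map_sum]
    refine Finset.sum_eq_zero fun e he => ?_
    rw [Finsupp.single_apply]
    split_ifs
    · exact h3 e he
    · exact map_zero _
  · intro j e' h
    rw [Finsupp.finsetSum_apply, coeff_sum] at h
    obtain ⟨e, he, h⟩ := Finset.exists_ne_zero_of_sum_ne_zero h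
    rw [Finsupp.single_apply] at h
    split_ifs at h with hj
    · rw [← hj]
      exact h4 e he e' h
    · exact absurd (coeff_zero _) h

end Homogeneous

/-! ## The tensor squares -/

section LeftBases

open MvPolynomial

theorem bijective_eval₂Hom_rename {A V Y W : Type} [CommRing A] (h : V → W) (g : Y → W)
    (hb : Function.Bijective (Sum.elim h g)) :
    Function.Bijective (eval₂Hom (rename (R := A) g).toRingHom (fun x => X (h x)) :
      MvPolynomial V (MvPolynomial Y A) →+* MvPolynomial W A) := by
  have : (eval₂Hom (rename (R := A) g).toRingHom (fun x => X (h x)) :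
      MvPolynomial V (MvPolynomial Y A) →+* MvPolynomial W A) =
      ((renameEquiv A (Equiv.ofBijective _ hb)).toRingEquiv.toRingHom.comp
        (sumRingEquiv A V Y).symm.toRingHom) := by
    refine ringHom_ext (fun r => ?_) (fun x => ?_)
    · induction r using MvPolynomial.induction_on with
      | C a => simp
      | add a b ha hb => simp only [map_add, ha, hb]
      | mul_X a i ha =>
        rw [C_mul, map_mul, map_mul, ha]
        congr 1
        simp
    · simp
  rw [this]
  exact ((renameEquiv A (Equiv.ofBijective _ hb)).toRingEquiv.bijective.comp
        (sumRingEquiv A V Y).symm.bijective)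

theorem isLeftBasis_of_bijective_eval₂Hom {R S X : Type} [CommRing R] [CommRing S] {f : R →+* S}
    {y : X → S} (h : Function.Bijective (eval₂Hom f y)) :
    IsLeftBasis f (fun β : X →₀ ℕ => β.prod fun n k => y n ^ k) := by
  have : (fun x : (X →₀ ℕ) →₀ R => x.sum fun β a => f a * β.prod fun n k => y n ^ k) =
      fun x => eval₂Hom f y ((basisMonomials X R).repr.symm x) := by
    funext x
    rw [Module.Basis.repr_symm_apply, Finsupp.linearCombination_apply, map_finsuppSum]
    refine Finsupp.sum_congr fun β _ => ?_
    rw [coe_basisMonomials, smul_monomial, smul_eq_mul, mul_one, coe_eval₂Hom, eval₂_monomial]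
  unfold IsLeftBasis
  rw [this]
  exact h.comp (basisMonomials X R).repr.symm.bijective

theorem bijective_sum_elim_last (k : ℕ) : Function.Bijective
    (Sum.elim (fun n : ℕ => (Fin.last k, n)) (Prod.map (Fin.castSucc (n := k)) (id : ℕ → ℕ))) := by
  constructor
  · rintro (a | ⟨a, m⟩) (b | ⟨b, n⟩) h
    · simpa using h
    · exact absurd (congrArg Prod.fst h).symm (Fin.castSucc_lt_last b).ne
    · exact absurd (congrArg Prod.fst h) (Fin.castSucc_lt_last a).ne
    · simpa using h
  · rintro ⟨i, n⟩
    induction i using Fin.lastCases with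
    | last => exact ⟨Sum.inl n, rfl⟩
    | cast i => exact ⟨Sum.inr (i, n), rfl⟩

theorem bijective_sum_elim_last' (k : ℕ) : Function.Bijective
    (Sum.elim (Prod.map (Fin.castSucc (n := k)) (id : ℕ → ℕ)) (fun n : ℕ => (Fin.last k, n))) := by
  have := (bijective_sum_elim_last k).comp (Equiv.sumComm _ _).bijective
  convert this using 1
  funext x
  cases x <;> rfl

variable (p : ℕ)

/-- The tree `0 ← 1 ← ⋯ ← k`. -/
def upTree (k : ℕ) : RootedTree (Fin (k + 1)) where
  root := 0
  parent j := ⟨j - 1, by omega⟩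
  rank j := j
  rank_lt j hj := by
    have : (j : ℕ) ≠ 0 := fun h => hj (Fin.ext h)
    show (j : ℕ) - 1 < j
    omega

theorem bpMap_t {I J : Type} (f : I → J) (i j : I) (n : ℕ) :
    bpMap p f (t p i j n) = t p (f i) (f j) n :=
  Subtype.ext (rename_transition p f i j n)

theorem ebpMap_algebraMap {I J : Type} (f : I → J) (r : bp p I) :
    ebpMap p f (algebraMap _ _ r) = algebraMap _ _ (bpMap p f r) := extMap_algebraMap _ _ _

theorem ebpMap_gen {I J : Type} (f : I → J) (x : I × ℕ) :
    ebpMap p f (gen _ x) = gen _ (f x.1, x.2) := by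
  rw [ebpMap, extMap_gen]; rfl

theorem milnorMap_algebraMap {I J : Type} (f : I → J) (r : XiRing p I) :
    milnorMap p f (algebraMap _ _ r) = algebraMap _ _ (rename (Prod.map f id) r) :=
  extMap_algebraMap _ _ _

theorem milnorMap_gen {I J : Type} (f : I → J) (x : I × ℕ) :
    milnorMap p f (gen _ x) = gen _ (f x.1, x.2) := by
  rw [milnorMap, extMap_gen]; rfl

/-- The substitution fixes every `μ_k` and alters the other family only by combinations of the
`μ_k`, so it is a shear of square zero. -/
theorem muTau_bijective : Function.Bijective (muTau p) := by
  let e : Fin 2 × ℕ → (Fin 2 × ℕ →₀ bp p (Fin 2)) := fun x => if x.1 = 0 then 0 else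
    - ∑ k ∈ Finset.range (x.2 + 1), Finsupp.single (0, k) (t p 0 1 (x.2 - k) ^ p ^ k)
  have h : (fun x : Fin 2 × ℕ => if x.1 = 0 then Finsupp.single (0, x.2) 1 else tau p x.2) =
      fun x => Finsupp.single x 1 + e x := by
    funext ⟨i, n⟩
    fin_cases i
    · simp [e]
    · simp [e, tau, sub_eq_add_neg]
  rw [muTau, h]
  refine extMap_shear_bijective e ?_
  rintro ⟨i, n⟩
  fin_cases i
  · simp [e]
  · show (- ∑ k ∈ Finset.range (n + 1), Finsupp.single ((0 : Fin 2), k) (t p 0 1 (n - k) ^ p ^ k)).sum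
      (fun y r => r • e y) = 0
    rw [← Finset.sum_neg_distrib, ← Finsupp.sum_finsetSum_index (by simp)
      (by intros; rw [add_smul])]
    refine Finset.sum_eq_zero fun k _ => ?_
    rw [← Finsupp.single_neg, Finsupp.sum_single_index (by simp)]
    simp [e]

/-- The unit of the Milnor algebra. -/
def milnorC (I : Type) : ZMod p →+* Milnor p I := (algebraMap (XiRing p I) (Milnor p I)).comp C

theorem milnorC_bijective : Function.Bijective (milnorC p (Fin 0)) := by
  constructor
  · exact (ExteriorAlgebra.algebraMap_leftInverse _).injective.comp (C_injective _ _)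
  · intro z
    induction z using ext_induction with
    | h0 r => exact ⟨coeff 0 r, congrArg (algebraMap (XiRing p (Fin 0)) (Milnor p (Fin 0))) (eq_C_of_isEmpty r).symm⟩
    | hadd a b ha hb =>
      obtain ⟨a, rfl⟩ := ha
      obtain ⟨b, rfl⟩ := hb
      exact ⟨a + b, map_add _ _ _⟩
    | hmul m a ha =>
      have : m = 0 := by ext x; exact x.1.elim0
      exact ⟨0, by rw [this, map_zero, map_zero, zero_mul]⟩

variable [Fact p.Prime]

theorem bpMap_bpParam_C {I J : Type} (O : RootedTree I) (O' : RootedTree J) (f : I → J)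
    (q : pInt p) : bpMap p f (bpParam p O (C q)) = bpParam p O' (C q) := by
  refine Subtype.ext ?_
  rw [bpParam_C]
  show rename _ (bpParam p O (C q) : MvPolynomial (I × ℕ) ℚ) = _
  rw [bpParam_C, rename_C]

/-- The up-tree is used because it keeps its root and edges when a last vertex is added; the
inclusion is then a mere renaming of polynomial generators. -/
theorem bpMap_bpParam_castSucc (k : ℕ) (x : MvPolynomial (Fin (k + 1) × ℕ) (pInt p)) :
    bpMap p Fin.castSucc (bpParam p (upTree k) x) =
      bpParam p (upTree (k + 1)) (rename (Prod.map Fin.castSucc id) x) := by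
  induction x using MvPolynomial.induction_on with
  | C a => rw [rename_C, bpMap_bpParam_C p _ (upTree (k + 1))]
  | add a b ha hb => simp only [map_add, ha, hb]
  | mul_X a i ha =>
    rw [map_mul, map_mul, map_mul, map_mul, ha]
    congr 1
    obtain ⟨j, n⟩ := i
    rw [rename_X]
    by_cases hj : j = (upTree k).root
    · subst hj
      have h1 := bpParam_vVar p (upTree k) (n + 1)
      have h2 := bpParam_vVar p (upTree (k + 1)) (n + 1)
      rw [vVar] at h1 h2
      rw [h1, bpMap_v]
      exact h2.symm
    · have hj' : Fin.castSucc j ≠ (upTree (k + 1)).root := fun h => hj (Fin.ext (by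
        have : (j.castSucc).val = 0 := congrArg Fin.val h
        exact this))
      have h1 := bpParam_famVar p (upTree k) hj (n + 1)
      have h2 := bpParam_famVar p (upTree (k + 1)) hj' (n + 1)
      rw [famVar] at h1 h2
      rw [h1, bpMap_t]
      exact h2.symm

/-- Adjoining one factor adjoins freely the transition coefficients of the new edge. For `k = 0`
this is `BP_*BP = BP_*[t_1, …]`; for `k = 1` it gives half of the tensor square. -/
theorem bijective_bp_last (k : ℕ) : Function.Bijective
    (eval₂Hom (bpMap p (Fin.castSucc (n := k + 1)))
      fun n : ℕ => t p (Fin.castSucc (Fin.last k)) (Fin.last (k + 1)) (n + 1)) := by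
  have h1 : (eval₂Hom (bpMap p (Fin.castSucc (n := k + 1)))
      fun n : ℕ => t p (Fin.castSucc (Fin.last k)) (Fin.last (k + 1)) (n + 1)) ∘
        (mapEquiv ℕ (bpParam p (upTree k))) =
      (bpParam p (upTree (k + 1))) ∘ (eval₂Hom
        (rename (R := pInt p) (Prod.map (Fin.castSucc (n := k + 1)) (id : ℕ → ℕ))).toRingHom
          (fun n : ℕ => X (Fin.last (k + 1), n))) := by
    have : (eval₂Hom (bpMap p (Fin.castSucc (n := k + 1)))
      fun n : ℕ => t p (Fin.castSucc (Fin.last k)) (Fin.last (k + 1)) (n + 1)).comp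
        (mapEquiv ℕ (bpParam p (upTree k))).toRingHom =
      (bpParam p (upTree (k + 1))).toRingHom.comp (eval₂Hom
        (rename (R := pInt p) (Prod.map (Fin.castSucc (n := k + 1)) (id : ℕ → ℕ))).toRingHom
          (fun n : ℕ => X (Fin.last (k + 1), n))) := by
      refine ringHom_ext (fun r => ?_) (fun n => ?_)
      · simpa using bpMap_bpParam_castSucc p k r
      · have hj : Fin.last (k + 1) ≠ (upTree (k + 1)).root :=
          fun h => absurd (congrArg Fin.val h) (Nat.succ_ne_zero k)
        have h2 := bpParam_famVar p (upTree (k + 1)) hj (n + 1)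
        rw [famVar] at h2
        simp only [RingHom.comp_apply, RingEquiv.toRingHom_eq_coe, RingHom.coe_coe, eval₂Hom_X']
        rw [h2]
        simp
        rfl
    exact congrArg DFunLike.coe this
  have h2 := (bpParam p (upTree (k + 1))).bijective.comp
    (bijective_eval₂Hom_rename (A := pInt p) _ _ (bijective_sum_elim_last (k + 1)))
  rw [← h1] at h2
  exact (Function.Bijective.of_comp_iff _ (mapEquiv ℕ (bpParam p (upTree k))).bijective).mp h2

theorem castSucc_one : (Fin.castSucc : Fin 1 → Fin 2) = ![0] := by
  funext i; fin_cases i; rfl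

theorem castSucc_two : (Fin.castSucc : Fin 2 → Fin 3) = ![0, 1] := by
  funext i; fin_cases i <;> rfl

theorem tPoly_bijective : Function.Bijective (tPoly p) := by
  have := bijective_bp_last p 0
  rw [castSucc_one] at this
  exact this

/-- The basis of the smash power of `EBP` over a smaller smash power. -/
theorem isLeftBasis_ebpMap (k : ℕ) : IsLeftBasis (ebpMap p (Fin.castSucc (n := k + 1)))
    (fun b : (ℕ →₀ ℕ) × Finset ℕ => algebraMap _ (EBP p (Fin (k + 2)))
      (b.1.prod fun n e => t p (Fin.castSucc (Fin.last k)) (Fin.last (k + 1)) (n + 1) ^ e) *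
      ((b.2.toList.map fun n : ℕ => (Fin.last (k + 1), n)).map (gen _)).prod) :=
  isLeftBasis_extMap (bpMap p (Fin.castSucc (n := k + 1)))
    (isLeftBasis_of_bijective_eval₂Hom (bijective_bp_last p k)) _ _ (bijective_sum_elim_last' (k + 1))

/-- The map `inr` carries the basis of `EBP_*EBP` over its left unit to the basis of the threefold
ring over `inl`. -/
theorem coopHopf_isTensorSquare : (coopHopf p).IsTensorSquare := by
  have h0 := isLeftBasis_ebpMap p 0
  have h1 := isLeftBasis_ebpMap p 1
  rw [castSucc_one] at h0
  rw [castSucc_two] at h1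
  refine tensorOverMap_bijective _ _ _ _ _ h0 (Eq.mp (congrArg _ (funext fun b => Eq.symm ?_)) h1)
  show ebpMap p ![1, 2] _ = _
  rw [map_mul, ebpMap_algebraMap, map_finsuppProd, map_list_prod]
  simp only [map_pow, bpMap_t, List.map_map]
  congr 2
  refine List.map_congr_left fun n _ => ?_
  simp only [Function.comp_apply, ebpMap_gen]
  rfl

theorem isLeftBasis_milnorMap (k : ℕ) : IsLeftBasis (milnorMap p (Fin.castSucc (n := k)))
    (fun b : (ℕ →₀ ℕ) × Finset ℕ => algebraMap _ (Milnor p (Fin (k + 1)))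
      (b.1.prod fun n e => (X (Fin.last k, n) : XiRing p (Fin (k + 1))) ^ e) *
      ((b.2.toList.map fun n : ℕ => (Fin.last k, n)).map (gen _)).prod) :=
  isLeftBasis_extMap (rename (R := ZMod p) (Prod.map Fin.castSucc (id : ℕ → ℕ))).toRingHom
    (isLeftBasis_of_bijective_eval₂Hom
      (bijective_eval₂Hom_rename (A := ZMod p) _ _ (bijective_sum_elim_last k))) _ _
    (bijective_sum_elim_last' k)

/-- The Milnor algebra over no factors is the ground field. -/
def milnorCEquiv : ZMod p ≃+* Milnor p (Fin 0) := RingEquiv.ofBijective _ (milnorC_bijective p)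

/-- The same argument, with the Milnor algebra on no factors serving as the ground field. -/
theorem dualSteenrod_isTensorSquare : (dualSteenrod p).IsTensorSquare := by
  have h0 : IsLeftBasis (milnorUnit p) _ :=
    (isLeftBasis_milnorMap p 0).comp_equiv (milnorCEquiv p) _ (fun c => by
      show milnorUnit p c =
        milnorMap p Fin.castSucc (algebraMap (XiRing p (Fin 0)) (Milnor p (Fin 0)) (C c))
      rw [milnorMap_algebraMap, rename_C]
      rfl)
  have h1 := isLeftBasis_milnorMap p 1
  rw [castSucc_one] at h1
  refine tensorOverMap_bijective _ _ _ _ _ h0 (Eq.mp (congrArg _ (funext fun b => Eq.symm ?_)) h1)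
  show milnorMap p ![1] _ = _
  rw [map_mul, milnorMap_algebraMap, map_finsuppProd, map_list_prod]
  simp only [map_pow, rename_X, List.map_map]
  congr 2
  refine List.map_congr_left fun n _ => ?_
  simp only [Function.comp_apply, milnorMap_gen]
  rfl

end LeftBases

/-! ## Isomorphisms of Hopf data and tensor squares -/

theorem tensorRel_map {B X Y B' X' Y' : Type} [Ring B] [Ring X] [Ring Y] [Ring B'] [Ring X']
    [Ring Y'] {r : B →+* X} {l : B →+* Y} {r' : B' →+* X'} {l' : B' →+* Y'} (b : B ≃+* B')
    (f : X ≃+* X') (g : Y ≃+* Y') (hr : ∀ a, f (r a) = r' (b a)) (hl : ∀ a, g (l a) = l' (b a)) :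
    (tensorRel r l).map (TensorProduct.congr f.toAddEquiv.toIntLinearEquiv
      g.toAddEquiv.toIntLinearEquiv).toAddEquiv.toAddMonoidHom = tensorRel r' l' := by
  rw [tensorRel, AddMonoidHom.map_closure, tensorRel]
  congr 1
  ext z
  constructor
  · rintro ⟨_, ⟨x, a, y, rfl⟩, rfl⟩
    refine ⟨f x, b a, g y, ?_⟩
    simp [← hr, ← hl]
  · rintro ⟨x, a, y, rfl⟩
    refine ⟨_, ⟨f.symm x, b.symm a, g.symm y, rfl⟩, ?_⟩
    simp [hr, hl]

/-- Yields the Künneth statement for the homology without a Künneth argument: the square is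
identified on its own and the property is carried back from `A_*`. -/
theorem HopfData.Iso.isTensorSquare {H K : HopfData} (φ : H.Iso K) (hK : K.IsTensorSquare) :
    H.IsTensorSquare := by
  let e : TensorOver H.rightUnit H.leftUnit ≃+ TensorOver K.rightUnit K.leftUnit :=
    QuotientAddGroup.congr _ _
      (TensorProduct.congr φ.total.toAddEquiv.toIntLinearEquiv
        φ.total.toAddEquiv.toIntLinearEquiv).toAddEquiv
      (tensorRel_map φ.base φ.total φ.total φ.rightUnit φ.leftUnit)
  have h : φ.square ∘ tensorOverMap H.rightUnit H.leftUnit H.inl H.inr H.compat =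
      tensorOverMap K.rightUnit K.leftUnit K.inl K.inr K.compat ∘ e := by
    funext z
    obtain ⟨z, rfl⟩ := QuotientAddGroup.mk_surjective z
    induction z using TensorProduct.induction_on with
    | zero => simp only [Function.comp_apply, QuotientAddGroup.mk_zero, map_zero]
    | add x y hx hy =>
      simp only [Function.comp_apply, QuotientAddGroup.mk_add, map_add] at hx hy ⊢
      rw [hx, hy]
    | tmul x y =>
      have he : e (QuotientAddGroup.mk (x ⊗ₜ[ℤ] y)) =
        QuotientAddGroup.mk (φ.total x ⊗ₜ[ℤ] φ.total y) := rfl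
      rw [Function.comp_apply, Function.comp_apply, he, tensorOverMap_tmul, tensorOverMap_tmul,
        map_mul, φ.inl, φ.inr]
  have hb := hK.comp e.bijective
  rw [← h] at hb
  exact (Function.Bijective.of_comp_iff' φ.square.bijective _).mp hb

/-! ## Elements of a given degree -/

section DegreePart

variable {A B : Type} [Ring A] [Ring B] {G : Set (ℕ × A)} {H : Set (ℕ × B)}

theorem mem_degreePart_of_mem {g : ℕ × A} (hg : g ∈ G) : g.2 ∈ degreePart G g.1 :=
  AddSubgroup.subset_closure ⟨[g], by simpa using hg, by simp, by simp⟩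

theorem one_mem_degreePart : (1 : A) ∈ degreePart G 0 :=
  AddSubgroup.subset_closure ⟨[], by simp, by simp, by simp⟩

theorem mul_mem_degreePart {a b : A} {d e : ℕ} (ha : a ∈ degreePart G d)
    (hb : b ∈ degreePart G e) : a * b ∈ degreePart G (d + e) := by
  induction ha using AddSubgroup.closure_induction with
  | zero => rw [zero_mul]; exact zero_mem _
  | add x y _ _ hx hy => rw [add_mul]; exact add_mem hx hy
  | neg x _ hx => rw [neg_mul]; exact neg_mem hx
  | mem x hx =>
    obtain ⟨l, hl, rfl, rfl⟩ := hx
    induction hb using AddSubgroup.closure_induction with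
    | zero => rw [mul_zero]; exact zero_mem _
    | add x y _ _ hx hy => rw [mul_add]; exact add_mem hx hy
    | neg x _ hx => rw [mul_neg]; exact neg_mem hx
    | mem y hy =>
      obtain ⟨l', hl', rfl, rfl⟩ := hy
      refine AddSubgroup.subset_closure ⟨l ++ l', ?_, by simp, by simp⟩
      intro g hg
      exact (List.mem_append.mp hg).elim (hl g) (hl' g)

theorem pow_mem_degreePart {a : A} {d : ℕ} (ha : a ∈ degreePart G d) (k : ℕ) :
    a ^ k ∈ degreePart G (k * d) := by
  induction k with
  | zero => rw [pow_zero, zero_mul]; exact one_mem_degreePart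
  | succ k ih => rw [pow_succ, add_mul, one_mul]; exact mul_mem_degreePart ih ha

theorem map_mem_degreePart (φ : A →+* B) (h : ∀ g ∈ G, φ g.2 ∈ degreePart H g.1) {a : A} {d : ℕ}
    (ha : a ∈ degreePart G d) : φ a ∈ degreePart H d := by
  induction ha using AddSubgroup.closure_induction with
  | zero => rw [map_zero]; exact zero_mem _
  | add x y _ _ hx hy => rw [map_add]; exact add_mem hx hy
  | neg x _ hx => rw [map_neg]; exact neg_mem hx
  | mem x hx =>
    obtain ⟨l, hl, rfl, rfl⟩ := hx
    induction l with
    | nil => simpa using one_mem_degreePart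
    | cons g l ih =>
      simp only [List.map_cons, List.prod_cons, List.sum_cons, map_mul]
      exact mul_mem_degreePart (h g (hl g (by simp))) (ih fun g hg => hl g (by simp [hg]))

/-- Used with `K` the ring of cycles: lifting generators to cycles of the same degree lifts every
homogeneous element in this way. -/
theorem exists_lift_mem_degreePart (φ : A →+* B) (K : Subring A)
    (h : ∀ g ∈ H, ∃ a ∈ K, a ∈ degreePart G g.1 ∧ φ a = g.2) {b : B} {d : ℕ}
    (hb : b ∈ degreePart H d) : ∃ a ∈ K, a ∈ degreePart G d ∧ φ a = b := by
  induction hb using AddSubgroup.closure_induction with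
  | zero => exact ⟨0, zero_mem _, zero_mem _, map_zero _⟩
  | add x y _ _ hx hy =>
    obtain ⟨a, ha, ha', rfl⟩ := hx
    obtain ⟨c, hc, hc', rfl⟩ := hy
    exact ⟨a + c, add_mem ha hc, add_mem ha' hc', map_add _ _ _⟩
  | neg x _ hx =>
    obtain ⟨a, ha, ha', rfl⟩ := hx
    exact ⟨-a, neg_mem ha, neg_mem ha', map_neg _ _⟩
  | mem x hx =>
    obtain ⟨l, hl, rfl, rfl⟩ := hx
    induction l with
    | nil => exact ⟨1, one_mem _, by simpa using one_mem_degreePart, by simp⟩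
    | cons g l ih =>
      obtain ⟨a, ha, ha', hga⟩ := h g (hl g (by simp))
      obtain ⟨c, hc, hc', hlc⟩ := ih fun g hg => hl g (by simp [hg])
      simp only [List.map_cons, List.prod_cons, List.sum_cons]
      exact ⟨a * c, mul_mem ha hc, mul_mem_degreePart ha' hc', by rw [map_mul, hga, hlc]⟩

open MvPolynomial in
theorem map_mem_degreePart_of_isWeightedHomogeneous {X R : Type} [CommRing R] {w : X → ℕ}
    (φ : MvPolynomial X R →+* A) (hC : ∀ c, φ (C c) ∈ degreePart G 0)
    (hX : ∀ x, φ (MvPolynomial.X x) ∈ degreePart G (w x)) {x : MvPolynomial X R} {d : ℕ}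
    (hx : IsWeightedHomogeneous w x d) : φ x ∈ degreePart G d := by
  have key : ∀ (e : X →₀ ℕ) (c : R), φ (monomial e c) ∈ degreePart G (Finsupp.weight w e) := by
    intro e
    induction e using Finsupp.induction_linear with
    | zero => intro c; rw [map_zero]; exact hC c
    | add e f he hf =>
      intro c
      rw [← mul_one c, ← monomial_mul, map_mul, map_add]
      exact mul_mem_degreePart (he c) (hf 1)
    | single a b =>
      intro c
      rw [← C_mul_X_pow_eq_monomial, map_mul, map_pow, Finsupp.weight_single, smul_eq_mul,
        ← zero_add (b * w a)]
      exact mul_mem_degreePart (hC c) (pow_mem_degreePart (hX a) b)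
  rw [← support_sum_monomial_coeff x, map_sum]
  refine sum_mem fun e he => ?_
  rw [← hx (mem_support_iff.mp he)]
  exact key e _

end DegreePart

/-! ## Reduction of `EBP` to the Milnor algebra -/

section Reduction

open MvPolynomial

variable (p : ℕ)

/-- The tree `0 → 1 → ⋯ → k`. -/
def downTree (k : ℕ) : RootedTree (Fin (k + 1)) where
  root := Fin.last k
  parent j := ⟨min (j + 1) k, by omega⟩
  rank j := k - j
  rank_lt j hj := by
    have h1 : (j : ℕ) ≠ k := fun h => hj (Fin.ext h)
    have h2 := j.2
    show k - min ((j : ℕ) + 1) k < k - j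
    omega

theorem downTree_parent {k : ℕ} (j : Fin k) : (downTree k).parent j.castSucc = j.succ :=
  Fin.ext (by
    show min ((j : ℕ) + 1) k = j + 1
    omega)

/-- Setting the variables of the last family to zero. -/
def dropLast (k : ℕ) : XiRing p (Fin (k + 1)) →+* XiRing p (Fin k) :=
  eval₂Hom C fun x => Fin.lastCases (motive := fun _ => XiRing p (Fin k)) 0
    (fun j => X (j, x.2)) x.1

theorem dropLast_C (k : ℕ) (c : ZMod p) : dropLast p k (C c) = C c := eval₂_C _ _ _

theorem dropLast_xi {k : ℕ} (j : Fin k) (n : ℕ) : dropLast p k (xi p j.castSucc n) = xi p j n := by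
  cases n with
  | zero => exact map_one _
  | succ n => rw [xi, dropLast, eval₂Hom_X', Fin.lastCases_castSucc, xi]

/-- The homology class of a cycle. -/
def homologyClass {I : Type} {z : EBP p I} (hz : del p I z = 0) : HEBP p I :=
  Ideal.Quotient.mk (boundaries (vFun p I)) ⟨z, hz⟩

section Shear

variable {k : ℕ} (e : Fin k × ℕ → (Fin k × ℕ →₀ XiRing p (Fin k)))

/-- The images of the generators `μ`, given a shear `e`. -/
def shearLast (x : Fin (k + 1) × ℕ) : Fin k × ℕ →₀ XiRing p (Fin k) :=
  Fin.lastCases (motive := fun _ => Fin k × ℕ →₀ XiRing p (Fin k)) 0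
    (fun j => Finsupp.single (j, x.2) 1 + e (j, x.2)) x.1

theorem shearLast_last (n : ℕ) : shearLast p e (Fin.last k, n) = 0 := by
  rw [shearLast, Fin.lastCases_last]

theorem shearLast_castSucc (j : Fin k) (n : ℕ) :
    shearLast p e (j.castSucc, n) = Finsupp.single (j, n) 1 + e (j, n) := by
  rw [shearLast, Fin.lastCases_castSucc]

end Shear

variable [Fact p.Prime]

/-- Reduction modulo the Araki generators, in terms of the coefficients `t_n` from the family
`j + 1` to the family `j`. -/
def red (k : ℕ) : bp p (Fin (k + 1)) →+* XiRing p (Fin k) :=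
  (dropLast p k).comp (redV p (downTree k))

/-- The reduction does not involve the last family, so dropping that family loses nothing and `red`
has the same kernel as `redV`. -/
theorem rename_red {k : ℕ} (x : bp p (Fin (k + 1))) :
    rename (Prod.map Fin.castSucc id) (red p k x) = redV p (downTree k) x := by
  classical
  have : ((rename (R := ZMod p) (Prod.map Fin.castSucc id)).toRingHom.comp (dropLast p k)).comp
      (redKill p (rootVars (downTree k) Set.univ)) =
      redKill p (rootVars (downTree k) Set.univ) := by
    refine ringHom_ext (fun r => ?_) (fun x => ?_)
    · simp [redKill, dropLast]
    · obtain ⟨j, n⟩ := x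
      rw [RingHom.comp_apply, redKill, eval₂Hom_X']
      split_ifs with h
      · rw [map_zero]
      · induction j using Fin.lastCases with
        | last => exact absurd ⟨n, trivial, rfl⟩ h
        | cast j => simp [dropLast]
  exact RingHom.congr_fun this _

theorem ker_red (k : ℕ) : RingHom.ker (red p k) = Ideal.span (Set.range (v p (Fin.last k))) := by
  have h : RingHom.ker (redV p (downTree k)) = _ := ker_redV p (downTree k)
  rw [show Fin.last k = (downTree k).root from rfl, ← h]
  ext x
  rw [RingHom.mem_ker, RingHom.mem_ker]
  constructor
  · intro hx
    rw [← rename_red, hx, map_zero]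
  · intro hx
    rw [red, RingHom.comp_apply, hx, map_zero]

theorem red_v {k : ℕ} (j : Fin (k + 1)) (n : ℕ) : red p k (v p j n) = 0 := by
  rw [red, RingHom.comp_apply, redV_v, map_zero]

theorem red_t {k : ℕ} (i j l : Fin (k + 1)) (n : ℕ) :
    red p k (t p i l n) =
      twConv p (fun n => red p k (t p i j n)) (fun n => red p k (t p j l n)) n := by
  rw [red, RingHom.comp_apply, redV_t p _ i j l, map_twConv]
  rfl

theorem red_t_succ {k : ℕ} (j : Fin k) (n : ℕ) :
    red p k (t p j.succ j.castSucc n) = xi p j n := by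
  rw [← downTree_parent, red, RingHom.comp_apply,
    redV_t_parent p _ (j := j.castSucc) (Fin.castSucc_lt_last j).ne, dropLast_xi]

theorem red_C {k : ℕ} {c : bp p (Fin (k + 1))} {q : ℚ} (hq : ¬ p ∣ q.den)
    (h : C q = (c : MvPolynomial (Fin (k + 1) × ℕ) ℚ)) : red p k c = C (pRed p ⟨q, hq⟩) := by
  rw [red, RingHom.comp_apply, redV_C p _ hq h, dropLast_C]

/-- Reduction is compatible with maps of index sets, on kernels. -/
theorem red_bpMap_eq_zero {k l : ℕ} (f : Fin (k + 1) → Fin (l + 1)) {x : bp p (Fin (k + 1))}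
    (hx : red p k x = 0) : red p l (bpMap p f x) = 0 := by
  have h : RingHom.ker (red p k) ≤ RingHom.ker ((red p l).comp (bpMap p f)) := by
    rw [ker_red, Ideal.span_le]
    rintro _ ⟨n, rfl⟩
    show red p l (bpMap p f (v p _ n)) = 0
    rw [bpMap_v, red_v]
  exact h hx

variable {k : ℕ} (e : Fin k × ℕ → (Fin k × ℕ →₀ XiRing p (Fin k)))

/-- The reduction of `EBP` to the Milnor algebra. -/
def milnorRed : EBP p (Fin (k + 1)) →+* Milnor p (Fin k) := extMap (red p k) (shearLast p e)

/-- Every family's `v_n` reduces to zero, so the Milnor algebra carries the Koszul differential of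
weight zero. -/
theorem milnorRed_del (z : EBP p (Fin (k + 1))) : milnorRed p e (del p _ z) = 0 := by
  have h := extMap_koszul (vFun p (Fin (k + 1))) (0 : Fin k × ℕ → XiRing p (Fin k)) (red p k)
    (shearLast p e) (fun x => ?_) z
  · rw [koszul_zero] at h
    exact h.symm
  · rw [vFun, red_v, Finsupp.linearCombination_apply]
    simp

theorem milnorRed_zero_eq (z : EBP p (Fin (k + 1))) :
    milnorMap p Fin.castSucc (milnorRed p (0 : Fin k × ℕ → (Fin k × ℕ →₀ XiRing p (Fin k))) z) =
      extMap (redV p (downTree k)) (fun x => Finsupp.single x 1)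
        (kill _ (Set.range fun n => (Fin.last k, n)) z) := by
  classical
  have : (milnorMap p Fin.castSucc).comp
      (milnorRed p (0 : Fin k × ℕ → (Fin k × ℕ →₀ XiRing p (Fin k)))) =
      (extMap (redV p (downTree k)) (fun x => Finsupp.single x 1)).comp
        (kill _ (Set.range fun n => (Fin.last k, n))) := by
    refine ext_ringHom (fun r => ?_) (fun x => ?_)
    · rw [RingHom.comp_apply, RingHom.comp_apply, milnorRed, extMap_algebraMap,
        milnorMap_algebraMap, rename_red, kill_algebraMap, extMap_algebraMap]
    · obtain ⟨j, n⟩ := x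
      rw [RingHom.comp_apply, RingHom.comp_apply, milnorRed, extMap_gen, kill_gen]
      induction j using Fin.lastCases with
      | last => rw [shearLast_last, if_pos ⟨n, rfl⟩, map_zero, map_zero, map_zero]
      | cast j =>
        rw [shearLast_castSucc, if_neg, Pi.zero_apply, add_zero, ← gen, milnorMap_gen, extMap_gen]
        · rfl
        · rintro ⟨m, h⟩
          exact (Fin.castSucc_lt_last j).ne (congrArg Prod.fst h).symm
  exact RingHom.congr_fun this z

/-- The parameter `e` only changes coordinates in the target. Exactness needs just `e = 0`, while
the choice of `e` decides which cycles become the Milnor generators. -/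
theorem milnorRed_eq (z : EBP p (Fin (k + 1))) :
    milnorRed p e z = extMap (RingHom.id _) (fun x => Finsupp.single x 1 + e x)
      (milnorRed p (0 : Fin k × ℕ → (Fin k × ℕ →₀ XiRing p (Fin k))) z) := by
  rw [milnorRed, milnorRed, extMap_extMap]
  congr 2
  funext ⟨j, n⟩
  induction j using Fin.lastCases with
  | last => rw [shearLast_last, shearLast_last, Finsupp.sum_zero_index]
  | cast j =>
    rw [shearLast_castSucc, shearLast_castSucc, Pi.zero_apply, add_zero,
      Finsupp.sum_single_index (by simp)]
    simp

/-- By invariance of the ideal, the `μ` of the earlier families can be changed into cycles using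
those of the last family. The complex becomes the Koszul complex of the last family's regular
sequence with free generators of weight zero, and `koszul_exact_of_extMap` applies. -/
theorem exists_del_eq (he : ∀ x, (e x).sum (fun y r => r • e y) = 0) {z : EBP p (Fin (k + 1))}
    (hz : del p _ z = 0) (hz' : milnorRed p e z = 0) : ∃ y, del p _ y = z := by
  have hd : ∀ x : Fin (k + 1) × ℕ, ∃ d : ℕ →₀ bp p (Fin (k + 1)),
      d.sum (fun i a => a * v p (Fin.last k) i) = - v p x.1 x.2 := by
    intro x
    have h : - v p x.1 x.2 ∈ RingHom.ker (red p k) := neg_mem (red_v p x.1 x.2)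
    rw [ker_red] at h
    exact Finsupp.mem_ideal_span_range_iff_exists_finsupp.mp h
  choose d hd using hd
  -- The corrected generator has differential `v_n^{(j)} + ∑ d_i v_i = 0`. The correction uses only
  -- the last family, which `ε` fixes, so it is a shear.
  let ε : Fin (k + 1) × ℕ → (Fin (k + 1) × ℕ →₀ bp p (Fin (k + 1))) := fun x =>
    if x.1 = Fin.last k then 0 else (d x).mapDomain fun i => (Fin.last k, i)
  have hε : ∀ n, ε (Fin.last k, n) = 0 := fun n => if_pos rfl
  have hε' : ∀ (j : Fin k) n, ε (j.castSucc, n) =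
      (d (j.castSucc, n)).mapDomain fun i => (Fin.last k, i) :=
    fun j n => if_neg (Fin.castSucc_lt_last j).ne
  let w : Fin (k + 1) × ℕ → bp p (Fin (k + 1)) := fun x =>
    if x.1 = Fin.last k then v p x.1 x.2 else 0
  let θ : EBP p (Fin (k + 1)) →+* EBP p (Fin (k + 1)) :=
    extMap (RingHom.id _) fun x => Finsupp.single x 1 + ε x
  have hθ : Function.Bijective θ := by
    refine extMap_shear_bijective ε ?_
    rintro ⟨j, n⟩
    induction j using Fin.lastCases with
    | last => rw [hε, Finsupp.sum_zero_index]
    | cast j =>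
      rw [hε', Finsupp.sum_mapDomain_index (by simp) (by intros; rw [add_smul])]
      simp [hε]
  have hθw : ∀ z, del p _ (θ z) = θ (koszul w z) := by
    refine extMap_koszul w _ _ _ ?_
    rintro ⟨j, n⟩
    rw [map_add, Finsupp.linearCombination_single, one_smul, vFun, RingHom.id_apply]
    induction j using Fin.lastCases with
    | last => rw [hε, map_zero, add_zero]; exact (if_pos rfl).symm
    | cast j =>
      have h1 : w (j.castSucc, n) = 0 := if_neg (Fin.castSucc_lt_last j).ne
      rw [hε', h1, Finsupp.linearCombination_mapDomain, Finsupp.linearCombination_apply]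
      have h2 := hd (j.castSucc, n)
      exact (congrArg (v p j.castSucc n + ·) h2).trans (add_neg_cancel _)
  -- The change of generators is invisible after reduction, because the last family's generators go
  -- to zero.
  have hθe : ∀ z, milnorRed p e (θ z) = milnorRed p e z := by
    intro z
    rw [milnorRed, extMap_extMap]
    congr 2
    funext ⟨j, n⟩
    rw [Finsupp.sum_add_index' (by simp) (by intros; rw [map_add, add_smul]),
      Finsupp.sum_single_index (by simp), map_one, one_smul]
    induction j using Fin.lastCases with
    | last => rw [hε, Finsupp.sum_zero_index, add_zero]
    | cast j =>
      rw [hε', Finsupp.sum_mapDomain_index (by simp) (by intros; rw [map_add, add_smul])]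
      simp [shearLast_last]
  obtain ⟨z, rfl⟩ := hθ.2 z
  rw [hθw] at hz
  rw [hθe, milnorRed_eq] at hz'
  have h0 := (extMap_shear_bijective e he).1 (hz'.trans (map_zero _).symm)
  have h1 := milnorRed_zero_eq p z
  rw [h0, map_zero] at h1
  obtain ⟨y, rfl⟩ := koszul_exact_of_extMap (v p (Fin.last k)) (v_regular p (downTree k))
    (k := fun n => (Fin.last k, n)) (fun a b h => congrArg Prod.snd h) w (fun i => if_pos rfl)
    (fun x hx => if_neg fun h => hx ⟨x.2, Prod.ext h.symm rfl⟩) (redV p (downTree k))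
    (ker_redV p (downTree k)) (hθ.1 (hz.trans (map_zero θ).symm)) h1.symm
  exact ⟨θ y, hθw y⟩

/-- The map from the homology of `EBP` to the Milnor algebra. -/
def homologyRed : HEBP p (Fin (k + 1)) →+* Milnor p (Fin k) :=
  Ideal.Quotient.lift (boundaries (vFun p (Fin (k + 1))))
    ((milnorRed p e).comp (cycles (vFun p (Fin (k + 1)))).subtype) (by
      rintro z ⟨y, hy⟩
      rw [RingHom.comp_apply, Subring.subtype_apply, ← hy]
      exact milnorRed_del p e y)

theorem homologyRed_injective (he : ∀ x, (e x).sum (fun y r => r • e y) = 0) :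
    Function.Injective (homologyRed p e) := by
  rw [injective_iff_map_eq_zero]
  intro z hz
  obtain ⟨⟨z, hz0⟩, rfl⟩ := Ideal.Quotient.mk_surjective z
  obtain ⟨y, hy⟩ := exists_del_eq p e he hz0 hz
  exact Ideal.Quotient.eq_zero_iff_mem.mpr ⟨y, hy⟩

end Reduction

/-! ## Degrees and surjectivity -/

section Degrees

open MvPolynomial

variable (p : ℕ)

theorem algebraMap_t_mem {I : Type} (i j : I) (n : ℕ) :
    algebraMap (bp p I) (EBP p I) (t p i j n) ∈ degreePart (ebpGens p I) (vDeg p n) :=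
  mem_degreePart_of_mem (G := ebpGens p I) (g := (_, _)) (Or.inl (Or.inr ⟨i, j, n, rfl⟩))

theorem algebraMap_v_mem {I : Type} (i : I) (n : ℕ) :
    algebraMap (bp p I) (EBP p I) (v p i n) ∈ degreePart (ebpGens p I) (vDeg p n) :=
  mem_degreePart_of_mem (G := ebpGens p I) (g := (_, _)) (Or.inl (Or.inl (Or.inr ⟨i, n, rfl⟩)))

theorem gen_mem {I : Type} (i : I) (n : ℕ) :
    gen (bp p I) (i, n) ∈ degreePart (ebpGens p I) (vDeg p n + 1) :=
  mem_degreePart_of_mem (G := ebpGens p I) (g := (_, _)) (Or.inr ⟨i, n, rfl⟩)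

theorem algebraMap_const_mem {I : Type} {c : bp p I} {q : ℚ} (hq : ¬ p ∣ q.den)
    (h : C q = (c : MvPolynomial (I × ℕ) ℚ)) :
    algebraMap (bp p I) (EBP p I) c ∈ degreePart (ebpGens p I) 0 :=
  mem_degreePart_of_mem (G := ebpGens p I) (g := (_, _)) (Or.inl (Or.inl (Or.inl ⟨c, ⟨q, hq, h⟩, rfl⟩)))

theorem milnor_C_mem {I : Type} (c : ZMod p) :
    algebraMap (XiRing p I) (Milnor p I) (C c) ∈ degreePart (milnorGens p I) 0 :=
  mem_degreePart_of_mem (G := milnorGens p I) (g := (_, _)) (Or.inl (Or.inl ⟨c, rfl⟩))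

theorem milnor_xi_mem {I : Type} (i : I) (n : ℕ) :
    algebraMap (XiRing p I) (Milnor p I) (xi p i n) ∈ degreePart (milnorGens p I) (vDeg p n) :=
  mem_degreePart_of_mem (G := milnorGens p I) (g := (_, _)) (Or.inl (Or.inr ⟨i, n, rfl⟩))

theorem milnor_gen_mem {I : Type} (i : I) (n : ℕ) :
    gen (XiRing p I) (i, n) ∈ degreePart (milnorGens p I) (vDeg p n + 1) :=
  mem_degreePart_of_mem (G := milnorGens p I) (g := (_, _)) (Or.inr ⟨i, n, rfl⟩)

theorem ebpMap_mem_degreePart {I J : Type} (f : I → J) {z : EBP p I} {d : ℕ}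
    (hz : z ∈ degreePart (ebpGens p I) d) : ebpMap p f z ∈ degreePart (ebpGens p J) d := by
  refine map_mem_degreePart (ebpMap p f) ?_ hz
  rintro _ (((⟨c, ⟨q, hq, hc⟩, rfl⟩ | ⟨i, n, rfl⟩) | ⟨i, j, n, rfl⟩) | ⟨i, n, rfl⟩)
  · rw [ebpMap_algebraMap]
    refine algebraMap_const_mem p hq ?_
    show _ = rename _ (c : MvPolynomial (I × ℕ) ℚ)
    rw [← hc, rename_C]
  · rw [ebpMap_algebraMap, bpMap_v]
    exact algebraMap_v_mem p _ n
  · rw [ebpMap_algebraMap, bpMap_t]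
    exact algebraMap_t_mem p _ _ n
  · rw [ebpMap_gen]
    exact gen_mem p _ n

variable [Fact p.Prime]

theorem algebraMap_bpParam_mem {I : Type} (O : RootedTree I)
    {x : MvPolynomial (I × ℕ) (pInt p)} {d : ℕ} (hx : IsWeightedHomogeneous (varDeg p) x d) :
    algebraMap (bp p I) (EBP p I) (bpParam p O x) ∈ degreePart (ebpGens p I) d := by
  refine map_mem_degreePart_of_isWeightedHomogeneous
    ((algebraMap (bp p I) (EBP p I)).comp (bpParam p O).toRingHom) (fun c => ?_) (fun x => ?_) hx
  · exact algebraMap_const_mem p c.2 (bpParam_C p O c).symm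
  · obtain ⟨j, n⟩ := x
    show algebraMap _ _ (bpParam p O (X (j, n))) ∈ degreePart _ (vDeg p (n + 1))
    by_cases hj : j = O.root
    · subst hj
      have h := bpParam_vVar p O (n + 1)
      rw [vVar] at h
      rw [h]
      exact algebraMap_v_mem p _ _
    · have h := bpParam_famVar p O hj (n + 1)
      rw [famVar] at h
      rw [h]
      exact algebraMap_t_mem p _ _ _

variable {k : ℕ}

/-- As a homogeneous polynomial in the down-tree generators, `t_n` is determined by the root
variables, which reduce to zero, and the edge variables, which reduce to the `ξ`. -/
theorem algebraMap_red_t_mem (i j : Fin (k + 1)) (n : ℕ) :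
    algebraMap (XiRing p (Fin k)) (Milnor p (Fin k)) (red p k (t p i j n)) ∈
      degreePart (milnorGens p (Fin k)) (vDeg p n) := by
  have h : t p i j n = bpParam p (downTree k) (tP p (downTree k) i j n) :=
    ((bpParam p (downTree k)).apply_symm_apply _).symm
  rw [h]
  refine map_mem_degreePart_of_isWeightedHomogeneous
    (((algebraMap (XiRing p (Fin k)) (Milnor p (Fin k))).comp (red p k)).comp
      (bpParam p (downTree k)).toRingHom) (fun c => ?_) (fun x => ?_)
    (isWeightedHomogeneous_tP p (downTree k) i j n)
  · show algebraMap _ _ (red p k (bpParam p (downTree k) (C c))) ∈ _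
    rw [red_C p c.2 (bpParam_C p _ c).symm]
    exact milnor_C_mem p _
  · obtain ⟨j, n⟩ := x
    show algebraMap _ _ (red p k (bpParam p (downTree k) (X (j, n)))) ∈
      degreePart _ (vDeg p (n + 1))
    induction j using Fin.lastCases with
    | last =>
      have h := bpParam_vVar p (downTree k) (n + 1)
      rw [vVar] at h
      have h' : (downTree k).root = Fin.last k := rfl
      rw [← h', h, red_v, map_zero]
      exact zero_mem _
    | cast j =>
      have h := bpParam_famVar p (downTree k) (j := j.castSucc) (Fin.castSucc_lt_last j).ne (n + 1)
      rw [famVar] at h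
      rw [h, downTree_parent, red_t_succ]
      exact milnor_xi_mem p _ _

variable {e : Fin k × ℕ → (Fin k × ℕ →₀ XiRing p (Fin k))}

theorem milnorRed_mem_degreePart
    (he : ∀ j n, ExteriorAlgebra.ι _ (e (j, n)) ∈ degreePart (milnorGens p (Fin k)) (vDeg p n + 1))
    {z : EBP p (Fin (k + 1))} {d : ℕ} (hz : z ∈ degreePart (ebpGens p (Fin (k + 1))) d) :
    milnorRed p e z ∈ degreePart (milnorGens p (Fin k)) d := by
  refine map_mem_degreePart (milnorRed p e) ?_ hz
  rintro _ (((⟨c, ⟨q, hq, hc⟩, rfl⟩ | ⟨i, n, rfl⟩) | ⟨i, j, n, rfl⟩) | ⟨i, n, rfl⟩)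
  · rw [milnorRed, extMap_algebraMap, red_C p hq hc]
    exact milnor_C_mem p _
  · rw [milnorRed, extMap_algebraMap, red_v, map_zero]
    exact zero_mem _
  · rw [milnorRed, extMap_algebraMap]
    exact algebraMap_red_t_mem p _ _ n
  · rw [milnorRed, extMap_gen]
    induction i using Fin.lastCases with
    | last =>
      rw [shearLast_last, map_zero]
      exact zero_mem _
    | cast j =>
      rw [shearLast_castSucc, map_add]
      exact add_mem (milnor_gen_mem p j n) (he j n)

/-- Coefficients are cycles, so constants and the `ξ` lift at once and only the exterior generators
need the hypothesis `hτ`. Preserving the degree gives the graded statement along with surjectivity.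
-/
theorem exists_cycle_milnorRed
    (hτ : ∀ j n, ∃ z, del p _ z = 0 ∧ z ∈ degreePart (ebpGens p (Fin (k + 1))) (vDeg p n + 1) ∧
      milnorRed p e z = gen _ (j, n)) {y : Milnor p (Fin k)} {d : ℕ}
    (hy : y ∈ degreePart (milnorGens p (Fin k)) d) :
    ∃ z ∈ cycles (vFun p (Fin (k + 1))), z ∈ degreePart (ebpGens p (Fin (k + 1))) d ∧
      milnorRed p e z = y := by
  refine exists_lift_mem_degreePart (milnorRed p e) (cycles (vFun p (Fin (k + 1)))) ?_ hy
  rintro _ ((⟨c, rfl⟩ | ⟨j, n, rfl⟩) | ⟨j, n, rfl⟩)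
  · obtain ⟨q, rfl⟩ := pRed_surjective p c
    refine ⟨_, koszul_algebraMap _ (bpParam p (downTree k) (C q)),
      algebraMap_const_mem p q.2 (bpParam_C p _ q).symm, ?_⟩
    rw [milnorRed, extMap_algebraMap, red_C p q.2 (bpParam_C p _ q).symm]
  · refine ⟨_, koszul_algebraMap _ (t p j.succ j.castSucc n), algebraMap_t_mem p _ _ n, ?_⟩
    rw [milnorRed, extMap_algebraMap, red_t_succ]
  · exact hτ j n

theorem homologyRed_surjective
    (hτ : ∀ j n, ∃ z, del p _ z = 0 ∧ z ∈ degreePart (ebpGens p (Fin (k + 1))) (vDeg p n + 1) ∧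
      milnorRed p e z = gen _ (j, n)) : Function.Surjective (homologyRed p e) := by
  have key : ∀ {y d}, y ∈ degreePart (milnorGens p (Fin k)) d → y ∈ (homologyRed p e).range := by
    intro y d hy
    obtain ⟨z, hz, -, rfl⟩ := exists_cycle_milnorRed p hτ hy
    exact ⟨homologyClass p hz, rfl⟩
  have hr : ∀ r : XiRing p (Fin k), algebraMap _ (Milnor p (Fin k)) r ∈ (homologyRed p e).range := by
    intro r
    induction r using MvPolynomial.induction_on with
    | C c => exact key (milnor_C_mem p c)
    | add a b ha hb => rw [map_add]; exact add_mem ha hb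
    | mul_X a x ha => rw [map_mul]; exact mul_mem ha (key (milnor_xi_mem p x.1 (x.2 + 1)))
  intro y
  show y ∈ (homologyRed p e).range
  induction y using ext_induction with
  | h0 r => exact hr r
  | hadd a b ha hb => exact add_mem ha hb
  | hmul m a ha =>
    refine mul_mem ?_ ha
    rw [ι_mem_closure_gen]
    exact sum_mem fun x _ => mul_mem (hr _) (key (milnor_gen_mem p x.1 x.2))

/-- The homology of `EBP` is the Milnor algebra. -/
def homologyEquiv (he : ∀ x, (e x).sum (fun y r => r • e y) = 0)
    (hτ : ∀ j n, ∃ z, del p _ z = 0 ∧ z ∈ degreePart (ebpGens p (Fin (k + 1))) (vDeg p n + 1) ∧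
      milnorRed p e z = gen _ (j, n)) : HEBP p (Fin (k + 1)) ≃+* Milnor p (Fin k) :=
  RingEquiv.ofBijective (homologyRed p e)
    ⟨homologyRed_injective p e he, homologyRed_surjective p hτ⟩

/-- For the nontrivial direction, a lift of the right degree represents the given class because the
map on homology is injective. -/
theorem homologyRed_mem_degreePart_iff (he : ∀ x, (e x).sum (fun y r => r • e y) = 0)
    (he' : ∀ j n, ExteriorAlgebra.ι _ (e (j, n)) ∈ degreePart (milnorGens p (Fin k)) (vDeg p n + 1))
    (hτ : ∀ j n, ∃ z, del p _ z = 0 ∧ z ∈ degreePart (ebpGens p (Fin (k + 1))) (vDeg p n + 1) ∧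
      milnorRed p e z = gen _ (j, n)) (d : ℕ) (x : HEBP p (Fin (k + 1))) :
    homologyRed p e x ∈ degreePart (milnorGens p (Fin k)) d ↔
      x ∈ homologyClasses (vFun p (Fin (k + 1))) (degreePart (ebpGens p (Fin (k + 1))) d) := by
  constructor
  · intro hx
    obtain ⟨z, hz, hz', h⟩ := exists_cycle_milnorRed p hτ hx
    exact ⟨⟨z, hz⟩, hz', homologyRed_injective p e he h⟩
  · rintro ⟨⟨z, hz⟩, hz', rfl⟩
    exact milnorRed_mem_degreePart p he' hz'

end Degrees

/-! ### Cycles representing the `τ_n` and the homology for one, two and three factors -/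

section Generators

open MvPolynomial

variable (p : ℕ)

theorem ebpMap_id {I : Type} (z : EBP p I) : ebpMap p id z = z := by
  have : ebpMap p (id : I → I) = RingHom.id _ := by
    refine ext_ringHom (fun r => ?_) (fun x => ebpMap_gen p id x)
    rw [ebpMap_algebraMap]
    refine congrArg (algebraMap (bp p I) (EBP p I)) (Subtype.ext ?_)
    show rename _ (r : MvPolynomial (I × ℕ) ℚ) = (r : MvPolynomial (I × ℕ) ℚ)
    rw [Prod.map_id, rename_id_apply]
  exact RingHom.congr_fun this z

/-- The trivial shear. -/
def shearZero (k : ℕ) : Fin k × ℕ → (Fin k × ℕ →₀ XiRing p (Fin k)) := 0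

/-- The shear for three factors. -/
def shearTwo (x : Fin 2 × ℕ) : Fin 2 × ℕ →₀ XiRing p (Fin 2) :=
  if x.1 = 0 then ∑ a ∈ Finset.range (x.2 + 1), Finsupp.single (1, a) (xi p 0 (x.2 - a) ^ p ^ a)
  else 0

theorem shearZero_sq (k : ℕ) (x : Fin k × ℕ) :
    (shearZero p k x).sum (fun y r => r • shearZero p k y) = 0 := Finsupp.sum_zero_index

theorem shearTwo_sq (x : Fin 2 × ℕ) :
    (shearTwo p x).sum (fun y r => r • shearTwo p y) = 0 := by
  obtain ⟨i, n⟩ := x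
  fin_cases i
  · show (∑ a ∈ Finset.range (n + 1), Finsupp.single ((1 : Fin 2), a) (xi p 0 (n - a) ^ p ^ a)).sum
      (fun y r => r • shearTwo p y) = 0
    rw [← Finsupp.sum_finsetSum_index (by simp) (by intros; rw [add_smul])]
    refine Finset.sum_eq_zero fun a _ => ?_
    rw [Finsupp.sum_single_index (by simp)]
    exact smul_zero _
  · exact Finsupp.sum_zero_index

theorem shearLast_one_one (n : ℕ) : shearLast p (shearZero p 1) (1, n) = 0 :=
  shearLast_last p (shearZero p 1) n

theorem shearLast_two_two (n : ℕ) : shearLast p (shearTwo p) (2, n) = 0 :=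
  shearLast_last p (shearTwo p) n

variable [Fact p.Prime]

/-- The right unit formula fails by an element of the square of the ideal, which is a combination of
the `v_k` with coefficients still in the ideal. These coefficients vanish under `red`, and
homogeneity keeps the resulting cycle in one degree. -/
theorem exists_tau_correction (n : ℕ) : ∃ d : ℕ →₀ bp p (Fin 2),
    (∀ k, red p 1 (d k) = 0) ∧
    (∀ k, algebraMap (bp p (Fin 2)) (EBP p (Fin 2)) (d k) * gen _ (1, k) ∈
      degreePart (ebpGens p (Fin 2)) (vDeg p n + 1)) ∧
    v p 0 n = twConv p (v p 1) (t p 1 0) n + d.sum fun k a => a * v p 1 k := by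
  let O := downTree 1
  have hx : IsWeightedHomogeneous (varDeg p)
      (aP p O 0 n - twConv p (aP p O 1) (tP p O 1 0) n) (vDeg p n) := by
    rw [← mem_weightedHomogeneousSubmodule]
    exact sub_mem (isWeightedHomogeneous_aP p O 0 n)
      (isWeightedHomogeneous_twConv (Fact.out : p.Prime).pos
        (fun a _ => isWeightedHomogeneous_aP p O 1 a)
        (fun a _ => isWeightedHomogeneous_tP p O 1 0 a))
  obtain ⟨d, hd, hd', hdeg⟩ := exists_homogeneous_combination p O hx (sq_dvd_scale_aP_sub p O 1 0 n)
  refine ⟨d.mapRange (bpParam p O) (map_zero _), fun k => ?_, fun k => ?_, ?_⟩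
  · rw [Finsupp.mapRange_apply, red, RingHom.comp_apply, redV_apply, RingEquiv.symm_apply_apply,
      hd', map_zero]
  · rw [Finsupp.mapRange_apply]
    by_cases hk : d k = 0
    · rw [hk, map_zero, map_zero, zero_mul]
      exact zero_mem _
    · obtain ⟨e, he⟩ := exists_coeff_ne_zero hk
      have h1 := hdeg k e he
      have h2 : IsWeightedHomogeneous (varDeg p) (d k) (Finsupp.weight (varDeg p) e) := by
        intro e' he'
        have := hdeg k e' he'
        omega
      rw [← h1, add_assoc]
      exact mul_mem_degreePart (algebraMap_bpParam_mem p O h2) (gen_mem p 1 k)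
  · have h1 := congrArg (bpParam p O) hd
    have h2 : bpParam p O (twConv p (aP p O 1) (tP p O 1 0) n) = _ :=
      map_twConv p (bpParam p O).toRingHom _ _ _
    rw [map_sub, h2, map_finsuppSum, sub_eq_iff_eq_add'] at h1
    rw [Finsupp.sum_mapRange_index (by simp)]
    simp only [map_mul, bpParam_vVar, aP, tP, RingEquiv.toRingHom_eq_coe, RingHom.coe_coe,
      RingEquiv.apply_symm_apply] at h1
    exact h1

/-- The correction term in the cycle `tauCycle`. -/
def tauCorrection (n : ℕ) : ℕ →₀ bp p (Fin 2) := (exists_tau_correction p n).choose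

/-- A cycle that reduces to the generator `τ_n` of the dual Steenrod algebra. -/
def tauCycle (n : ℕ) : EBP p (Fin 2) :=
  gen _ (0, n) -
    ∑ a ∈ Finset.range (n + 1), algebraMap (bp p (Fin 2)) (EBP p (Fin 2)) (t p 1 0 (n - a) ^ p ^ a) * gen _ (1, a) -
    (tauCorrection p n).sum fun k a => algebraMap (bp p (Fin 2)) (EBP p (Fin 2)) a * gen _ (1, k)

theorem del_tauCycle (n : ℕ) : del p (Fin 2) (tauCycle p n) = 0 := by
  have h : ∀ (r : bp p (Fin 2)) (k : ℕ),
      del p (Fin 2) (algebraMap _ _ r * gen _ (1, k)) = algebraMap _ _ (r * v p 1 k) := by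
    intro r k
    rw [← Algebra.smul_def, map_smul, koszul_gen, Algebra.smul_def, ← map_mul]
    rfl
  rw [tauCycle, map_sub, map_sub, koszul_gen, map_sum, map_finsuppSum]
  simp only [h]
  rw [← map_sum, ← map_finsuppSum, ← map_sub, ← map_sub]
  have h1 : v p 0 n = twConv p (v p 1) (t p 1 0) n + (tauCorrection p n).sum fun k a => a * v p 1 k :=
    (exists_tau_correction p n).choose_spec.2.2
  have h2 : twConv p (v p 1) (t p 1 0) n =
      ∑ a ∈ Finset.range (n + 1), t p (1 : Fin 2) 0 (n - a) ^ p ^ a * v p 1 a :=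
    Finset.sum_congr rfl fun a _ => mul_comm _ _
  rw [h2] at h1
  have h3 : vFun p (Fin 2) (0, n) = v p 0 n := rfl
  rw [h3, h1, add_sub_cancel_left]
  exact (congrArg _ (sub_self _)).trans (map_zero _)

theorem tauCycle_mem (n : ℕ) : tauCycle p n ∈ degreePart (ebpGens p (Fin 2)) (vDeg p n + 1) := by
  refine sub_mem (sub_mem (gen_mem p 0 n) (sum_mem fun a ha => ?_)) (sum_mem fun k _ =>
    (exists_tau_correction p n).choose_spec.2.1 k)
  have han : a ≤ n := Nat.lt_succ_iff.mp (Finset.mem_range.mp ha)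
  rw [map_pow, ← vDeg_add p (Fact.out : p.Prime).pos han, add_comm (vDeg p a), add_assoc]
  exact mul_mem_degreePart (pow_mem_degreePart (algebraMap_t_mem p 1 0 _) _) (gen_mem p 1 a)

/-- The correction is known only to exist; any map that kills the ideal does not see it. -/
theorem map_tauCycle {T : Type} [Ring T] (Ψ : EBP p (Fin 2) →+* T)
    (hΨ : ∀ x, red p 1 x = 0 → Ψ (algebraMap _ _ x) = 0) (n : ℕ) :
    Ψ (tauCycle p n) = Ψ (gen _ (0, n)) -
      ∑ a ∈ Finset.range (n + 1), Ψ (algebraMap (bp p (Fin 2)) _ (t p 1 0 (n - a))) ^ p ^ a * Ψ (gen _ (1, a)) := by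
  rw [tauCycle, map_sub, map_sub, map_sum, map_finsuppSum, sub_eq_self.mpr]
  · simp only [map_mul, map_pow]
  · refine Finset.sum_eq_zero fun k _ => ?_
    show Ψ (algebraMap (bp p (Fin 2)) (EBP p (Fin 2)) (tauCorrection p n k) * gen _ (1, k)) = 0
    rw [map_mul, hΨ (tauCorrection p n k) ((exists_tau_correction p n).choose_spec.1 k), zero_mul]

variable {k : ℕ} (e : Fin k × ℕ → (Fin k × ℕ →₀ XiRing p (Fin k)))

theorem milnorRed_ebpMap_algebraMap (f : Fin 2 → Fin (k + 1)) (r : bp p (Fin 2)) :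
    milnorRed p e (ebpMap p f (algebraMap _ _ r)) = algebraMap _ _ (red p k (bpMap p f r)) := by
  rw [ebpMap_algebraMap, milnorRed, extMap_algebraMap]

theorem milnorRed_ebpMap_tauCycle (f : Fin 2 → Fin (k + 1)) (n : ℕ) :
    milnorRed p e (ebpMap p f (tauCycle p n)) =
      ExteriorAlgebra.ι _ (shearLast p e (f 0, n)) -
      ∑ a ∈ Finset.range (n + 1), algebraMap _ (Milnor p (Fin k))
          (red p k (t p (f 1) (f 0) (n - a)) ^ p ^ a) *
        ExteriorAlgebra.ι _ (shearLast p e (f 1, a)) := by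
  have h := map_tauCycle p ((milnorRed p e).comp (ebpMap p f)) (fun x hx => by
    rw [RingHom.comp_apply, milnorRed_ebpMap_algebraMap, red_bpMap_eq_zero p f hx, map_zero]) n
  simp only [RingHom.comp_apply, milnorRed_ebpMap_algebraMap, ebpMap_gen, bpMap_t] at h
  simp only [milnorRed, extMap_gen] at h ⊢
  simpa only [map_pow] using h

/-! ### The equivalences for one, two and three factors -/

theorem ι_single {R X : Type} [CommRing R] (x : X) (r : R) :
    ExteriorAlgebra.ι R (Finsupp.single x r) = algebraMap R (Ext R X) r * gen R x := by
  rw [ι_mem_closure_gen, Finsupp.sum_single_index (by rw [map_zero, zero_mul])]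

theorem ι_shearTwo_zero (n : ℕ) : ExteriorAlgebra.ι _ (shearTwo p (0, n)) =
    ∑ a ∈ Finset.range (n + 1), algebraMap (XiRing p (Fin 2)) (Milnor p (Fin 2)) (xi p 0 (n - a) ^ p ^ a) *
      gen _ (1, a) := by
  rw [shearTwo, if_pos rfl, map_sum]
  exact Finset.sum_congr rfl fun a _ => ι_single _ _

theorem ι_shearZero_mem (k : ℕ) (j : Fin k) (n : ℕ) :
    ExteriorAlgebra.ι _ (shearZero p k (j, n)) ∈ degreePart (milnorGens p (Fin k)) (vDeg p n + 1) := by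
  rw [shearZero, Pi.zero_apply, map_zero]
  exact zero_mem _

theorem ι_shearTwo_mem (j : Fin 2) (n : ℕ) :
    ExteriorAlgebra.ι _ (shearTwo p (j, n)) ∈ degreePart (milnorGens p (Fin 2)) (vDeg p n + 1) := by
  fin_cases j
  · refine (ι_shearTwo_zero p n).symm ▸ sum_mem fun a ha => ?_
    have han : a ≤ n := Nat.lt_succ_iff.mp (Finset.mem_range.mp ha)
    rw [map_pow, ← vDeg_add p (Fact.out : p.Prime).pos han, add_comm (vDeg p a), add_assoc]
    exact mul_mem_degreePart (pow_mem_degreePart (milnor_xi_mem p 0 _) _) (milnor_gen_mem p 1 a)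
  · show ExteriorAlgebra.ι _ 0 ∈ _
    rw [map_zero]
    exact zero_mem _

theorem red_one_t (n : ℕ) : red p 1 (t p 1 0 n) = xi p 0 n := red_t_succ p (0 : Fin 1) n

theorem red_two_t_one_zero (n : ℕ) : red p 2 (t p 1 0 n) = xi p 0 n := red_t_succ p (0 : Fin 2) n

theorem red_two_t_two_one (n : ℕ) : red p 2 (t p 2 1 n) = xi p 1 n := red_t_succ p (1 : Fin 2) n

theorem ι_shearLast_one_zero (n : ℕ) :
    ExteriorAlgebra.ι _ (shearLast p (shearZero p 1) (0, n)) = gen (XiRing p (Fin 1)) (0, n) := by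
  have := shearLast_castSucc p (shearZero p 1) 0 n
  rw [shearZero, Pi.zero_apply, add_zero] at this
  exact congrArg _ this

theorem ι_shearLast_two_zero (n : ℕ) : ExteriorAlgebra.ι _ (shearLast p (shearTwo p) (0, n)) =
    gen (XiRing p (Fin 2)) (0, n) + ∑ a ∈ Finset.range (n + 1),
      algebraMap (XiRing p (Fin 2)) (Milnor p (Fin 2)) (xi p 0 (n - a) ^ p ^ a) * gen _ (1, a) := by
  rw [← ι_shearTwo_zero, gen, ← map_add]
  exact congrArg _ (shearLast_castSucc p (shearTwo p) 0 n)

theorem ι_shearLast_two_one (n : ℕ) : ExteriorAlgebra.ι _ (shearLast p (shearTwo p) (1, n)) =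
    gen (XiRing p (Fin 2)) (1, n) := by
  have := shearLast_castSucc p (shearTwo p) 1 n
  rw [shearTwo, if_neg (by simp), add_zero] at this
  exact congrArg _ this

theorem milnorRed_tauCycle (n : ℕ) :
    milnorRed p (shearZero p 1) (tauCycle p n) = gen _ (0, n) := by
  have h := milnorRed_ebpMap_tauCycle p (shearZero p 1) id n
  simp only [id_eq, shearLast_one_one, map_zero, mul_zero, Finset.sum_const_zero, sub_zero,
    ι_shearLast_one_zero, ebpMap_id] at h
  exact h

/-- This dictates `shearTwo`: the cycle is `μ_n` minus `∑ ξ_{n-a}^{p^a} μ_a` of the middle family up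
to the correction, and the shear cancels that sum. -/
theorem milnorRed_inl_tauCycle (n : ℕ) :
    milnorRed p (shearTwo p) (ebpMap p ![0, 1] (tauCycle p n)) = gen _ (0, n) := by
  have h := milnorRed_ebpMap_tauCycle p (shearTwo p) ![0, 1] n
  simp only [Matrix.cons_val_zero, Matrix.cons_val_one, ι_shearLast_two_zero, ι_shearLast_two_one,
    red_two_t_one_zero, add_sub_cancel_right] at h
  exact h

theorem milnorRed_inr_tauCycle (n : ℕ) :
    milnorRed p (shearTwo p) (ebpMap p ![1, 2] (tauCycle p n)) = gen _ (1, n) := by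
  have h := milnorRed_ebpMap_tauCycle p (shearTwo p) ![1, 2] n
  simp only [Matrix.cons_val_zero, Matrix.cons_val_one, ι_shearLast_two_one, shearLast_two_two,
    map_zero, mul_zero, Finset.sum_const_zero, sub_zero] at h
  exact h

/-- Here the subtracted sum belongs to the last family and vanishes, so the shear remains and
supplies the second part of Milnor's coproduct. -/
theorem milnorRed_comul_tauCycle (n : ℕ) :
    milnorRed p (shearTwo p) (ebpMap p ![0, 2] (tauCycle p n)) =
      gen (XiRing p (Fin 2)) (0, n) + ∑ a ∈ Finset.range (n + 1),
        algebraMap (XiRing p (Fin 2)) (Milnor p (Fin 2)) (xi p 0 (n - a) ^ p ^ a) * gen _ (1, a) := by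
  have h := milnorRed_ebpMap_tauCycle p (shearTwo p) ![0, 2] n
  simp only [Matrix.cons_val_zero, Matrix.cons_val_one, ι_shearLast_two_zero, shearLast_two_two,
    map_zero, mul_zero, Finset.sum_const_zero, sub_zero] at h
  exact h

/-- Interchanging the factors sends the leading `μ_n` to the last family, where it reduces to zero;
only the sum survives. -/
theorem milnorRed_conj_tauCycle (n : ℕ) :
    milnorRed p (shearZero p 1) (ebpMap p ![1, 0] (tauCycle p n)) =
      - ∑ a ∈ Finset.range (n + 1),
        algebraMap (XiRing p (Fin 1)) (Milnor p (Fin 1)) (red p 1 (t p 0 1 (n - a)) ^ p ^ a) * gen _ (0, a) := by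
  have h := milnorRed_ebpMap_tauCycle p (shearZero p 1) ![1, 0] n
  simp only [Matrix.cons_val_zero, Matrix.cons_val_one, ι_shearLast_one_zero, shearLast_one_one,
    map_zero, zero_sub] at h
  exact h

/-- The homology of `EBP_*`. -/
def homologyEquivZero : HEBP p (Fin 1) ≃+* Milnor p (Fin 0) :=
  homologyEquiv p (shearZero_sq p 0) (fun j => j.elim0)

theorem exists_cycle_one (j : Fin 1) (n : ℕ) : ∃ z, del p _ z = 0 ∧
    z ∈ degreePart (ebpGens p (Fin 2)) (vDeg p n + 1) ∧
    milnorRed p (shearZero p 1) z = gen _ (j, n) := by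
  obtain rfl : j = 0 := Subsingleton.elim _ _
  exact ⟨tauCycle p n, del_tauCycle p n, tauCycle_mem p n, milnorRed_tauCycle p n⟩

/-- The homology of `EBP_*EBP`. -/
def homologyEquivOne : HEBP p (Fin 2) ≃+* Milnor p (Fin 1) :=
  homologyEquiv p (shearZero_sq p 1) (exists_cycle_one p)

theorem exists_cycle_two (j : Fin 2) (n : ℕ) : ∃ z, del p _ z = 0 ∧
    z ∈ degreePart (ebpGens p (Fin 3)) (vDeg p n + 1) ∧
    milnorRed p (shearTwo p) z = gen _ (j, n) := by
  have h : ∀ f : Fin 2 → Fin 3, del p _ (ebpMap p f (tauCycle p n)) = 0 := fun f => by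
    rw [del_ebpMap, del_tauCycle, map_zero]
  fin_cases j
  · exact ⟨_, h _, ebpMap_mem_degreePart p _ (tauCycle_mem p n), milnorRed_inl_tauCycle p n⟩
  · exact ⟨_, h _, ebpMap_mem_degreePart p _ (tauCycle_mem p n), milnorRed_inr_tauCycle p n⟩

/-- The homology of `EBP_*EBP ⊗ EBP_*EBP`. -/
def homologyEquivTwo : HEBP p (Fin 3) ≃+* Milnor p (Fin 2) :=
  homologyEquiv p (shearTwo_sq p) (exists_cycle_two p)

end Generators

/-! ## Conjugation -/

section Conjugation

open MvPolynomial

variable (p : ℕ) [Fact p.Prime]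

/-- The recursion defining `conjXi` says that it is a left inverse of `xi` under twisted
convolution. -/
theorem twConv_conjXi (n : ℕ) :
    twConv p (conjXi p) (xi p (0 : Fin 1)) n = if n = 0 then 1 else 0 := by
  rw [twConv, Finset.sum_range_succ, conjXi]
  split_ifs with h
  · subst h
    simp [xi]
  · rw [← Finset.sum_range (fun i => xi p (0 : Fin 1) (n - i) ^ p ^ i * conjXi p i), Nat.sub_self, xi, one_pow, mul_one,
      add_neg_eq_zero]
    exact Finset.sum_congr rfl fun _ _ => mul_comm _ _

/-- Composing the transitions `0 → 1 → 0` gives the identity transition, so the reduced `t` from `0`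
to `1` satisfies the same recursion as `conjXi`. -/
theorem red_t_conj (n : ℕ) : red p 1 (t p 0 1 n) = conjXi p n := by
  induction n using Nat.strong_induction_on with
  | _ n ih =>
    have h1 := red_t p (k := 1) 0 1 0 n
    have h2 : red p 1 (t p 0 0 n) = if n = 0 then 1 else 0 := by
      rw [t_self]; split_ifs <;> simp
    rw [h2, ← twConv_conjXi] at h1
    simp only [red_one_t] at h1
    rw [twConv, twConv, Finset.sum_range_succ, Finset.sum_range_succ,
      Finset.sum_congr rfl fun a ha => by rw [← ih a (Finset.mem_range.mp ha)], Nat.sub_self, xi,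
      one_pow, mul_one, mul_one] at h1
    exact (add_left_cancel h1).symm

/-- The coefficients of `τ_m` in the `conjTau p n` convolve with `xi` to minus the delta sequence at
`m`. By associativity they are minus that delta sequence convolved with the inverse `conjXi`. -/
theorem conjTau_apply (n m : ℕ) : conjTau p n (0, m) =
    - twConv p (fun a => if a = m then 1 else 0) (conjXi p) n := by
  induction n using Nat.strong_induction_on with
  | _ n ih =>
    have h := twConv_assoc p (fun a => if a = m then (1 : XiRing p (Fin 1)) else 0) (conjXi p)
      (xi p 0) n
    rw [funext (twConv_conjXi p), twConv_delta, twConv, Finset.sum_range_succ, Nat.sub_self, xi,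
      one_pow, mul_one] at h
    rw [conjTau, Finsupp.sub_apply, Finsupp.neg_apply, Finsupp.finsetSum_apply,
      ← Finset.sum_range (fun i => ((xi p 0 (n - i) ^ p ^ i : XiRing p (Fin 1)) • conjTau p i) (0, m)),
      Finset.sum_congr rfl fun i hi => by
        rw [Finsupp.smul_apply, ih i (Finset.mem_range.mp hi), smul_neg, smul_eq_mul, mul_comm],
      Finset.sum_neg_distrib, sub_neg_eq_add, Finsupp.single_apply]
    have h' : (if ((0 : Fin 1), n) = (0, m) then (1 : XiRing p (Fin 1)) else 0) =
      if n = m then 1 else 0 := by simp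
    rw [h', ← h]
    ring

theorem ι_conjTau (n : ℕ) : ExteriorAlgebra.ι _ (conjTau p n) =
    - ∑ a ∈ Finset.range (n + 1),
      algebraMap (XiRing p (Fin 1)) (Milnor p (Fin 1)) (conjXi p (n - a) ^ p ^ a) * gen _ (0, a) := by
  have h : conjTau p n =
      - ∑ a ∈ Finset.range (n + 1), Finsupp.single (0, a) (conjXi p (n - a) ^ p ^ a) := by
    ext1 ⟨j, m⟩
    obtain rfl : j = 0 := Subsingleton.elim _ _
    rw [conjTau_apply, Finsupp.neg_apply, Finsupp.finsetSum_apply, twConv]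
    congr 1
    refine Finset.sum_congr rfl fun a _ => ?_
    rw [Finsupp.single_apply]
    by_cases ham : a = m <;> simp [ham]
  rw [h, map_neg, map_sum]
  simp only [ι_single]

end Conjugation

/-! ## The isomorphism with the dual Steenrod algebra -/

section Isomorphism

open MvPolynomial

variable (p : ℕ)

/-- The homology class of `t_n`. -/
def tClass {I : Type} (i j : I) (n : ℕ) : HEBP p I :=
  homologyClass p (koszul_algebraMap _ (t p i j n))

theorem milnorGens_zero_eq : ∀ g ∈ milnorGens p (Fin 0), ∃ c : ZMod p, g = (0, milnorC p (Fin 0) c) := by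
  rintro _ ((⟨c, rfl⟩ | ⟨j, n, rfl⟩) | ⟨j, n, rfl⟩)
  · exact ⟨c, rfl⟩
  · exact j.elim0
  · exact j.elim0

variable [Fact p.Prime]

/-- The homology class of `tauCycle`. -/
def tauClass (n : ℕ) : HEBP p (Fin 2) := homologyClass p (del_tauCycle p n)

theorem homologyEquivOne_tClass (n : ℕ) :
    homologyEquivOne p (tClass p 1 0 n) =
      algebraMap (XiRing p (Fin 1)) (Milnor p (Fin 1)) (xi p 0 n) := by
  show milnorRed p (shearZero p 1) (algebraMap (bp p (Fin 2)) _ (t p 1 0 n)) = _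
  rw [milnorRed, extMap_algebraMap, red_one_t]

theorem homologyEquivOne_tauClass (n : ℕ) :
    homologyEquivOne p (tauClass p n) = gen _ (0, n) := milnorRed_tauCycle p n

/-- Through `homologyEquivOne` the homology is generated over `F_p` by these classes, and a ring
homomorphism has no choice on `F_p`. -/
theorem hebp_ringHom_ext {T : Type} [Ring T] {F G : HEBP p (Fin 2) →+* T}
    (h1 : ∀ n, F (tClass p 1 0 n) = G (tClass p 1 0 n))
    (h2 : ∀ n, F (tauClass p n) = G (tauClass p n)) : F = G := by
  have h : F.comp (homologyEquivOne p).symm.toRingHom =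
      G.comp (homologyEquivOne p).symm.toRingHom := by
    refine ext_ringHom (fun r => ?_) (fun x => ?_)
    · induction r using MvPolynomial.induction_on with
      | C c =>
        exact RingHom.congr_fun (Subsingleton.elim
          ((F.comp (homologyEquivOne p).symm.toRingHom).comp (milnorC p (Fin 1)))
          ((G.comp (homologyEquivOne p).symm.toRingHom).comp (milnorC p (Fin 1)))) c
      | add a b ha hb => rw [map_add, map_add, map_add, ha, hb]
      | mul_X a x ha =>
        rw [map_mul, map_mul, map_mul, ha]
        congr 1
        obtain ⟨j, n⟩ := x
        obtain rfl : j = 0 := Subsingleton.elim _ _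
        have h : (homologyEquivOne p).symm (algebraMap (XiRing p (Fin 1)) _ (X (0, n))) =
            tClass p 1 0 (n + 1) :=
          (RingEquiv.symm_apply_eq _).mpr (homologyEquivOne_tClass p (n + 1)).symm
        show F ((homologyEquivOne p).symm _) = G ((homologyEquivOne p).symm _)
        rw [h, h1]
    · obtain ⟨j, n⟩ := x
      obtain rfl : j = 0 := Subsingleton.elim _ _
      have h : (homologyEquivOne p).symm (gen _ (0, n)) = tauClass p n :=
        (RingEquiv.symm_apply_eq _).mpr (homologyEquivOne_tauClass p n).symm
      show F ((homologyEquivOne p).symm _) = G ((homologyEquivOne p).symm _)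
      rw [h, h2]
  ext x
  have := RingHom.congr_fun h (homologyEquivOne p x)
  simpa using this

/-- The homology of `EBP_*` is the prime field. -/
def homologyBase : HEBP p (Fin 1) ≃+* ZMod p := (homologyEquivZero p).trans (milnorCEquiv p).symm

/-- Compatibility with both units is automatic, since the base is the prime field. -/
theorem homologyBase_ringHom_ext {T : Type} [Ring T] (F : HEBP p (Fin 1) →+* T) (G : ZMod p →+* T)
    (b : HEBP p (Fin 1)) : F b = G (homologyBase p b) := by
  have := RingHom.congr_fun (Subsingleton.elim (F.comp (homologyBase p).symm.toRingHom) G)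
    (homologyBase p b)
  simpa using this

theorem homologyEquivOne_conj (x : HEBP p (Fin 2)) :
    homologyEquivOne p (hebpMap p ![1, 0] x) = milnorConj p (homologyEquivOne p x) := by
  refine RingHom.congr_fun (f := (homologyEquivOne p).toRingHom.comp (hebpMap p ![1, 0]))
    (g := (milnorConj p).comp (homologyEquivOne p).toRingHom)
    (hebp_ringHom_ext p (fun n => ?_) (fun n => ?_)) x
  · show milnorRed p (shearZero p 1) (ebpMap p ![1, 0] (algebraMap (bp p (Fin 2)) _ (t p 1 0 n))) =
      milnorConj p (homologyEquivOne p (tClass p 1 0 n))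
    rw [milnorRed_ebpMap_algebraMap, bpMap_t, homologyEquivOne_tClass, milnorConj,
      extMap_algebraMap]
    refine congrArg _ ((red_t_conj p n).trans ?_)
    cases n with
    | zero => rw [xi, map_one, conjXi, if_pos rfl]
    | succ n => rw [xi, eval₂Hom_X']
  · show milnorRed p (shearZero p 1) (ebpMap p ![1, 0] (tauCycle p n)) =
      milnorConj p (homologyEquivOne p (tauClass p n))
    rw [milnorRed_conj_tauCycle, homologyEquivOne_tauClass, milnorConj, extMap_gen, ι_conjTau]
    simp only [red_t_conj]

theorem homologyBase_counit (x : HEBP p (Fin 2)) :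
    homologyBase p (hebpMap p ![0, 0] x) = milnorCounit p (homologyEquivOne p x) := by
  refine RingHom.congr_fun (f := (homologyBase p).toRingHom.comp (hebpMap p ![0, 0]))
    (g := (milnorCounit p).comp (homologyEquivOne p).toRingHom)
    (hebp_ringHom_ext p (fun n => ?_) (fun n => ?_)) x
  · show (milnorCEquiv p).symm (milnorRed p (shearZero p 0)
      (ebpMap p ![0, 0] (algebraMap (bp p (Fin 2)) _ (t p 1 0 n)))) =
      milnorCounit p (homologyEquivOne p (tClass p 1 0 n))
    rw [milnorRed_ebpMap_algebraMap, bpMap_t, homologyEquivOne_tClass]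
    have h : t p (![(0 : Fin 1), 0] 1) (![(0 : Fin 1), 0] 0) n = if n = 0 then 1 else 0 :=
      t_self p (0 : Fin 1) n
    rw [h, milnorCounit, RingHom.comp_apply]
    have h' : ∀ r, (ExteriorAlgebra.algebraMapInv (R := XiRing p (Fin 1))
      (M := Fin 1 × ℕ →₀ XiRing p (Fin 1))).toRingHom (algebraMap _ _ r) = r :=
      ExteriorAlgebra.algebraMap_leftInverse _
    rw [h']
    cases n with
    | zero => simp [xi]
    | succ n => simp [xi]
  · show (milnorCEquiv p).symm (milnorRed p (shearZero p 0) (ebpMap p ![0, 0] (tauCycle p n))) =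
      milnorCounit p (homologyEquivOne p (tauClass p n))
    have h0 : ∀ x, shearLast p (shearZero p 0) x = 0 := fun x => Finsupp.ext fun y => y.1.elim0
    have h' : (ExteriorAlgebra.algebraMapInv (R := XiRing p (Fin 1))
      (M := Fin 1 × ℕ →₀ XiRing p (Fin 1))).toRingHom (gen _ (0, n)) = 0 := by
      show ExteriorAlgebra.algebraMapInv (ExteriorAlgebra.ι _ _) = _
      simp [ExteriorAlgebra.algebraMapInv]
    rw [milnorRed_ebpMap_tauCycle, homologyEquivOne_tauClass, milnorCounit, RingHom.comp_apply, h']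
    simp [h0]

theorem homologyEquivTwo_inl (x : HEBP p (Fin 2)) :
    homologyEquivTwo p (hebpMap p ![0, 1] x) = milnorMap p ![0] (homologyEquivOne p x) := by
  refine RingHom.congr_fun (f := (homologyEquivTwo p).toRingHom.comp (hebpMap p ![0, 1]))
    (g := (milnorMap p ![0]).comp (homologyEquivOne p).toRingHom)
    (hebp_ringHom_ext p (fun n => ?_) (fun n => ?_)) x
  · show milnorRed p (shearTwo p) (ebpMap p ![0, 1] (algebraMap (bp p (Fin 2)) _ (t p 1 0 n))) =
      milnorMap p ![0] (homologyEquivOne p (tClass p 1 0 n))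
    rw [milnorRed_ebpMap_algebraMap, bpMap_t, homologyEquivOne_tClass, milnorMap_algebraMap]
    refine congrArg _ ((red_two_t_one_zero p n).trans ?_)
    cases n with
    | zero => rw [xi, xi, map_one]
    | succ n => rw [xi, xi, rename_X]; rfl
  · show milnorRed p (shearTwo p) (ebpMap p ![0, 1] (tauCycle p n)) =
      milnorMap p ![0] (homologyEquivOne p (tauClass p n))
    rw [milnorRed_inl_tauCycle, homologyEquivOne_tauClass, milnorMap_gen]
    rfl

theorem homologyEquivTwo_inr (x : HEBP p (Fin 2)) :
    homologyEquivTwo p (hebpMap p ![1, 2] x) = milnorMap p ![1] (homologyEquivOne p x) := by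
  refine RingHom.congr_fun (f := (homologyEquivTwo p).toRingHom.comp (hebpMap p ![1, 2]))
    (g := (milnorMap p ![1]).comp (homologyEquivOne p).toRingHom)
    (hebp_ringHom_ext p (fun n => ?_) (fun n => ?_)) x
  · show milnorRed p (shearTwo p) (ebpMap p ![1, 2] (algebraMap (bp p (Fin 2)) _ (t p 1 0 n))) =
      milnorMap p ![1] (homologyEquivOne p (tClass p 1 0 n))
    rw [milnorRed_ebpMap_algebraMap, bpMap_t, homologyEquivOne_tClass, milnorMap_algebraMap]
    refine congrArg _ ((red_two_t_two_one p n).trans ?_)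
    cases n with
    | zero => rw [xi, xi, map_one]
    | succ n => rw [xi, xi, rename_X]; rfl
  · show milnorRed p (shearTwo p) (ebpMap p ![1, 2] (tauCycle p n)) =
      milnorMap p ![1] (homologyEquivOne p (tauClass p n))
    rw [milnorRed_inr_tauCycle, homologyEquivOne_tauClass, milnorMap_gen]
    rfl

theorem homologyEquivTwo_comul (x : HEBP p (Fin 2)) :
    homologyEquivTwo p (hebpMap p ![0, 2] x) = milnorComul p (homologyEquivOne p x) := by
  refine RingHom.congr_fun (f := (homologyEquivTwo p).toRingHom.comp (hebpMap p ![0, 2]))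
    (g := (milnorComul p).comp (homologyEquivOne p).toRingHom)
    (hebp_ringHom_ext p (fun n => ?_) (fun n => ?_)) x
  · show milnorRed p (shearTwo p) (ebpMap p ![0, 2] (algebraMap (bp p (Fin 2)) _ (t p 1 0 n))) =
      milnorComul p (homologyEquivOne p (tClass p 1 0 n))
    rw [milnorRed_ebpMap_algebraMap, bpMap_t, homologyEquivOne_tClass, milnorComul,
      extMap_algebraMap]
    -- Composing from right to left through the middle family puts the `p^i`-th powers on the left
    -- tensor factor, as in Milnor's formula.
    refine congrArg _ ((red_t p (k := 2) 2 1 0 n).trans ?_)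
    simp only [red_two_t_one_zero, red_two_t_two_one]
    cases n with
    | zero => rw [xi, map_one]; simp [twConv, xi]
    | succ n =>
      rw [xi, eval₂Hom_X']
      exact Finset.sum_congr rfl fun _ _ => mul_comm _ _
  · show milnorRed p (shearTwo p) (ebpMap p ![0, 2] (tauCycle p n)) =
      milnorComul p (homologyEquivOne p (tauClass p n))
    rw [milnorRed_comul_tauCycle, homologyEquivOne_tauClass, milnorComul, extMap_gen, map_add,
      map_sum]
    simp only [ι_single, map_one, one_mul]

theorem homologyBase_mem_degreePart_iff (d : ℕ) (x : HEBP p (Fin 1)) :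
    homologyBase p x ∈ degreePart {x : ℕ × ZMod p | x.1 = 0} d ↔
      x ∈ homologyClasses (vFun p (Fin 1)) (degreePart (ebpGens p (Fin 1)) d) := by
  rw [← homologyRed_mem_degreePart_iff p (shearZero_sq p 0) (ι_shearZero_mem p 0)
    (fun j => j.elim0)]
  constructor
  · intro h
    have := map_mem_degreePart (H := milnorGens p (Fin 0)) (milnorCEquiv p).toRingHom (fun g hg => by
      rw [show g.1 = 0 from hg]
      exact milnor_C_mem p g.2) h
    have h2 : milnorCEquiv p (homologyBase p x) = homologyRed p (shearZero p 0) x :=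
      (milnorCEquiv p).apply_symm_apply _
    exact h2 ▸ this
  · intro h
    refine map_mem_degreePart (milnorCEquiv p).symm.toRingHom (fun g hg => ?_) h
    obtain ⟨c, rfl⟩ := milnorGens_zero_eq p g hg
    exact mem_degreePart_of_mem (g := (0, _)) rfl

/-- The homology of `(EBP_*, EBP_*EBP)` is the dual Steenrod algebra. -/
def homologyHopfIso : (homologyHopf p).Iso (dualSteenrod p) where
  base := homologyBase p
  total := homologyEquivOne p
  square := homologyEquivTwo p
  base_deg := homologyBase_mem_degreePart_iff p
  total_deg := homologyRed_mem_degreePart_iff p (shearZero_sq p 1) (ι_shearZero_mem p 1)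
    (exists_cycle_one p)
  square_deg := homologyRed_mem_degreePart_iff p (shearTwo_sq p) (ι_shearTwo_mem p)
    (exists_cycle_two p)
  leftUnit := homologyBase_ringHom_ext p ((homologyEquivOne p).toRingHom.comp (hebpMap p ![0]))
    (milnorUnit p)
  rightUnit := homologyBase_ringHom_ext p ((homologyEquivOne p).toRingHom.comp (hebpMap p ![1]))
    (milnorUnit p)
  counit := homologyBase_counit p
  conj := homologyEquivOne_conj p
  inl := homologyEquivTwo_inl p
  inr := homologyEquivTwo_inr p
  comul := homologyEquivTwo_comul p

end Isomorphism

end EBPHopf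

end

theorem mainTheorem4 (p : ℕ) [Fact p.Prime] (hp : 2 < p) :
    Function.Bijective (EBPHopf.tPoly p) ∧
    Function.Bijective (EBPHopf.muTau p) ∧
    (EBPHopf.coopHopf p).IsTensorSquare ∧
    (EBPHopf.homologyHopf p).IsTensorSquare ∧
    (EBPHopf.dualSteenrod p).IsTensorSquare ∧
    Nonempty ((EBPHopf.homologyHopf p).Iso (EBPHopf.dualSteenrod p)) :=
  ⟨EBPHopf.tPoly_bijective p, EBPHopf.muTau_bijective p, EBPHopf.coopHopf_isTensorSquare p,
    (EBPHopf.homologyHopfIso p).isTensorSquare (EBPHopf.dualSteenrod_isTensorSquare p),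
    EBPHopf.dualSteenrod_isTensorSquare p, ⟨EBPHopf.homologyHopfIso p⟩⟩
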